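/- A Wang tile is a quadruple $(t_w,t_e,t_s,t_n)\in H^2\times V^2$ of colours of its west, east, south and north edges, where $H,V$ are finite sets; a Wang set is a set of Wang tiles. A tiling of the plane by a Wang set is a map $f$ from $\mathbb{Z}^2$ to its tiles such that the east colour of $f(x,y)$ equals the west colour of $f(x+1,y)$ and the north colour of $f(x,y)$ equals the south colour of $f(x,y+1)$ for all $(x,y)\in\mathbb{Z}^2$. It is periodic if there is $(u,v)\in\mathbb{Z}^2\setminus\{(0,0)\}$ with $f(x,y)=f(x+u,y+v)$ for all $(x,y)$. A Wang set is aperiodic if it tiles the plane and no tiling of the plane by it is periodic. Let $\mathcal{T}$ be the Wang set with $H=\{0,1,2,3\}$, $V=\{0,1,2,3,4\}$ and the tiles $(t_w,t_e,t_s,t_n)$: $$(0,0,1,0),\ (0,3,2,1),\ (1,0,2,2),\ (1,1,4,2),\ (1,3,2,3),\ (3,0,1,1),\ (3,1,1,1),\ (3,1,2,2),\ (3,3,3,1),\ (2,2,1,4),\ (2,2,0,2).$$ Let $\mathcal{T}'$ be the Wang set with $H=V=\{0,1,2,3\}$ and the tiles $$(0,0,1,0),\ (0,3,2,1),\ (1,0,2,2),\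 (1,1,0,2),\ (1,3,2,3),\ (3,0,1,1),\ (3,1,1,1),\ (3,1,2,2),\ (3,3,3,1),\ (2,2,1,0),\ (2,2,0,2).$$ **Theorem.** Both $\mathcal{T}$ and $\mathcal{T}'$ have exactly 11 tiles, $\mathcal{T}'$ is obtained from $\mathcal{T}$ by merging the vertical colours $4$ and $0$ into $0$ (horizontal colours being unchanged), and the Wang set $\mathcal{T}'$ is aperiodic. -/

import Mathlib

/-- A Wang tile: a unit square whose west and east edges carry colours in `H` and whose
south and north edges carry colours in `V`. -/
@[ext]
structure WangTile (H V : Type) where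
  /-- the colour of the west edge -/
  w : H
  /-- the colour of the east edge -/
  e : H
  /-- the colour of the south edge -/
  s : V
  /-- the colour of the north edge -/
  n : V
deriving DecidableEq

/-- A Wang set over the finite sets of colours `H` and `V`: a set of Wang tiles. -/
structure WangSet (H V : Type) [Fintype H] [Fintype V] where
  /-- the tiles of the Wang set -/
  tiles : Finset (WangTile H V)

namespace WangSet

/-- `f` is a tiling of the plane by `T`: every cell of `ℤ²` receives a tile of `T`, and contiguous
edges have the same colour. Tiles are placed by translation only. -/
def IsTiling {H V : Type} [Fintype H] [Fintype V] (T : WangSet H V)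
    (f : ℤ × ℤ → WangTile H V) : Prop :=
  (∀ x y : ℤ, f (x, y) ∈ T.tiles) ∧
  (∀ x y : ℤ, (f (x, y)).e = (f (x + 1, y)).w) ∧
  (∀ x y : ℤ, (f (x, y)).n = (f (x, y + 1)).s)

/-- `f` has a nonzero period vector. -/
def IsPeriodicTiling {H V : Type} (f : ℤ × ℤ → WangTile H V) : Prop :=
  ∃ u v : ℤ, (u, v) ≠ (0, 0) ∧ ∀ x y : ℤ, f (x, y) = f (x + u, y + v)

/-- A Wang set tiles the plane if there is a tiling of the plane by it. -/
def TilesPlane {H V : Type} [Fintype H] [Fintype V] (T : WangSet H V) : Prop :=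
  ∃ f, T.IsTiling f

/-- A Wang set is aperiodic if it tiles the plane and no tiling by it is periodic. -/
def IsAperiodic {H V : Type} [Fintype H] [Fintype V] (T : WangSet H V) : Prop :=
  T.TilesPlane ∧ ∀ f, T.IsTiling f → ¬ IsPeriodicTiling f

/-- The Wang set obtained by applying `φ` to the colours of the south and north edges of all
tiles. -/
def mapVertical {H V V' : Type} [Fintype H] [Fintype V] [Fintype V'] [DecidableEq H]
    [DecidableEq V'] (φ : V → V') (T : WangSet H V) : WangSet H V' :=
  ⟨T.tiles.image fun t => ⟨t.w, t.e, φ t.s, φ t.n⟩⟩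

end WangSet

/-- The first set `𝒯`, with four horizontal and five vertical colours; each tile is listed as
`⟨west, east, south, north⟩`. -/
def wangT : WangSet (Fin 4) (Fin 5) :=
  ⟨{⟨0, 0, 1, 0⟩, ⟨0, 3, 2, 1⟩, ⟨1, 0, 2, 2⟩, ⟨1, 1, 4, 2⟩, ⟨1, 3, 2, 3⟩, ⟨3, 0, 1, 1⟩,
    ⟨3, 1, 1, 1⟩, ⟨3, 1, 2, 2⟩, ⟨3, 3, 3, 1⟩, ⟨2, 2, 1, 4⟩, ⟨2, 2, 0, 2⟩}⟩

/-- The second set `𝒯'`, with four horizontal and four vertical colours; each tile is listed as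
`⟨west, east, south, north⟩`. -/
def wangT' : WangSet (Fin 4) (Fin 4) :=
  ⟨{⟨0, 0, 1, 0⟩, ⟨0, 3, 2, 1⟩, ⟨1, 0, 2, 2⟩, ⟨1, 1, 0, 2⟩, ⟨1, 3, 2, 3⟩, ⟨3, 0, 1, 1⟩,
    ⟨3, 1, 1, 1⟩, ⟨3, 1, 2, 2⟩, ⟨3, 3, 3, 1⟩, ⟨2, 2, 1, 0⟩, ⟨2, 2, 0, 2⟩}⟩

/-- The map of vertical colours that sends `4` to `0` and fixes `0, 1, 2, 3`. -/
def mergeFourZero : Fin 5 → Fin 4 := ![0, 1, 2, 3, 0]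

/-! Read every row of a tiling as a bi-infinite path of a transducer from its south colours to its
north colours. Rows that read like the two tiles with horizontal colour 2 (`TypeOne`) recur after
four or five rows (`IsTilingRows.next`), so they cut the plane into strips B of four rows and A of
five rows. Finite computations with transducers exclude BB, AAA and ABABABA. Hence pairs AA
alternate with single strips B or triples BAB.

These three pieces AA, B, BAB are strips of levels 1, 0, 2 of a Fibonacci hierarchy. A strip of any
level is a bi-infinite word in five blocks with marks on their lower and upper sides, where lengths
and mark positions are linear in two consecutive Fibonacci numbers `a`, `b` and a parity `s`
(`StripRel`). Strips that touch have the same marks on their common side. Comparing distances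
between marks shows that strips of levels `m + 1`, `m`, `m + 1` on top of each other form a strip of
level `m + 3` (`StripRel.combine`); conversely each strip of level `m + 3` splits in this way
(`StripRel.split`). In the decompositions considered, strips whose levels have equal parity never
touch, and the stack `m + 1`, `m`, `m + 1`, `m`, `m + 1` is impossible. So every strip of level `m`
can be absorbed, and a decomposition into levels `m`, `m + 1`, `m + 2` yields one into levels `m +
1`, `m + 2`, `m + 3` (`Decomposes.coarsen_decomposes`).

The coarser decompositions are determined by the tiling, so a period of the tiling preserves all of
them. Strips become arbitrarily high, which excludes periods with a vertical component; the two
sides of a strip have no common period of size at most `b - 3`, which excludes horizontal ones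
(`Decomposes.not_period`). For existence, levels 0, 1, 2 are filled with explicit tiles, splitting
reduces all higher levels to these, and a compactness argument turns arbitrarily high strips into a
tiling of the plane (`tilesPlane`). -/

/-! ### Bi-infinite sequences of integers. -/

/-- A total and co-total relation has a bi-infinite orbit through every point. -/
theorem exists_int_orbit {α : Type*} (R : α → α → Prop) (hs : ∀ x, ∃ y, R x y)
    (hp : ∀ x, ∃ y, R y x) (x₀ : α) : ∃ f : ℤ → α, f 0 = x₀ ∧ ∀ k, R (f k) (f (k + 1)) := by
  choose s hs using hs
  choose r hr using hp
  refine ⟨fun k => match k with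
    | Int.ofNat n => s^[n] x₀
    | Int.negSucc n => r^[n + 1] x₀, rfl, ?_⟩
  intro k
  match k with
  | Int.ofNat n =>
    have : (Int.ofNat n + 1 : ℤ) = Int.ofNat (n + 1) := rfl
    simp only [this, Function.iterate_succ_apply']
    exact hs _
  | Int.negSucc 0 => exact hr _
  | Int.negSucc (n + 1) =>
    have : (Int.negSucc (n + 1) + 1 : ℤ) = Int.negSucc n := by omega
    simp only [this]
    rw [Function.iterate_succ_apply' r (n + 1)]
    exact hr _

/-- Every integer function has a bi-infinite partial sum. -/
theorem exists_int_partialSum (g : ℤ → ℤ) :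
    ∃ K : ℤ → ℤ, K 0 = 0 ∧ ∀ k, K (k + 1) = K k + g k := by
  -- The orbit runs through pairs (index, partial sum), because the increment depends on the index.
  obtain ⟨f, h0, hf⟩ := exists_int_orbit (α := ℤ × ℤ)
    (fun x y => y.1 = x.1 + 1 ∧ y.2 = x.2 + g x.1)
    (fun x => ⟨(x.1 + 1, x.2 + g x.1), rfl, rfl⟩)
    (fun x => ⟨(x.1 - 1, x.2 - g (x.1 - 1)), by simp, by simp⟩) (0, 0)
  have h1 : ∀ k, (f k).1 = k := by
    intro k
    induction k using Int.induction_on with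
    | zero => simp [h0]
    | succ n ih => rw [(hf n).1, ih]
    | pred n ih =>
      have := (hf (-(n : ℤ) - 1)).1
      rw [sub_add_cancel, ih] at this
      omega
  refine ⟨fun k => (f k).2, by simp [h0], fun k => ?_⟩
  have := (hf k).2
  rwa [h1] at this

theorem add_le_of_strictMono {κ : ℤ → ℤ} (h : StrictMono κ) (k : ℤ) (n : ℕ) :
    κ k + n ≤ κ (k + n) := by
  induction n with
  | zero => simp
  | succ n ih =>
    have : κ (k + n) < κ (k + (n + 1 : ℕ)) := h (by push_cast; omega)
    push_cast at *
    omega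

/-- Every integer lies in exactly one of the intervals cut out by a strictly increasing
sequence. -/
theorem exists_mem_interval {κ : ℤ → ℤ} (h : StrictMono κ) (m : ℤ) :
    ∃ k, κ k ≤ m ∧ m < κ (k + 1) := by
  have hb : ∃ b : ℤ, ∀ z, κ z ≤ m → z ≤ b := by
    refine ⟨|m - κ 0|, fun z hz => ?_⟩
    by_contra hlt
    push Not at hlt
    have h0 : 0 ≤ |m - κ 0| := abs_nonneg _
    have h1 := add_le_of_strictMono h 0 z.toNat
    rw [Int.toNat_of_nonneg (by omega), zero_add] at h1
    have := le_abs_self (m - κ 0)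
    omega
  have hi : ∃ z, κ z ≤ m := by
    refine ⟨-((κ 0 - m).toNat : ℤ), ?_⟩
    have h1 := add_le_of_strictMono h (-((κ 0 - m).toNat : ℤ)) (κ 0 - m).toNat
    rw [neg_add_cancel] at h1
    omega
  obtain ⟨k, hk, hmax⟩ := Int.exists_greatest_of_bdd hb hi
  refine ⟨k, hk, ?_⟩
  by_contra hcon
  have := hmax (k + 1) (by omega)
  omega

theorem interval_unique {κ : ℤ → ℤ} (h : StrictMono κ) {m k l : ℤ} (hk : κ k ≤ m)
    (hk' : m < κ (k + 1)) (hl : κ l ≤ m) (hl' : m < κ (l + 1)) : k = l := by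
  rcases lt_trichotomy k l with hkl | hkl | hkl
  · have := h.monotone (show k + 1 ≤ l by omega); omega
  · exact hkl
  · have := h.monotone (show l + 1 ≤ k by omega); omega

/-- A set of integers, unbounded below, in which every element has a next one related to it,
can be enumerated by a bi-infinite sequence with consecutive terms related. -/
theorem exists_consecutive {V : Set ℤ} {Good : ℤ → ℤ → Prop} (hb : ∀ n, ∃ v ∈ V, v ≤ n)
    (hn : ∀ v ∈ V, ∃ v' ∈ V, v < v' ∧ (∀ w, v < w → w < v' → w ∉ V) ∧ Good v v') :
    ∃ κ : ℤ → ℤ, ∀ k, κ k ∈ V ∧ κ k < κ (k + 1) ∧ Good (κ k) (κ (k + 1)) := by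
  obtain ⟨v₀, hv₀, -⟩ := hb 0
  obtain ⟨f, -, hf⟩ := exists_int_orbit (α := V) (fun x y => x.1 < y.1 ∧ Good x.1 y.1)
    (fun x => by
      obtain ⟨v', hv', h1, -, h2⟩ := hn x.1 x.2
      exact ⟨⟨v', hv'⟩, h1, h2⟩)
    (fun x => by
      -- The predecessor of `x` is the greatest element `u` of `V` below `x`: the successor of `u`
      -- can neither precede `x`, by maximality, nor jump over it.
      obtain ⟨u, ⟨huV, hux⟩, hu⟩ := Int.exists_greatest_of_bdd
        (P := fun z => z ∈ V ∧ z < x.1) ⟨x.1, fun z hz => hz.2.le⟩ (by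
          obtain ⟨v, hv, hle⟩ := hb (x.1 - 1)
          exact ⟨v, hv, by omega⟩)
      obtain ⟨v', hv', h1, h2, h3⟩ := hn u huV
      have : v' = x.1 := by
        rcases lt_trichotomy v' x.1 with h | h | h
        · have := hu v' ⟨hv', h⟩
          omega
        · exact h
        · exact absurd x.2 (h2 _ hux h)
      subst this
      exact ⟨⟨u, huV⟩, h1, h3⟩) ⟨v₀, hv₀⟩
  exact ⟨fun k => (f k).1, fun k => ⟨(f k).2, (hf k).1, (hf k).2⟩⟩

/-! ### Layouts of marked blocks, and matching of marks between two layouts. -/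

/-- The five kinds of blocks of a strip. -/
inductive Blk
  | A | B | C | D | E
deriving DecidableEq

/-- Lengths, and positions and widths of the marks of the blocks. A block of width `0` is
unmarked. -/
structure MarkData where
  /-- length of a block -/
  ln : Blk → ℤ
  /-- start of the mark -/
  hd : Blk → ℤ
  /-- width of the mark -/
  wd : Blk → ℤ

namespace MarkData

/-- Marks are at least two wide, and leave free the first place of their block. -/
def Wf (M : MarkData) : Prop :=
  ∀ t, 1 ≤ M.ln t ∧ (M.wd t = 0 ∨ 2 ≤ M.wd t ∧ 1 ≤ M.hd t ∧ M.hd t + M.wd t ≤ M.ln t)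

/-- The sequence of blocks `t` is laid out at the positions `p`. -/
def Layout (M : MarkData) (p : ℤ → ℤ) (t : ℤ → Blk) : Prop :=
  ∀ k, p (k + 1) = p k + M.ln (t k)

/-- The offset `j` lies in the mark of the block `t`. -/
def InMark (M : MarkData) (t : Blk) (j : ℤ) : Prop :=
  M.hd t ≤ j ∧ j < M.hd t + M.wd t

/-- The union of all marks. -/
def zone (M : MarkData) (p : ℤ → ℤ) (t : ℤ → Blk) : Set ℤ :=
  {i | ∃ k, M.InMark (t k) (i - p k)}

/-- The mark of block `k` of one layout is that of block `j` of another. -/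
def Match (M M' : MarkData) (p : ℤ → ℤ) (t : ℤ → Blk) (p' : ℤ → ℤ) (t' : ℤ → Blk)
    (k j : ℤ) : Prop :=
  p k + M.hd (t k) = p' j + M'.hd (t' j) ∧ M.wd (t k) = M'.wd (t' j) ∧ M.wd (t k) ≠ 0

theorem Match.symm {M M' : MarkData} {p : ℤ → ℤ} {t : ℤ → Blk} {p' : ℤ → ℤ} {t' : ℤ → Blk}
    {k j : ℤ} (h : Match M M' p t p' t' k j) : Match M' M p' t' p t j k :=
  ⟨h.1.symm, h.2.1.symm, h.2.1 ▸ h.2.2⟩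

variable {M M' : MarkData} {p p' : ℤ → ℤ} {t t' : ℤ → Blk}

theorem Layout.strictMono (hM : M.Wf) (h : M.Layout p t) : StrictMono p :=
  strictMono_int_of_lt_succ fun k => by have := h k; have := (hM (t k)).1; omega

/-- Marks of different blocks are separated. -/
theorem Layout.sep (hM : M.Wf) (h : M.Layout p t) {k l : ℤ} (hkl : k < l)
    (hk : M.wd (t k) ≠ 0) (hl : M.wd (t l) ≠ 0) :
    p k + M.hd (t k) + M.wd (t k) < p l + M.hd (t l) := by
  have h1 := (h.strictMono hM).monotone (show k + 1 ≤ l by omega)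
  have h2 := h k
  have h3 := hM (t k)
  have h4 := hM (t l)
  omega

/-- Marks of one layout are separated by free places, so they are the maximal runs of its zone. If
two overlapping marks of the two layouts differed in an end, a place adjacent to one of them would
lie in the zone and hence in a second mark touching the first. -/
theorem match_exists (hM : M.Wf) (hM' : M'.Wf) (h : M.Layout p t) (h' : M'.Layout p' t')
    (hz : M.zone p t = M'.zone p' t') {k : ℤ} (hk : M.wd (t k) ≠ 0) :
    ∃ j, Match M M' p t p' t' k j := by
  have hin : ∀ (M : MarkData) (p : ℤ → ℤ) (t : ℤ → Blk) (i : ℤ), i ∈ M.zone p t →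
      ∃ k, M.wd (t k) ≠ 0 ∧ p k + M.hd (t k) ≤ i ∧ i < p k + M.hd (t k) + M.wd (t k) := by
    rintro M p t i ⟨k, h1, h2⟩
    exact ⟨k, by omega, by omega, by omega⟩
  have hout : ∀ (M : MarkData) (p : ℤ → ℤ) (t : ℤ → Blk) (i k : ℤ), p k + M.hd (t k) ≤ i →
      i < p k + M.hd (t k) + M.wd (t k) → i ∈ M.zone p t := by
    intro M p t i k h1 h2
    exact ⟨k, by omega, by omega⟩
  have hw := hM (t k)
  obtain ⟨j, hj0, hj1, hj2⟩ := hin M' p' t' (p k + M.hd (t k))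
    (hz ▸ hout M p t _ k le_rfl (by omega))
  have hw' := hM' (t' j)
  have hst : p k + M.hd (t k) = p' j + M'.hd (t' j) := by
    by_contra hne
    obtain ⟨l, hl0, hl1, hl2⟩ := hin M p t (p k + M.hd (t k) - 1)
      (hz ▸ hout M' p' t' _ j (by omega) (by omega))
    rcases lt_trichotomy k l with hkl | rfl | hkl
    · have := h.sep hM hkl hk hl0; omega
    · omega
    · have := h.sep hM hkl hl0 hk; omega
  refine ⟨j, hst, ?_, hk⟩
  rcases lt_trichotomy (M.wd (t k)) (M'.wd (t' j)) with hlt | heq | hlt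
  · obtain ⟨l, hl0, hl1, hl2⟩ := hin M p t (p k + M.hd (t k) + M.wd (t k))
      (hz ▸ hout M' p' t' _ j (by omega) (by omega))
    rcases lt_trichotomy k l with hkl | rfl | hkl
    · have := h.sep hM hkl hk hl0; omega
    · omega
    · have := h.sep hM hkl hl0 hk; omega
  · exact heq
  · obtain ⟨l, hl0, hl1, hl2⟩ := hin M' p' t' (p' j + M'.hd (t' j) + M'.wd (t' j))
      (hz ▸ hout M p t _ k (by omega) (by omega))
    rcases lt_trichotomy j l with hkl | rfl | hkl
    · have := h'.sep hM' hkl hj0 hl0; omega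
    · omega
    · have := h'.sep hM' hkl hl0 hj0; omega

theorem match_lt (hM : M.Wf) (hM' : M'.Wf) (h : M.Layout p t) (h' : M'.Layout p' t')
    {k l i j : ℤ} (hk : Match M M' p t p' t' k i) (hl : Match M M' p t p' t' l j)
    (hkl : k < l) : i < j := by
  have h1 := h.sep hM hkl hk.2.2 hl.2.2
  have h2 := hM (t k)
  by_contra hcon
  rcases eq_or_lt_of_le (not_lt.1 hcon) with heq | hlt
  · subst heq
    have := hk.1; have := hl.1; omega
  · have h3 := h'.sep hM' hlt hl.symm.2.2 hk.symm.2.2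
    have := hk.1; have := hl.1
    have := hM' (t' j)
    omega

/-- Between the blocks matched to consecutive marked blocks there are no marked blocks. -/
theorem match_next (hM : M.Wf) (hM' : M'.Wf) (h : M.Layout p t) (h' : M'.Layout p' t')
    (hz : M.zone p t = M'.zone p' t') {k l i : ℤ} (hk : Match M M' p t p' t' k i)
    (hkl : k < l) (hl : M.wd (t l) ≠ 0) (hm : ∀ m, k < m → m < l → M.wd (t m) = 0) :
    ∃ j, i < j ∧ Match M M' p t p' t' l j ∧ ∀ m, i < m → m < j → M'.wd (t' m) = 0 := by
  obtain ⟨j, hj⟩ := match_exists hM hM' h h' hz hl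
  refine ⟨j, match_lt hM hM' h h' hk hj hkl, hj, fun m h1 h2 => ?_⟩
  by_contra hne
  obtain ⟨q, hq⟩ := match_exists hM' hM h' h hz.symm hne
  have h3 := match_lt hM' hM h' h hk.symm hq h1
  have h4 := match_lt hM' hM h' h hq hj.symm h2
  exact hq.symm.2.2 (hm q h3 h4)

/-- If all unmarked blocks have length at least `f`, then between the blocks matched to
consecutive marked blocks there is at most one block, or there is room for two. -/
theorem match_gap (hM : M.Wf) (hM' : M'.Wf) (h : M.Layout p t) (h' : M'.Layout p' t')
    (hz : M.zone p t = M'.zone p' t') {f : ℤ} (hf : ∀ t, M'.wd t = 0 → f ≤ M'.ln t)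
    {k l i : ℤ} (hk : Match M M' p t p' t' k i)
    (hkl : k < l) (hl : M.wd (t l) ≠ 0) (hm : ∀ m, k < m → m < l → M.wd (t m) = 0) :
    (Match M M' p t p' t' l (i + 1) ∨ 
      Match M M' p t p' t' l (i + 2) ∧ M'.wd (t' (i + 1)) = 0 ∨
      ∃ j, Match M M' p t p' t' l j ∧ p' (i + 1) + 2 * f ≤ p' j) := by
  obtain ⟨j, hij, hj, hu⟩ := match_next hM hM' h h' hz hk hkl hl hm
  rcases (show j = i + 1 ∨ j = i + 2 ∨ i + 3 ≤ j by omega) with rfl | rfl | hlt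
  · exact Or.inl hj
  · exact Or.inr (Or.inl ⟨hj, hu _ (by omega) (by omega)⟩)
  · refine Or.inr (Or.inr ⟨j, hj, ?_⟩)
    have h1 := hf _ (hu (i + 1) (by omega) (by omega))
    have h2 := hf _ (hu (i + 2) (by omega) (by omega))
    have h3 := h' (i + 1)
    have h4 := h' (i + 2)
    have h5 := (h'.strictMono hM').monotone (show i + 2 + 1 ≤ j by omega)
    rw [show i + 1 + 1 = i + 2 by ring] at h3
    omega

end MarkData

namespace MarkData
variable {M M' : MarkData} {p p' : ℤ → ℤ} {t t' : ℤ → Blk}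

/-- The possible sequences of blocks of `M'` between the blocks matched to consecutive marked
blocks of `M`, where `d` is the total length of the blocks between the latter. -/
def Gap (M M' : MarkData) (p : ℤ → ℤ) (t : ℤ → Blk) (p' : ℤ → ℤ) (t' : ℤ → Blk)
    (f k l i d : ℤ) : Prop :=
  ∃ j S, Match M M' p t p' t' l j ∧
    M.ln (t k) - M.hd (t k) - M.wd (t k) + d + M.hd (t l) =
      M'.ln (t' i) - M'.hd (t' i) - M'.wd (t' i) + S + M'.hd (t' j) ∧
    (j = i + 1 ∧ S = 0 ∨ j = i + 2 ∧ M'.wd (t' (i + 1)) = 0 ∧ S = M'.ln (t' (i + 1)) ∨ 2 * f ≤ S)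

theorem gap_of_unmarked (hM : M.Wf) (hM' : M'.Wf) (h : M.Layout p t) (h' : M'.Layout p' t')
    (hz : M.zone p t = M'.zone p' t') {f : ℤ} (hf : ∀ t, M'.wd t = 0 → f ≤ M'.ln t)
    {k l i : ℤ} (hk : Match M M' p t p' t' k i) (hkl : k < l) (hl : M.wd (t l) ≠ 0)
    (hm : ∀ m, k < m → m < l → M.wd (t m) = 0) :
    Gap M M' p t p' t' f k l i (p l - p (k + 1)) := by
  have hi := h' i
  have hk0 := h k
  rcases match_gap hM hM' h h' hz hf hk hkl hl hm with hj | ⟨hj, h0⟩ | ⟨j, hj, hr⟩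
  · have := hk.1; have := hj.1; have := hk.2.1
    exact ⟨_, 0, hj, by omega, Or.inl ⟨rfl, rfl⟩⟩
  · have := hk.1; have := hj.1; have := hk.2.1
    have hi1 := h' (i + 1)
    rw [show i + 1 + 1 = i + 2 by ring] at hi1
    exact ⟨_, _, hj, by omega, Or.inr (Or.inl ⟨rfl, h0, rfl⟩)⟩
  · have := hk.1; have := hj.1; have := hk.2.1
    exact ⟨_, p' j - p' (i + 1), hj, by omega, Or.inr (Or.inr (by omega))⟩

theorem gap₁ (hM : M.Wf) (hM' : M'.Wf) (h : M.Layout p t) (h' : M'.Layout p' t')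
    (hz : M.zone p t = M'.zone p' t') {f : ℤ} (hf : ∀ t, M'.wd t = 0 → f ≤ M'.ln t)
    {k i : ℤ} (hk : Match M M' p t p' t' k i) (hl : M.wd (t (k + 1)) ≠ 0) :
    Gap M M' p t p' t' f k (k + 1) i 0 := by
  have := gap_of_unmarked hM hM' h h' hz hf hk (show k < k + 1 by omega) hl
    (fun m h1 h2 => by omega)
  rwa [sub_self] at this

theorem gap₂ (hM : M.Wf) (hM' : M'.Wf) (h : M.Layout p t) (h' : M'.Layout p' t')
    (hz : M.zone p t = M'.zone p' t') {f : ℤ} (hf : ∀ t, M'.wd t = 0 → f ≤ M'.ln t)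
    {k i : ℤ} (hk : Match M M' p t p' t' k i) (h1 : M.wd (t (k + 1)) = 0)
    (hl : M.wd (t (k + 2)) ≠ 0) :
    Gap M M' p t p' t' f k (k + 2) i (M.ln (t (k + 1))) := by
  have := gap_of_unmarked hM hM' h h' hz hf hk (show k < k + 2 by omega) hl
    (fun m h2 h3 => by rwa [show m = k + 1 by omega])
  have hp := h (k + 1)
  rw [show k + 1 + 1 = k + 2 by ring] at hp
  rwa [hp, add_sub_cancel_left] at this

theorem gap₃ (hM : M.Wf) (hM' : M'.Wf) (h : M.Layout p t) (h' : M'.Layout p' t')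
    (hz : M.zone p t = M'.zone p' t') {f : ℤ} (hf : ∀ t, M'.wd t = 0 → f ≤ M'.ln t)
    {k i : ℤ} (hk : Match M M' p t p' t' k i) (h1 : M.wd (t (k + 1)) = 0)
    (h2 : M.wd (t (k + 2)) = 0) (hl : M.wd (t (k + 3)) ≠ 0) :
    Gap M M' p t p' t' f k (k + 3) i (M.ln (t (k + 1)) + M.ln (t (k + 2))) := by
  have := gap_of_unmarked hM hM' h h' hz hf hk (show k < k + 3 by omega) hl
    (fun m h3 h4 => by
      rcases (show m = k + 1 ∨ m = k + 2 by omega) with rfl | rfl <;> assumption)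
  have hp := h (k + 1)
  have hp' := h (k + 2)
  rw [show k + 1 + 1 = k + 2 by ring] at hp
  rw [show k + 2 + 1 = k + 3 by ring] at hp'
  rwa [hp', hp, show p (k + 1) + M.ln (t (k + 1)) + M.ln (t (k + 2)) - p (k + 1) =
    M.ln (t (k + 1)) + M.ln (t (k + 2)) by ring] at this

end MarkData

open MarkData

/-! ### The five blocks at one level of the hierarchy. -/

/-- Lengths of the blocks at the level with parameters `a`, `b`. -/
def blkLen (a b : ℤ) : Blk → ℤ
  | .A => a + b
  | .B => a + b
  | .C => a + 2 * b
  | .D => a + 2 * b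
  | .E => 2 * a + 2 * b

/-- Marks on the lower side of the blocks. -/
def inData (a b s : ℤ) : MarkData where
  ln := blkLen a b
  hd
    | .A => 0
    | .B => a + b - 2
    | .C => 0
    | .D => a + b - 3 + s
    | .E => a + 2 * b - 2
  wd
    | .A => 0
    | .B => 2
    | .C => 0
    | .D => 3
    | .E => 2

/-- Marks on the upper side of the blocks. -/
def outData (a b s : ℤ) : MarkData where
  ln := blkLen a b
  hd
    | .A => b - 3 + 2 * s
    | .B => 0
    | .C => 2 * b - 3 + s
    | .D => 0
    | .E => a + b - 3 + 2 * s
  wd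
    | .A => 2
    | .B => 0
    | .C => 3
    | .D => 0
    | .E => 2

/-- The parameters that occur. -/
structure LevelOk (a b s : ℤ) : Prop where
  ha : 2 ≤ a
  hab : a < b
  hba : b < 2 * a
  hs : s = 0 ∨ s = 1
  hbs : 5 ≤ b + 2 * s

theorem LevelOk.next {a b s : ℤ} (h : LevelOk a b s) : LevelOk b (a + b) (1 - s) := by
  obtain ⟨h1, h2, h3, h4, h5⟩ := h
  constructor <;> omega

theorem inData_wf {a b s : ℤ} (h : LevelOk a b s) : (inData a b s).Wf := by
  obtain ⟨h1, h2, h3, h4, h5⟩ := h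
  intro t
  cases t <;> simp [inData, blkLen] <;> omega

theorem outData_wf {a b s : ℤ} (h : LevelOk a b s) : (outData a b s).Wf := by
  obtain ⟨h1, h2, h3, h4, h5⟩ := h
  intro t
  cases t <;> simp [outData, blkLen] <;> omega

theorem inData_le {a b s : ℤ} (h : LevelOk a b s) (t : Blk) (ht : (inData a b s).wd t = 0) :
    a + b ≤ (inData a b s).ln t := by
  obtain ⟨h1, h2, h3, h4, h5⟩ := h
  cases t <;> simp [inData, blkLen] at ht ⊢ <;> omega

theorem outData_le {a b s : ℤ} (h : LevelOk a b s) (t : Blk) (ht : (outData a b s).wd t = 0) :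
    a + b ≤ (outData a b s).ln t := by
  obtain ⟨h1, h2, h3, h4, h5⟩ := h
  cases t <;> simp [outData, blkLen] at ht ⊢ <;> omega

/-! ### Three stacked strips: words that cannot occur in the middle one. -/

/-- Three consecutive strips: one of a level between two of the next level. -/
structure Triple (a b s : ℤ) (pL : ℤ → ℤ) (tL : ℤ → Blk) (pN : ℤ → ℤ) (tN : ℤ → Blk)
    (pU : ℤ → ℤ) (tU : ℤ → Blk) : Prop where
  ok : LevelOk a b s
  hL : ∀ k, pL (k + 1) = pL k + blkLen b (a + b) (tL k)
  hN : ∀ k, pN (k + 1) = pN k + blkLen a b (tN k)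
  hU : ∀ k, pU (k + 1) = pU k + blkLen b (a + b) (tU k)
  hLN : (inData a b s).zone pN tN = (outData b (a + b) (1 - s)).zone pL tL
  hNU : (outData a b s).zone pN tN = (inData b (a + b) (1 - s)).zone pU tU

namespace Triple
variable {a b s : ℤ} {pL pN pU : ℤ → ℤ} {tL tN tU : ℤ → Blk}

/-- The lower mark of block `k` of the middle strip is the upper mark of block `i` of the lower
strip. -/
abbrev MatchL (_ : Triple a b s pL tL pN tN pU tU) (k i : ℤ) : Prop :=
  Match (inData a b s) (outData b (a + b) (1 - s)) pN tN pL tL k i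

/-- The upper mark of block `k` of the middle strip is the lower mark of block `i` of the upper
strip. -/
abbrev MatchU (_ : Triple a b s pL tL pN tN pU tU) (k i : ℤ) : Prop :=
  Match (outData a b s) (inData b (a + b) (1 - s)) pN tN pU tU k i

variable (T : Triple a b s pL tL pN tN pU tU)
include T

theorem existsL {k : ℤ} (hk : (inData a b s).wd (tN k) ≠ 0) : ∃ i, T.MatchL k i :=
  match_exists (inData_wf T.ok) (outData_wf T.ok.next) T.hN T.hL T.hLN hk

theorem existsU {k : ℤ} (hk : (outData a b s).wd (tN k) ≠ 0) : ∃ i, T.MatchU k i :=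
  match_exists (outData_wf T.ok) (inData_wf T.ok.next) T.hN T.hU T.hNU hk

end Triple

namespace Triple
variable {a b s : ℤ} {pL pN pU : ℤ → ℤ} {tL tN tU : ℤ → Blk}
variable (T : Triple a b s pL tL pN tN pU tU)
include T

open MarkData

/-- Only `B` and `D` are unmarked on the upper side, and at the level of the lower strip they have
lengths `a + 2 * b` and `2 * a + 3 * b`. Two or more unmarked blocks in a row need only the crude
bound. -/
theorem gapL {k l i d : ℤ}
    (h : Gap (inData a b s) (outData b (a + b) (1 - s)) pN tN pL tL (b + (a + b)) k l i d) :
    ∃ j S, T.MatchL (l) j ∧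
      (inData a b s).ln (tN k) - (inData a b s).hd (tN k) - (inData a b s).wd (tN k) + d +
        (inData a b s).hd (tN (l)) =
      (outData b (a + b) (1 - s)).ln (tL i) - (outData b (a + b) (1 - s)).hd (tL i) -
        (outData b (a + b) (1 - s)).wd (tL i) + S + (outData b (a + b) (1 - s)).hd (tL j) ∧
      (j = i + 1 ∧ S = 0 ∨ j = i + 2 ∧ tL (i + 1) = .B ∧ S = a + 2 * b ∨
        j = i + 2 ∧ tL (i + 1) = .D ∧ S = 2 * a + 3 * b ∨ 2 * a + 4 * b ≤ S) := by
  obtain ⟨j, S, hj, he, hS⟩ := h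
  refine ⟨j, S, hj, he, ?_⟩
  rcases hS with hS | ⟨hS, h0, h1⟩ | hS
  · exact Or.inl hS
  · cases ht : tL (i + 1) <;> simp [ht, outData, blkLen] at h0 h1 ⊢ <;> omega
  · omega

theorem gapL₁ {k i : ℤ} (hk : T.MatchL k i) 
    (hl : (inData a b s).wd (tN (k + 1)) ≠ 0) :
    ∃ j S, T.MatchL (k + 1) j ∧
      (inData a b s).ln (tN k) - (inData a b s).hd (tN k) - (inData a b s).wd (tN k) + 0 +
        (inData a b s).hd (tN (k + 1)) =
      (outData b (a + b) (1 - s)).ln (tL i) - (outData b (a + b) (1 - s)).hd (tL i) -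
        (outData b (a + b) (1 - s)).wd (tL i) + S + (outData b (a + b) (1 - s)).hd (tL j) ∧
      (j = i + 1 ∧ S = 0 ∨ j = i + 2 ∧ tL (i + 1) = .B ∧ S = a + 2 * b ∨
        j = i + 2 ∧ tL (i + 1) = .D ∧ S = 2 * a + 3 * b ∨ 2 * a + 4 * b ≤ S) :=
  T.gapL (gap₁ (inData_wf T.ok) (outData_wf T.ok.next) T.hN T.hL T.hLN
    (outData_le T.ok.next) hk hl)

theorem gapL₂ {k i : ℤ} (hk : T.MatchL k i) (h1 : (inData a b s).wd (tN (k + 1)) = 0)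
    (hl : (inData a b s).wd (tN (k + 2)) ≠ 0) :
    ∃ j S, T.MatchL (k + 2) j ∧
      (inData a b s).ln (tN k) - (inData a b s).hd (tN k) - (inData a b s).wd (tN k) + (inData a b s).ln (tN (k + 1)) +
        (inData a b s).hd (tN (k + 2)) =
      (outData b (a + b) (1 - s)).ln (tL i) - (outData b (a + b) (1 - s)).hd (tL i) -
        (outData b (a + b) (1 - s)).wd (tL i) + S + (outData b (a + b) (1 - s)).hd (tL j) ∧
      (j = i + 1 ∧ S = 0 ∨ j = i + 2 ∧ tL (i + 1) = .B ∧ S = a + 2 * b ∨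
        j = i + 2 ∧ tL (i + 1) = .D ∧ S = 2 * a + 3 * b ∨ 2 * a + 4 * b ≤ S) :=
  T.gapL (gap₂ (inData_wf T.ok) (outData_wf T.ok.next) T.hN T.hL T.hLN
    (outData_le T.ok.next) hk h1 hl)

theorem gapL₃ {k i : ℤ} (hk : T.MatchL k i) (h1 : (inData a b s).wd (tN (k + 1)) = 0)
    (h2 : (inData a b s).wd (tN (k + 2)) = 0)
    (hl : (inData a b s).wd (tN (k + 3)) ≠ 0) :
    ∃ j S, T.MatchL (k + 3) j ∧
      (inData a b s).ln (tN k) - (inData a b s).hd (tN k) - (inData a b s).wd (tN k) + ((inData a b s).ln (tN (k + 1)) + (inData a b s).ln (tN (k + 2))) +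
        (inData a b s).hd (tN (k + 3)) =
      (outData b (a + b) (1 - s)).ln (tL i) - (outData b (a + b) (1 - s)).hd (tL i) -
        (outData b (a + b) (1 - s)).wd (tL i) + S + (outData b (a + b) (1 - s)).hd (tL j) ∧
      (j = i + 1 ∧ S = 0 ∨ j = i + 2 ∧ tL (i + 1) = .B ∧ S = a + 2 * b ∨
        j = i + 2 ∧ tL (i + 1) = .D ∧ S = 2 * a + 3 * b ∨ 2 * a + 4 * b ≤ S) :=
  T.gapL (gap₃ (inData_wf T.ok) (outData_wf T.ok.next) T.hN T.hL T.hLN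
    (outData_le T.ok.next) hk h1 h2 hl)

/-- The analogue of `gapL` upwards: on the lower side the unmarked blocks are `A` and `C`. -/
theorem gapU {k l i d : ℤ}
    (h : Gap (outData a b s) (inData b (a + b) (1 - s)) pN tN pU tU (b + (a + b)) k l i d) :
    ∃ j S, T.MatchU (l) j ∧
      (outData a b s).ln (tN k) - (outData a b s).hd (tN k) - (outData a b s).wd (tN k) + d +
        (outData a b s).hd (tN (l)) =
      (inData b (a + b) (1 - s)).ln (tU i) - (inData b (a + b) (1 - s)).hd (tU i) -
        (inData b (a + b) (1 - s)).wd (tU i) + S + (inData b (a + b) (1 - s)).hd (tU j) ∧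
      (j = i + 1 ∧ S = 0 ∨ j = i + 2 ∧ tU (i + 1) = .A ∧ S = a + 2 * b ∨
        j = i + 2 ∧ tU (i + 1) = .C ∧ S = 2 * a + 3 * b ∨ 2 * a + 4 * b ≤ S) := by
  obtain ⟨j, S, hj, he, hS⟩ := h
  refine ⟨j, S, hj, he, ?_⟩
  rcases hS with hS | ⟨hS, h0, h1⟩ | hS
  · exact Or.inl hS
  · cases ht : tU (i + 1) <;> simp [ht, inData, blkLen] at h0 h1 ⊢ <;> omega
  · omega

theorem gapU₁ {k i : ℤ} (hk : T.MatchU k i) 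
    (hl : (outData a b s).wd (tN (k + 1)) ≠ 0) :
    ∃ j S, T.MatchU (k + 1) j ∧
      (outData a b s).ln (tN k) - (outData a b s).hd (tN k) - (outData a b s).wd (tN k) + 0 +
        (outData a b s).hd (tN (k + 1)) =
      (inData b (a + b) (1 - s)).ln (tU i) - (inData b (a + b) (1 - s)).hd (tU i) -
        (inData b (a + b) (1 - s)).wd (tU i) + S + (inData b (a + b) (1 - s)).hd (tU j) ∧
      (j = i + 1 ∧ S = 0 ∨ j = i + 2 ∧ tU (i + 1) = .A ∧ S = a + 2 * b ∨
        j = i + 2 ∧ tU (i + 1) = .C ∧ S = 2 * a + 3 * b ∨ 2 * a + 4 * b ≤ S) :=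
  T.gapU (gap₁ (outData_wf T.ok) (inData_wf T.ok.next) T.hN T.hU T.hNU
    (inData_le T.ok.next) hk hl)

theorem gapU₂ {k i : ℤ} (hk : T.MatchU k i) (h1 : (outData a b s).wd (tN (k + 1)) = 0)
    (hl : (outData a b s).wd (tN (k + 2)) ≠ 0) :
    ∃ j S, T.MatchU (k + 2) j ∧
      (outData a b s).ln (tN k) - (outData a b s).hd (tN k) - (outData a b s).wd (tN k) + (outData a b s).ln (tN (k + 1)) +
        (outData a b s).hd (tN (k + 2)) =
      (inData b (a + b) (1 - s)).ln (tU i) - (inData b (a + b) (1 - s)).hd (tU i) -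
        (inData b (a + b) (1 - s)).wd (tU i) + S + (inData b (a + b) (1 - s)).hd (tU j) ∧
      (j = i + 1 ∧ S = 0 ∨ j = i + 2 ∧ tU (i + 1) = .A ∧ S = a + 2 * b ∨
        j = i + 2 ∧ tU (i + 1) = .C ∧ S = 2 * a + 3 * b ∨ 2 * a + 4 * b ≤ S) :=
  T.gapU (gap₂ (outData_wf T.ok) (inData_wf T.ok.next) T.hN T.hU T.hNU
    (inData_le T.ok.next) hk h1 hl)

theorem gapU₃ {k i : ℤ} (hk : T.MatchU k i) (h1 : (outData a b s).wd (tN (k + 1)) = 0)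
    (h2 : (outData a b s).wd (tN (k + 2)) = 0)
    (hl : (outData a b s).wd (tN (k + 3)) ≠ 0) :
    ∃ j S, T.MatchU (k + 3) j ∧
      (outData a b s).ln (tN k) - (outData a b s).hd (tN k) - (outData a b s).wd (tN k) + ((outData a b s).ln (tN (k + 1)) + (outData a b s).ln (tN (k + 2))) +
        (outData a b s).hd (tN (k + 3)) =
      (inData b (a + b) (1 - s)).ln (tU i) - (inData b (a + b) (1 - s)).hd (tU i) -
        (inData b (a + b) (1 - s)).wd (tU i) + S + (inData b (a + b) (1 - s)).hd (tU j) ∧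
      (j = i + 1 ∧ S = 0 ∨ j = i + 2 ∧ tU (i + 1) = .A ∧ S = a + 2 * b ∨
        j = i + 2 ∧ tU (i + 1) = .C ∧ S = 2 * a + 3 * b ∨ 2 * a + 4 * b ≤ S) :=
  T.gapU (gap₃ (outData_wf T.ok) (inData_wf T.ok.next) T.hN T.hU T.hNU
    (inData_le T.ok.next) hk h1 h2 hl)

/-- Matched marks have equal width, and among lower marks only that of `D`, among upper marks only
that of `C`, has width three. -/
theorem typeL {k i : ℤ} (h : T.MatchL k i) :
    tN k = .D ∧ tL i = .C ∨ tN k = .B ∧ (tL i = .A ∨ tL i = .E) ∨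
      tN k = .E ∧ (tL i = .A ∨ tL i = .E) := by
  have h1 := h.2.1
  have h2 := h.2.2
  cases hk : tN k <;> cases hi : tL i <;> simp [hk, hi, inData, outData] at h1 h2 ⊢

theorem typeU {k i : ℤ} (h : T.MatchU k i) :
    tN k = .C ∧ tU i = .D ∨ tN k = .A ∧ (tU i = .B ∨ tU i = .E) ∨
      tN k = .E ∧ (tU i = .B ∨ tU i = .E) := by
  have h1 := h.2.1
  have h2 := h.2.2
  cases hk : tN k <;> cases hi : tU i <;> simp [hk, hi, inData, outData] at h1 h2 ⊢

/-- In this family of lemmas the name spells the excluded word. The distance between the lower marks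
of its first and last block has to be a distance between consecutive upper marks of the lower strip.
Every combination of matched types and of blocks between them is a linear equation in `a`, `b`, `s`
that contradicts `LevelOk`. -/
theorem not_L_BB {k k1 : ℤ} (e1 : k1 = k + 1) (h0 : tN k = .B) (h1 : tN k1 = .B) :
    False := by
  subst e1
  obtain ⟨i, hi⟩ := T.existsL (k := k) (by simp [h0, inData])
  obtain ⟨j, S, hj, he, hS⟩ := T.gapL₁ hi (by simp [h1, inData])
  have ti := T.typeL hi
  have tj := T.typeL hj
  obtain ⟨g1, g2, g3, g4, g5⟩ := T.ok
  simp only [h0, h1, reduceCtorEq, false_and, true_and, false_or, or_false] at ti tj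
  rcases ti with ti | ti <;> rcases tj with tj | tj <;>
    simp [h0, h1, ti, tj, inData, outData, blkLen] at he <;> omega

theorem not_L_BD {k k1 : ℤ} (e1 : k1 = k + 1) (h0 : tN k = .B) (h1 : tN k1 = .D) :
    False := by
  subst e1
  obtain ⟨i, hi⟩ := T.existsL (k := k) (by simp [h0, inData])
  obtain ⟨j, S, hj, he, hS⟩ := T.gapL₁ hi (by simp [h1, inData])
  have ti := T.typeL hi
  have tj := T.typeL hj
  obtain ⟨g1, g2, g3, g4, g5⟩ := T.ok
  simp only [h0, h1, reduceCtorEq, false_and, true_and, false_or, or_false] at ti tj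
  rcases ti with ti | ti <;>
    simp [h0, h1, ti, tj, inData, outData, blkLen] at he <;> omega

theorem not_L_DD {k k1 : ℤ} (e1 : k1 = k + 1) (h0 : tN k = .D) (h1 : tN k1 = .D) :
    False := by
  subst e1
  obtain ⟨i, hi⟩ := T.existsL (k := k) (by simp [h0, inData])
  obtain ⟨j, S, hj, he, hS⟩ := T.gapL₁ hi (by simp [h1, inData])
  have ti := T.typeL hi
  have tj := T.typeL hj
  obtain ⟨g1, g2, g3, g4, g5⟩ := T.ok
  simp only [h0, h1, reduceCtorEq, false_and, true_and, false_or, or_false] at ti tj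
  simp [h0, h1, ti, tj, inData, outData, blkLen] at he
  omega

theorem not_L_EB {k k1 : ℤ} (e1 : k1 = k + 1) (h0 : tN k = .E) (h1 : tN k1 = .B) :
    False := by
  subst e1
  obtain ⟨i, hi⟩ := T.existsL (k := k) (by simp [h0, inData])
  obtain ⟨j, S, hj, he, hS⟩ := T.gapL₁ hi (by simp [h1, inData])
  have ti := T.typeL hi
  have tj := T.typeL hj
  obtain ⟨g1, g2, g3, g4, g5⟩ := T.ok
  simp only [h0, h1, reduceCtorEq, false_and, true_and, false_or, or_false] at ti tj
  rcases ti with ti | ti <;> rcases tj with tj | tj <;>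
    simp [h0, h1, ti, tj, inData, outData, blkLen] at he <;> omega

theorem not_L_ED {k k1 : ℤ} (e1 : k1 = k + 1) (h0 : tN k = .E) (h1 : tN k1 = .D) :
    False := by
  subst e1
  obtain ⟨i, hi⟩ := T.existsL (k := k) (by simp [h0, inData])
  obtain ⟨j, S, hj, he, hS⟩ := T.gapL₁ hi (by simp [h1, inData])
  have ti := T.typeL hi
  have tj := T.typeL hj
  obtain ⟨g1, g2, g3, g4, g5⟩ := T.ok
  simp only [h0, h1, reduceCtorEq, false_and, true_and, false_or, or_false] at ti tj
  rcases ti with ti | ti <;>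
    simp [h0, h1, ti, tj, inData, outData, blkLen] at he <;> omega

theorem not_L_EE {k k1 : ℤ} (e1 : k1 = k + 1) (h0 : tN k = .E) (h1 : tN k1 = .E) :
    False := by
  subst e1
  obtain ⟨i, hi⟩ := T.existsL (k := k) (by simp [h0, inData])
  obtain ⟨j, S, hj, he, hS⟩ := T.gapL₁ hi (by simp [h1, inData])
  have ti := T.typeL hi
  have tj := T.typeL hj
  obtain ⟨g1, g2, g3, g4, g5⟩ := T.ok
  simp only [h0, h1, reduceCtorEq, false_and, true_and, false_or, or_false] at ti tj
  rcases ti with ti | ti <;> rcases tj with tj | tj <;>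
    simp [h0, h1, ti, tj, inData, outData, blkLen] at he <;> omega

/-- The same computation with upper marks of the middle strip and lower marks of the upper strip. -/
theorem not_U_AA {k k1 : ℤ} (e1 : k1 = k + 1) (h0 : tN k = .A) (h1 : tN k1 = .A) :
    False := by
  subst e1
  obtain ⟨i, hi⟩ := T.existsU (k := k) (by simp [h0, outData])
  obtain ⟨j, S, hj, he, hS⟩ := T.gapU₁ hi (by simp [h1, outData])
  have ti := T.typeU hi
  have tj := T.typeU hj
  obtain ⟨g1, g2, g3, g4, g5⟩ := T.ok
  simp only [h0, h1, reduceCtorEq, false_and, true_and, false_or, or_false] at ti tj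
  rcases ti with ti | ti <;> rcases tj with tj | tj <;>
    simp [h0, h1, ti, tj, inData, outData, blkLen] at he <;> omega

theorem not_U_CA {k k1 : ℤ} (e1 : k1 = k + 1) (h0 : tN k = .C) (h1 : tN k1 = .A) :
    False := by
  subst e1
  obtain ⟨i, hi⟩ := T.existsU (k := k) (by simp [h0, outData])
  obtain ⟨j, S, hj, he, hS⟩ := T.gapU₁ hi (by simp [h1, outData])
  have ti := T.typeU hi
  have tj := T.typeU hj
  obtain ⟨g1, g2, g3, g4, g5⟩ := T.ok
  simp only [h0, h1, reduceCtorEq, false_and, true_and, false_or, or_false] at ti tj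
  rcases tj with tj | tj <;>
    simp [h0, h1, ti, tj, inData, outData, blkLen] at he <;> omega

theorem not_U_CC {k k1 : ℤ} (e1 : k1 = k + 1) (h0 : tN k = .C) (h1 : tN k1 = .C) :
    False := by
  subst e1
  obtain ⟨i, hi⟩ := T.existsU (k := k) (by simp [h0, outData])
  obtain ⟨j, S, hj, he, hS⟩ := T.gapU₁ hi (by simp [h1, outData])
  have ti := T.typeU hi
  have tj := T.typeU hj
  obtain ⟨g1, g2, g3, g4, g5⟩ := T.ok
  simp only [h0, h1, reduceCtorEq, false_and, true_and, false_or, or_false] at ti tj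
  simp [h0, h1, ti, tj, inData, outData, blkLen] at he
  omega

theorem not_U_AE {k k1 : ℤ} (e1 : k1 = k + 1) (h0 : tN k = .A) (h1 : tN k1 = .E) :
    False := by
  subst e1
  obtain ⟨i, hi⟩ := T.existsU (k := k) (by simp [h0, outData])
  obtain ⟨j, S, hj, he, hS⟩ := T.gapU₁ hi (by simp [h1, outData])
  have ti := T.typeU hi
  have tj := T.typeU hj
  obtain ⟨g1, g2, g3, g4, g5⟩ := T.ok
  simp only [h0, h1, reduceCtorEq, false_and, true_and, false_or, or_false] at ti tj
  rcases ti with ti | ti <;> rcases tj with tj | tj <;>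
    simp [h0, h1, ti, tj, inData, outData, blkLen] at he <;> omega

theorem not_U_CE {k k1 : ℤ} (e1 : k1 = k + 1) (h0 : tN k = .C) (h1 : tN k1 = .E) :
    False := by
  subst e1
  obtain ⟨i, hi⟩ := T.existsU (k := k) (by simp [h0, outData])
  obtain ⟨j, S, hj, he, hS⟩ := T.gapU₁ hi (by simp [h1, outData])
  have ti := T.typeU hi
  have tj := T.typeU hj
  obtain ⟨g1, g2, g3, g4, g5⟩ := T.ok
  simp only [h0, h1, reduceCtorEq, false_and, true_and, false_or, or_false] at ti tj
  rcases tj with tj | tj <;>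
    simp [h0, h1, ti, tj, inData, outData, blkLen] at he <;> omega

theorem not_U_ABE {k k1 k2 : ℤ} (e1 : k1 = k + 1) (e2 : k2 = k + 2) (h0 : tN k = .A) (h1 : tN k1 = .B) (h2 : tN k2 = .E) :
    False := by
  subst e1 e2
  obtain ⟨i, hi⟩ := T.existsU (k := k) (by simp [h0, outData])
  obtain ⟨j, S, hj, he, hS⟩ := T.gapU₂ hi (by simp [h1, outData]) (by simp [h2, outData])
  have ti := T.typeU hi
  have tj := T.typeU hj
  obtain ⟨g1, g2, g3, g4, g5⟩ := T.ok
  simp only [h0, h1, h2, reduceCtorEq, false_and, true_and, false_or, or_false] at ti tj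
  rcases ti with ti | ti <;> rcases tj with tj | tj <;>
    simp [h0, h1, h2, ti, tj, inData, outData, blkLen] at he <;> omega

theorem not_U_ADE {k k1 k2 : ℤ} (e1 : k1 = k + 1) (e2 : k2 = k + 2) (h0 : tN k = .A) (h1 : tN k1 = .D) (h2 : tN k2 = .E) :
    False := by
  subst e1 e2
  obtain ⟨i, hi⟩ := T.existsU (k := k) (by simp [h0, outData])
  obtain ⟨j, S, hj, he, hS⟩ := T.gapU₂ hi (by simp [h1, outData]) (by simp [h2, outData])
  have ti := T.typeU hi
  have tj := T.typeU hj
  obtain ⟨g1, g2, g3, g4, g5⟩ := T.ok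
  simp only [h0, h1, h2, reduceCtorEq, false_and, true_and, false_or, or_false] at ti tj
  rcases ti with ti | ti <;> rcases tj with tj | tj <;>
    simp [h0, h1, h2, ti, tj, inData, outData, blkLen] at he <;> omega

theorem not_U_CBE {k k1 k2 : ℤ} (e1 : k1 = k + 1) (e2 : k2 = k + 2) (h0 : tN k = .C) (h1 : tN k1 = .B) (h2 : tN k2 = .E) :
    False := by
  subst e1 e2
  obtain ⟨i, hi⟩ := T.existsU (k := k) (by simp [h0, outData])
  obtain ⟨j, S, hj, he, hS⟩ := T.gapU₂ hi (by simp [h1, outData]) (by simp [h2, outData])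
  have ti := T.typeU hi
  have tj := T.typeU hj
  obtain ⟨g1, g2, g3, g4, g5⟩ := T.ok
  simp only [h0, h1, h2, reduceCtorEq, false_and, true_and, false_or, or_false] at ti tj
  rcases tj with tj | tj <;>
    simp [h0, h1, h2, ti, tj, inData, outData, blkLen] at he <;> omega

theorem not_U_CDE {k k1 k2 : ℤ} (e1 : k1 = k + 1) (e2 : k2 = k + 2) (h0 : tN k = .C) (h1 : tN k1 = .D) (h2 : tN k2 = .E) :
    False := by
  subst e1 e2
  obtain ⟨i, hi⟩ := T.existsU (k := k) (by simp [h0, outData])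
  obtain ⟨j, S, hj, he, hS⟩ := T.gapU₂ hi (by simp [h1, outData]) (by simp [h2, outData])
  have ti := T.typeU hi
  have tj := T.typeU hj
  obtain ⟨g1, g2, g3, g4, g5⟩ := T.ok
  simp only [h0, h1, h2, reduceCtorEq, false_and, true_and, false_or, or_false] at ti tj
  rcases tj with tj | tj <;>
    simp [h0, h1, h2, ti, tj, inData, outData, blkLen] at he <;> omega

theorem not_U_ADBE {k k1 k2 k3 : ℤ} (e1 : k1 = k + 1) (e2 : k2 = k + 2) (e3 : k3 = k + 3) (h0 : tN k = .A) (h1 : tN k1 = .D) (h2 : tN k2 = .B) (h3 : tN k3 = .E) :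
    False := by
  subst e1 e2 e3
  obtain ⟨i, hi⟩ := T.existsU (k := k) (by simp [h0, outData])
  obtain ⟨j, S, hj, he, hS⟩ := T.gapU₃ hi (by simp [h1, outData]) (by simp [h2, outData]) (by simp [h3, outData])
  have ti := T.typeU hi
  have tj := T.typeU hj
  obtain ⟨g1, g2, g3, g4, g5⟩ := T.ok
  simp only [h0, h1, h2, h3, reduceCtorEq, false_and, true_and, false_or, or_false] at ti tj
  rcases ti with ti | ti <;> rcases tj with tj | tj <;>
    simp [h0, h1, h2, h3, ti, tj, inData, outData, blkLen] at he <;> omega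

theorem not_U_CDBE {k k1 k2 k3 : ℤ} (e1 : k1 = k + 1) (e2 : k2 = k + 2) (e3 : k3 = k + 3) (h0 : tN k = .C) (h1 : tN k1 = .D) (h2 : tN k2 = .B) (h3 : tN k3 = .E) :
    False := by
  subst e1 e2 e3
  obtain ⟨i, hi⟩ := T.existsU (k := k) (by simp [h0, outData])
  obtain ⟨j, S, hj, he, hS⟩ := T.gapU₃ hi (by simp [h1, outData]) (by simp [h2, outData]) (by simp [h3, outData])
  have ti := T.typeU hi
  have tj := T.typeU hj
  obtain ⟨g1, g2, g3, g4, g5⟩ := T.ok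
  simp only [h0, h1, h2, h3, reduceCtorEq, false_and, true_and, false_or, or_false] at ti tj
  rcases tj with tj | tj <;>
    simp [h0, h1, h2, h3, ti, tj, inData, outData, blkLen] at he <;> omega

theorem not_L_BAD {k k1 k2 : ℤ} (e1 : k1 = k + 1) (e2 : k2 = k + 2) (h0 : tN k = .B) (h1 : tN k1 = .A) (h2 : tN k2 = .D) :
    False := by
  subst e1 e2
  obtain ⟨i, hi⟩ := T.existsL (k := k) (by simp [h0, inData])
  obtain ⟨j, S, hj, he, hS⟩ := T.gapL₂ hi (by simp [h1, inData]) (by simp [h2, inData])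
  have ti := T.typeL hi
  have tj := T.typeL hj
  obtain ⟨g1, g2, g3, g4, g5⟩ := T.ok
  simp only [h0, h1, h2, reduceCtorEq, false_and, true_and, false_or, or_false] at ti tj
  rcases ti with ti | ti <;>
    simp [h0, h1, h2, ti, tj, inData, outData, blkLen] at he <;> omega

theorem not_L_DCD {k k1 k2 : ℤ} (e1 : k1 = k + 1) (e2 : k2 = k + 2) (h0 : tN k = .D) (h1 : tN k1 = .C) (h2 : tN k2 = .D) :
    False := by
  subst e1 e2
  obtain ⟨i, hi⟩ := T.existsL (k := k) (by simp [h0, inData])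
  obtain ⟨j, S, hj, he, hS⟩ := T.gapL₂ hi (by simp [h1, inData]) (by simp [h2, inData])
  have ti := T.typeL hi
  have tj := T.typeL hj
  obtain ⟨g1, g2, g3, g4, g5⟩ := T.ok
  simp only [h0, h1, h2, reduceCtorEq, false_and, true_and, false_or, or_false] at ti tj
  simp [h0, h1, h2, ti, tj, inData, outData, blkLen] at he
  omega

theorem not_U_ABA {k k1 k2 : ℤ} (e1 : k1 = k + 1) (e2 : k2 = k + 2) (h0 : tN k = .A) (h1 : tN k1 = .B) (h2 : tN k2 = .A) :
    False := by
  subst e1 e2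
  obtain ⟨i, hi⟩ := T.existsU (k := k) (by simp [h0, outData])
  obtain ⟨j, S, hj, he, hS⟩ := T.gapU₂ hi (by simp [h1, outData]) (by simp [h2, outData])
  have ti := T.typeU hi
  have tj := T.typeU hj
  obtain ⟨g1, g2, g3, g4, g5⟩ := T.ok
  simp only [h0, h1, h2, reduceCtorEq, false_and, true_and, false_or, or_false] at ti tj
  rcases ti with ti | ti <;> rcases tj with tj | tj <;>
    simp [h0, h1, h2, ti, tj, inData, outData, blkLen] at he <;> omega

theorem not_U_ABC {k k1 k2 : ℤ} (e1 : k1 = k + 1) (e2 : k2 = k + 2) (h0 : tN k = .A) (h1 : tN k1 = .B) (h2 : tN k2 = .C) :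
    False := by
  subst e1 e2
  obtain ⟨i, hi⟩ := T.existsU (k := k) (by simp [h0, outData])
  obtain ⟨j, S, hj, he, hS⟩ := T.gapU₂ hi (by simp [h1, outData]) (by simp [h2, outData])
  have ti := T.typeU hi
  have tj := T.typeU hj
  obtain ⟨g1, g2, g3, g4, g5⟩ := T.ok
  simp only [h0, h1, h2, reduceCtorEq, false_and, true_and, false_or, or_false] at ti tj
  rcases ti with ti | ti <;>
    simp [h0, h1, h2, ti, tj, inData, outData, blkLen] at he <;> omega

theorem not_U_CBA {k k1 k2 : ℤ} (e1 : k1 = k + 1) (e2 : k2 = k + 2) (h0 : tN k = .C) (h1 : tN k1 = .B) (h2 : tN k2 = .A) :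
    False := by
  subst e1 e2
  obtain ⟨i, hi⟩ := T.existsU (k := k) (by simp [h0, outData])
  obtain ⟨j, S, hj, he, hS⟩ := T.gapU₂ hi (by simp [h1, outData]) (by simp [h2, outData])
  have ti := T.typeU hi
  have tj := T.typeU hj
  obtain ⟨g1, g2, g3, g4, g5⟩ := T.ok
  simp only [h0, h1, h2, reduceCtorEq, false_and, true_and, false_or, or_false] at ti tj
  rcases tj with tj | tj <;>
    simp [h0, h1, h2, ti, tj, inData, outData, blkLen] at he <;> omega

theorem not_U_CDC {k k1 k2 : ℤ} (e1 : k1 = k + 1) (e2 : k2 = k + 2) (h0 : tN k = .C) (h1 : tN k1 = .D) (h2 : tN k2 = .C) :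
    False := by
  subst e1 e2
  obtain ⟨i, hi⟩ := T.existsU (k := k) (by simp [h0, outData])
  obtain ⟨j, S, hj, he, hS⟩ := T.gapU₂ hi (by simp [h1, outData]) (by simp [h2, outData])
  have ti := T.typeU hi
  have tj := T.typeU hj
  obtain ⟨g1, g2, g3, g4, g5⟩ := T.ok
  simp only [h0, h1, h2, reduceCtorEq, false_and, true_and, false_or, or_false] at ti tj
  simp [h0, h1, h2, ti, tj, inData, outData, blkLen] at he
  omega

theorem not_U_ADBA {k k1 k2 k3 : ℤ} (e1 : k1 = k + 1) (e2 : k2 = k + 2) (e3 : k3 = k + 3) (h0 : tN k = .A) (h1 : tN k1 = .D) (h2 : tN k2 = .B) (h3 : tN k3 = .A) :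
    False := by
  subst e1 e2 e3
  obtain ⟨i, hi⟩ := T.existsU (k := k) (by simp [h0, outData])
  obtain ⟨j, S, hj, he, hS⟩ := T.gapU₃ hi (by simp [h1, outData]) (by simp [h2, outData]) (by simp [h3, outData])
  have ti := T.typeU hi
  have tj := T.typeU hj
  obtain ⟨g1, g2, g3, g4, g5⟩ := T.ok
  simp only [h0, h1, h2, h3, reduceCtorEq, false_and, true_and, false_or, or_false] at ti tj
  rcases ti with ti | ti <;> rcases tj with tj | tj <;>
    simp [h0, h1, h2, h3, ti, tj, inData, outData, blkLen] at he <;> omega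

end Triple

/-! ### Three stacked strips: what a word of the middle one forces in its neighbours. -/

namespace Triple
variable {a b s : ℤ} {pL pN pU : ℤ → ℤ} {tL tN tU : ℤ → Blk}
variable (T : Triple a b s pL tL pN tN pU tU)
include T

open MarkData

/-- For words that do occur, the same linear equations leave few alternatives. Those that survive
fix the types of matched blocks and, where it is asserted, how many unmarked blocks lie between them
and which. -/
theorem L_DB {k k1 i : ℤ} (hi : T.MatchL k i) (e1 : k1 = k + 1)
    (h0 : tN k = .D) (h1 : tN k1 = .B) :
    T.MatchL k1 (i + 1) ∧ tL (i + 1) = .A := by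
  subst e1
  obtain ⟨j, S, hj, he, hS⟩ := T.gapL₁ hi (by simp [h1, inData])
  have ti := T.typeL hi
  have tj := T.typeL hj
  obtain ⟨g1, g2, g3, g4, g5⟩ := T.ok
  simp only [h0, h1, reduceCtorEq, false_and, true_and, false_or, or_false] at ti tj
  rcases tj with tj | tj <;> rcases hS with ⟨z1, z2⟩ | ⟨z1, z0, z2⟩ | ⟨z1, z0, z2⟩ | z2 <;>
    simp [h0, h1, ti, tj, inData, outData, blkLen] at he <;>
    first | (exfalso; omega) | (subst z1; exact ⟨hj, tj⟩)

theorem L_BCB {k k1 k2 i : ℤ} (hi : T.MatchL k i) (e1 : k1 = k + 1) (e2 : k2 = k + 2)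
    (h0 : tN k = .B) (h1 : tN k1 = .C) (h2 : tN k2 = .B) :
    tL i = .E ∧ ∃ j, T.MatchL k2 j ∧ tL j = .A := by
  subst e1 e2
  obtain ⟨j, S, hj, he, hS⟩ := T.gapL₂ hi (by simp [h1, inData]) (by simp [h2, inData])
  have ti := T.typeL hi
  have tj := T.typeL hj
  obtain ⟨g1, g2, g3, g4, g5⟩ := T.ok
  simp only [h0, h1, h2, reduceCtorEq, false_and, true_and, false_or, or_false] at ti tj
  rcases ti with ti | ti <;> rcases tj with tj | tj <;> rcases hS with ⟨z1, z2⟩ | ⟨z1, z0, z2⟩ | ⟨z1, z0, z2⟩ | z2 <;>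
    simp [h0, h1, h2, ti, tj, inData, outData, blkLen] at he <;>
    first | (exfalso; omega) | exact ⟨ti, j, hj, tj⟩

theorem L_BCD {k k1 k2 i : ℤ} (hi : T.MatchL k i) (e1 : k1 = k + 1) (e2 : k2 = k + 2)
    (h0 : tN k = .B) (h1 : tN k1 = .C) (h2 : tN k2 = .D) :
    T.MatchL k2 (i + 1) := by
  subst e1 e2
  obtain ⟨j, S, hj, he, hS⟩ := T.gapL₂ hi (by simp [h1, inData]) (by simp [h2, inData])
  have ti := T.typeL hi
  have tj := T.typeL hj
  obtain ⟨g1, g2, g3, g4, g5⟩ := T.ok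
  simp only [h0, h1, h2, reduceCtorEq, false_and, true_and, false_or, or_false] at ti tj
  rcases ti with ti | ti <;> rcases hS with ⟨z1, z2⟩ | ⟨z1, z0, z2⟩ | ⟨z1, z0, z2⟩ | z2 <;>
    simp [h0, h1, h2, ti, tj, inData, outData, blkLen] at he <;>
    first | (exfalso; omega) | (subst z1; exact hj)

theorem L_DCB {k k1 k2 i : ℤ} (hi : T.MatchL k i) (e1 : k1 = k + 1) (e2 : k2 = k + 2)
    (h0 : tN k = .D) (h1 : tN k1 = .C) (h2 : tN k2 = .B) :
    T.MatchL k2 (i + 2) ∧ tL (i + 1) = .B ∧ tL (i + 2) = .A := by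
  subst e1 e2
  obtain ⟨j, S, hj, he, hS⟩ := T.gapL₂ hi (by simp [h1, inData]) (by simp [h2, inData])
  have ti := T.typeL hi
  have tj := T.typeL hj
  obtain ⟨g1, g2, g3, g4, g5⟩ := T.ok
  simp only [h0, h1, h2, reduceCtorEq, false_and, true_and, false_or, or_false] at ti tj
  rcases tj with tj | tj <;> rcases hS with ⟨z1, z2⟩ | ⟨z1, z0, z2⟩ | ⟨z1, z0, z2⟩ | z2 <;>
    simp [h0, h1, h2, ti, tj, inData, outData, blkLen] at he <;>
    first | (exfalso; omega) | (subst z1; exact ⟨hj, z0, tj⟩)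

theorem L_DAD {k k1 k2 i : ℤ} (hi : T.MatchL k i) (e1 : k1 = k + 1) (e2 : k2 = k + 2)
    (h0 : tN k = .D) (h1 : tN k1 = .A) (h2 : tN k2 = .D) :
    T.MatchL k2 (i + 1) := by
  subst e1 e2
  obtain ⟨j, S, hj, he, hS⟩ := T.gapL₂ hi (by simp [h1, inData]) (by simp [h2, inData])
  have ti := T.typeL hi
  have tj := T.typeL hj
  obtain ⟨g1, g2, g3, g4, g5⟩ := T.ok
  simp only [h0, h1, h2, reduceCtorEq, false_and, true_and, false_or, or_false] at ti tj
  rcases hS with ⟨z1, z2⟩ | ⟨z1, z0, z2⟩ | ⟨z1, z0, z2⟩ | z2 <;>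
    simp [h0, h1, h2, ti, tj, inData, outData, blkLen] at he <;>
    first | (exfalso; omega) | (subst z1; exact hj)

theorem L_DACB {k k1 k2 k3 i : ℤ} (hi : T.MatchL k i) (e1 : k1 = k + 1) (e2 : k2 = k + 2) (e3 : k3 = k + 3)
    (h0 : tN k = .D) (h1 : tN k1 = .A) (h2 : tN k2 = .C) (h3 : tN k3 = .B) :
    T.MatchL k3 (i + 2) ∧ tL (i + 1) = .D ∧ tL (i + 2) = .A := by
  subst e1 e2 e3
  obtain ⟨j, S, hj, he, hS⟩ := T.gapL₃ hi (by simp [h1, inData]) (by simp [h2, inData]) (by simp [h3, inData])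
  have ti := T.typeL hi
  have tj := T.typeL hj
  obtain ⟨g1, g2, g3, g4, g5⟩ := T.ok
  simp only [h0, h1, h2, h3, reduceCtorEq, false_and, true_and, false_or, or_false] at ti tj
  rcases tj with tj | tj <;> rcases hS with ⟨z1, z2⟩ | ⟨z1, z0, z2⟩ | ⟨z1, z0, z2⟩ | z2 <;>
    simp [h0, h1, h2, h3, ti, tj, inData, outData, blkLen] at he <;>
    first | (exfalso; omega) | (subst z1; exact ⟨hj, z0, tj⟩)

theorem L_DACD {k k1 k2 k3 i : ℤ} (hi : T.MatchL k i) (e1 : k1 = k + 1) (e2 : k2 = k + 2) (e3 : k3 = k + 3)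
    (h0 : tN k = .D) (h1 : tN k1 = .A) (h2 : tN k2 = .C) (h3 : tN k3 = .D) :
    T.MatchL k3 (i + 2) ∧ tL (i + 1) = .B := by
  subst e1 e2 e3
  obtain ⟨j, S, hj, he, hS⟩ := T.gapL₃ hi (by simp [h1, inData]) (by simp [h2, inData]) (by simp [h3, inData])
  have ti := T.typeL hi
  have tj := T.typeL hj
  obtain ⟨g1, g2, g3, g4, g5⟩ := T.ok
  simp only [h0, h1, h2, h3, reduceCtorEq, false_and, true_and, false_or, or_false] at ti tj
  rcases hS with ⟨z1, z2⟩ | ⟨z1, z0, z2⟩ | ⟨z1, z0, z2⟩ | z2 <;>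
    simp [h0, h1, h2, h3, ti, tj, inData, outData, blkLen] at he <;>
    first | (exfalso; omega) | (subst z1; exact ⟨hj, z0⟩)

theorem U_AC {k k1 i : ℤ} (hi : T.MatchU k i) (e1 : k1 = k + 1)
    (h0 : tN k = .A) (h1 : tN k1 = .C) :
    T.MatchU k1 (i + 1) ∧ tU i = .B := by
  subst e1
  obtain ⟨j, S, hj, he, hS⟩ := T.gapU₁ hi (by simp [h1, outData])
  have ti := T.typeU hi
  have tj := T.typeU hj
  obtain ⟨g1, g2, g3, g4, g5⟩ := T.ok
  simp only [h0, h1, reduceCtorEq, false_and, true_and, false_or, or_false] at ti tj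
  rcases ti with ti | ti <;> rcases hS with ⟨z1, z2⟩ | ⟨z1, z0, z2⟩ | ⟨z1, z0, z2⟩ | z2 <;>
    simp [h0, h1, ti, tj, inData, outData, blkLen] at he <;>
    first | (exfalso; omega) | (subst z1; exact ⟨hj, ti⟩)

theorem U_ADA {k k1 k2 i : ℤ} (hi : T.MatchU k i) (e1 : k1 = k + 1) (e2 : k2 = k + 2)
    (h0 : tN k = .A) (h1 : tN k1 = .D) (h2 : tN k2 = .A) :
    tU i = .B ∧ ∃ j, T.MatchU k2 j ∧ tU j = .E := by
  subst e1 e2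
  obtain ⟨j, S, hj, he, hS⟩ := T.gapU₂ hi (by simp [h1, outData]) (by simp [h2, outData])
  have ti := T.typeU hi
  have tj := T.typeU hj
  obtain ⟨g1, g2, g3, g4, g5⟩ := T.ok
  simp only [h0, h1, h2, reduceCtorEq, false_and, true_and, false_or, or_false] at ti tj
  rcases ti with ti | ti <;> rcases tj with tj | tj <;> rcases hS with ⟨z1, z2⟩ | ⟨z1, z0, z2⟩ | ⟨z1, z0, z2⟩ | z2 <;>
    simp [h0, h1, h2, ti, tj, inData, outData, blkLen] at he <;>
    first | (exfalso; omega) | exact ⟨ti, j, hj, tj⟩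

theorem U_ADC {k k1 k2 i : ℤ} (hi : T.MatchU k i) (e1 : k1 = k + 1) (e2 : k2 = k + 2)
    (h0 : tN k = .A) (h1 : tN k1 = .D) (h2 : tN k2 = .C) :
    T.MatchU k2 (i + 2) ∧ tU i = .B ∧ tU (i + 1) = .A := by
  subst e1 e2
  obtain ⟨j, S, hj, he, hS⟩ := T.gapU₂ hi (by simp [h1, outData]) (by simp [h2, outData])
  have ti := T.typeU hi
  have tj := T.typeU hj
  obtain ⟨g1, g2, g3, g4, g5⟩ := T.ok
  simp only [h0, h1, h2, reduceCtorEq, false_and, true_and, false_or, or_false] at ti tj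
  rcases ti with ti | ti <;> rcases hS with ⟨z1, z2⟩ | ⟨z1, z0, z2⟩ | ⟨z1, z0, z2⟩ | z2 <;>
    simp [h0, h1, h2, ti, tj, inData, outData, blkLen] at he <;>
    first | (exfalso; omega) | (subst z1; exact ⟨hj, ti, z0⟩)

theorem U_CDA {k k1 k2 i : ℤ} (hi : T.MatchU k i) (e1 : k1 = k + 1) (e2 : k2 = k + 2)
    (h0 : tN k = .C) (h1 : tN k1 = .D) (h2 : tN k2 = .A) :
    T.MatchU k2 (i + 1) ∧ tU (i + 1) = .B := by
  subst e1 e2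
  obtain ⟨j, S, hj, he, hS⟩ := T.gapU₂ hi (by simp [h1, outData]) (by simp [h2, outData])
  have ti := T.typeU hi
  have tj := T.typeU hj
  obtain ⟨g1, g2, g3, g4, g5⟩ := T.ok
  simp only [h0, h1, h2, reduceCtorEq, false_and, true_and, false_or, or_false] at ti tj
  rcases tj with tj | tj <;> rcases hS with ⟨z1, z2⟩ | ⟨z1, z0, z2⟩ | ⟨z1, z0, z2⟩ | z2 <;>
    simp [h0, h1, h2, ti, tj, inData, outData, blkLen] at he <;>
    first | (exfalso; omega) | (subst z1; exact ⟨hj, tj⟩)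

theorem U_CBC {k k1 k2 i : ℤ} (hi : T.MatchU k i) (e1 : k1 = k + 1) (e2 : k2 = k + 2)
    (h0 : tN k = .C) (h1 : tN k1 = .B) (h2 : tN k2 = .C) :
    T.MatchU k2 (i + 1) := by
  subst e1 e2
  obtain ⟨j, S, hj, he, hS⟩ := T.gapU₂ hi (by simp [h1, outData]) (by simp [h2, outData])
  have ti := T.typeU hi
  have tj := T.typeU hj
  obtain ⟨g1, g2, g3, g4, g5⟩ := T.ok
  simp only [h0, h1, h2, reduceCtorEq, false_and, true_and, false_or, or_false] at ti tj
  rcases hS with ⟨z1, z2⟩ | ⟨z1, z0, z2⟩ | ⟨z1, z0, z2⟩ | z2 <;>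
    simp [h0, h1, h2, ti, tj, inData, outData, blkLen] at he <;>
    first | (exfalso; omega) | (subst z1; exact hj)

theorem U_CDBA {k k1 k2 k3 i : ℤ} (hi : T.MatchU k i) (e1 : k1 = k + 1) (e2 : k2 = k + 2) (e3 : k3 = k + 3)
    (h0 : tN k = .C) (h1 : tN k1 = .D) (h2 : tN k2 = .B) (h3 : tN k3 = .A) :
    ∃ j, T.MatchU k3 j ∧ tU j = .E := by
  subst e1 e2 e3
  obtain ⟨j, S, hj, he, hS⟩ := T.gapU₃ hi (by simp [h1, outData]) (by simp [h2, outData]) (by simp [h3, outData])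
  have ti := T.typeU hi
  have tj := T.typeU hj
  obtain ⟨g1, g2, g3, g4, g5⟩ := T.ok
  simp only [h0, h1, h2, h3, reduceCtorEq, false_and, true_and, false_or, or_false] at ti tj
  rcases tj with tj | tj <;> rcases hS with ⟨z1, z2⟩ | ⟨z1, z0, z2⟩ | ⟨z1, z0, z2⟩ | z2 <;>
    simp [h0, h1, h2, h3, ti, tj, inData, outData, blkLen] at he <;>
    first | (exfalso; omega) | exact ⟨j, hj, tj⟩

theorem U_CDBC {k k1 k2 k3 i : ℤ} (hi : T.MatchU k i) (e1 : k1 = k + 1) (e2 : k2 = k + 2) (e3 : k3 = k + 3)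
    (h0 : tN k = .C) (h1 : tN k1 = .D) (h2 : tN k2 = .B) (h3 : tN k3 = .C) :
    T.MatchU k3 (i + 2) ∧ tU (i + 1) = .A := by
  subst e1 e2 e3
  obtain ⟨j, S, hj, he, hS⟩ := T.gapU₃ hi (by simp [h1, outData]) (by simp [h2, outData]) (by simp [h3, outData])
  have ti := T.typeU hi
  have tj := T.typeU hj
  obtain ⟨g1, g2, g3, g4, g5⟩ := T.ok
  simp only [h0, h1, h2, h3, reduceCtorEq, false_and, true_and, false_or, or_false] at ti tj
  rcases hS with ⟨z1, z2⟩ | ⟨z1, z0, z2⟩ | ⟨z1, z0, z2⟩ | z2 <;>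
    simp [h0, h1, h2, h3, ti, tj, inData, outData, blkLen] at he <;>
    first | (exfalso; omega) | (subst z1; exact ⟨hj, z0⟩)

theorem U_ADBC {k k1 k2 k3 i : ℤ} (hi : T.MatchU k i) (e1 : k1 = k + 1) (e2 : k2 = k + 2) (e3 : k3 = k + 3)
    (h0 : tN k = .A) (h1 : tN k1 = .D) (h2 : tN k2 = .B) (h3 : tN k3 = .C) :
    T.MatchU k3 (i + 2) ∧ tU i = .B ∧ tU (i + 1) = .C := by
  subst e1 e2 e3
  obtain ⟨j, S, hj, he, hS⟩ := T.gapU₃ hi (by simp [h1, outData]) (by simp [h2, outData]) (by simp [h3, outData])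
  have ti := T.typeU hi
  have tj := T.typeU hj
  obtain ⟨g1, g2, g3, g4, g5⟩ := T.ok
  simp only [h0, h1, h2, h3, reduceCtorEq, false_and, true_and, false_or, or_false] at ti tj
  rcases ti with ti | ti <;> rcases hS with ⟨z1, z2⟩ | ⟨z1, z0, z2⟩ | ⟨z1, z0, z2⟩ | z2 <;>
    simp [h0, h1, h2, h3, ti, tj, inData, outData, blkLen] at he <;>
    first | (exfalso; omega) | (subst z1; exact ⟨hj, ti, z0⟩)

end Triple

/-! ### Three stacked strips: cutting them simultaneously into pieces. -/

/-- The blocks of `t` from index `k` on start with the list `l`. -/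
def Reads (t : ℤ → Blk) : ℤ → List Blk → Prop
  | _, [] => True
  | k, x :: l => t k = x ∧ Reads t (k + 1) l

/-- The blocks of the lower of three strips that are combined into one block. -/
def seqL : Blk → List Blk
  | .A => [.C, .A]
  | .B => [.C, .B]
  | .C => [.C, .C, .A]
  | .D => [.C, .D, .A]
  | .E => [.C, .C, .B, .A]

/-- The blocks of the middle one of three strips that are combined into one block. -/
def seqN : Blk → List Blk
  | .A => [.D, .B, .C]
  | .B => [.D, .A, .C]
  | .C => [.D, .A, .D, .B, .C]
  | .D => [.D, .A, .C, .B, .C]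
  | .E => [.D, .A, .D, .C, .B, .C]

/-- The blocks of the upper of three strips that are combined into one block. -/
def seqU : Blk → List Blk
  | .A => [.A, .D]
  | .B => [.B, .D]
  | .C => [.B, .C, .D]
  | .D => [.B, .D, .D]
  | .E => [.B, .A, .D, .D]

namespace Triple
variable {a b s : ℤ} {pL pN pU : ℤ → ℤ} {tL tN tU : ℤ → Blk}
variable (T : Triple a b s pL tL pN tN pU tU)
include T

open MarkData

/-- `E` carries marks on both sides, and every possible past of at most three blocks is excluded by
one side or the other. -/
theorem not_E {k : ℤ} (h : tN k = .E) : False := by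
  cases h1 : tN (k - 1) with
  | A => exact T.not_U_AE (by omega) h1 h
  | C => exact T.not_U_CE (by omega) h1 h
  | E => exact T.not_L_EE (by omega) h1 h
  | B =>
    cases h2 : tN (k - 2) with
    | A => exact T.not_U_ABE (by omega) (by omega) h2 h1 h
    | B => exact T.not_L_BB (by omega) h2 h1
    | C => exact T.not_U_CBE (by omega) (by omega) h2 h1 h
    | E => exact T.not_L_EB (by omega) h2 h1
    | D =>
      cases h3 : tN (k - 3) with
      | A => exact T.not_U_ADBE (by omega) (by omega) (by omega) h3 h2 h1 h
      | B => exact T.not_L_BD (by omega) h3 h2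
      | C => exact T.not_U_CDBE (by omega) (by omega) (by omega) h3 h2 h1 h
      | D => exact T.not_L_DD (by omega) h3 h2
      | E => exact T.not_L_ED (by omega) h3 h2
  | D =>
    cases h2 : tN (k - 2) with
    | A => exact T.not_U_ADE (by omega) (by omega) h2 h1 h
    | B => exact T.not_L_BD (by omega) h2 h1
    | C => exact T.not_U_CDE (by omega) (by omega) h2 h1 h
    | D => exact T.not_L_DD (by omega) h2 h1
    | E => exact T.not_L_ED (by omega) h2 h1

/-- Such a pair has no possible successor. -/
theorem not_AB {k k1 : ℤ} (e1 : k1 = k + 1) (h0 : tN k = .A) (h1 : tN k1 = .B) : False := by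
  cases h2 : tN (k + 2) with
  | A => exact T.not_U_ABA e1 rfl h0 h1 h2
  | B => exact T.not_L_BB (by omega) h1 h2
  | C => exact T.not_U_ABC e1 rfl h0 h1 h2
  | D => exact T.not_L_BD (by omega) h1 h2
  | E => exact T.not_E h2

theorem eq_C_or_D_of_A {k k1 : ℤ} (e1 : k1 = k + 1) (h : tN k = .A) :
    tN k1 = .C ∨ tN k1 = .D := by
  cases h1 : tN k1 with
  | A => exact (T.not_U_AA e1 h h1).elim
  | B => exact (T.not_AB e1 h h1).elim
  | C => exact Or.inl rfl
  | D => exact Or.inr rfl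
  | E => exact (T.not_E h1).elim

theorem eq_B_or_D_of_C {k k1 : ℤ} (e1 : k1 = k + 1) (h : tN k = .C) :
    tN k1 = .B ∨ tN k1 = .D := by
  cases h1 : tN k1 with
  | A => exact (T.not_U_CA e1 h h1).elim
  | B => exact Or.inl rfl
  | C => exact (T.not_U_CC e1 h h1).elim
  | D => exact Or.inr rfl
  | E => exact (T.not_E h1).elim

theorem not_BA {k k1 : ℤ} (e1 : k1 = k + 1) (h0 : tN k = .B) (h1 : tN k1 = .A) : False := by
  cases hm : tN (k - 1) with
  | A => exact T.not_U_ABA (by omega) (by omega) hm h0 h1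
  | B => exact T.not_L_BB (by omega) hm h0
  | C => exact T.not_U_CBA (by omega) (by omega) hm h0 h1
  | E => exact T.not_E hm
  | D =>
    cases hl : tN (k - 2) with
    | A => exact T.not_U_ADBA (by omega) (by omega) (by omega) hl hm h0 h1
    | B => exact T.not_L_BD (by omega) hl hm
    | D => exact T.not_L_DD (by omega) hl hm
    | E => exact T.not_E hl
    | C =>
      -- The one context left is C D B A. There the final `A` is matched to a block `E` of the upper
      -- strip, whereas a following `C` would require `B`; a following `D` gives the excluded word B
      -- A D.
      obtain ⟨i, hi⟩ := T.existsU (k := k - 2) (by simp [hl, outData])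
      obtain ⟨j, hj, htj⟩ := T.U_CDBA (k3 := k1) hi rfl rfl (by omega) hl
        (by rwa [show k - 2 + 1 = k - 1 by ring]) (by rwa [show k - 2 + 2 = k by ring]) h1
      rcases T.eq_C_or_D_of_A (k1 := k1 + 1) rfl h1 with h2 | h2
      · have := (T.U_AC hj rfl h1 h2).2
        simp [htj] at this
      · exact T.not_L_BAD (by omega) (by omega) h0 h1 h2

theorem eq_C_of_B {k k1 : ℤ} (e1 : k1 = k + 1) (h : tN k = .B) : tN k1 = .C := by
  cases h1 : tN k1 with
  | A => exact (T.not_BA e1 h h1).elim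
  | B => exact (T.not_L_BB e1 h h1).elim
  | C => rfl
  | D => exact (T.not_L_BD e1 h h1).elim
  | E => exact (T.not_E h1).elim

theorem of_D {k k1 : ℤ} (e1 : k1 = k + 1) (h : tN k = .D) :
    tN k1 = .A ∨ tN k1 = .B ∨ tN k1 = .C := by
  cases h1 : tN k1 with
  | A => simp
  | B => simp
  | C => simp
  | D => exact (T.not_L_DD e1 h h1).elim
  | E => exact (T.not_E h1).elim

/-- The second `A` is matched to a block `E` above, but each of its possible continuations C, D A, D
B C, D C requires a block `B` there. -/
theorem not_ADA {k k1 k2 : ℤ} (e1 : k1 = k + 1) (e2 : k2 = k + 2) (h0 : tN k = .A)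
    (h1 : tN k1 = .D) (h2 : tN k2 = .A) : False := by
  obtain ⟨i, hi⟩ := T.existsU (k := k) (by simp [h0, outData])
  obtain ⟨-, j, hj, htj⟩ := T.U_ADA hi e1 e2 h0 h1 h2
  rcases T.eq_C_or_D_of_A (k1 := k2 + 1) rfl h2 with h3 | h3
  · have := (T.U_AC hj rfl h2 h3).2
    simp [htj] at this
  · rcases T.of_D (k1 := k2 + 2) (by omega) h3 with h4 | h4 | h4
    · have := (T.U_ADA hj rfl rfl h2 h3 h4).1
      simp [htj] at this
    · have h5 := T.eq_C_of_B (k1 := k2 + 3) (by omega) h4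
      have := (T.U_ADBC hj rfl rfl rfl h2 h3 h4 h5).2.1
      simp [htj] at this
    · have := (T.U_ADC hj rfl rfl h2 h3 h4).2.1
      simp [htj] at this

/-- Blocks `B`, `C` whose `B` is matched to a block `A` are followed by `D`. -/
theorem eq_D_of_BC {k k1 k2 i : ℤ} (e1 : k1 = k + 1) (e2 : k2 = k + 2) (h0 : tN k = .B)
    (h1 : tN k1 = .C) (hi : T.MatchL k i) (hti : tL i = .A) : tN k2 = .D := by
  rcases T.eq_B_or_D_of_C (k1 := k2) (by omega) h1 with h2 | h2
  · have := (T.L_BCB hi e1 e2 h0 h1 h2).1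
    simp [hti] at this
  · exact h2

/-- After `C` the strip may continue with B C at most twice: in B C B the second `B` is matched to
`A`, and then `eq_D_of_BC` applies. -/
theorem exists_CD_of_C {k : ℤ} (h : tN k = .C) :
    ∃ m, k ≤ m ∧ m ≤ k + 4 ∧ tN m = .C ∧ tN (m + 1) = .D := by
  rcases T.eq_B_or_D_of_C (k1 := k + 1) rfl h with h1 | h1
  · have h2 := T.eq_C_of_B (k1 := k + 2) (by omega) h1
    rcases T.eq_B_or_D_of_C (k1 := k + 3) (by omega) h2 with h3 | h3
    · have h4 := T.eq_C_of_B (k1 := k + 4) (by omega) h3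
      obtain ⟨i, hi⟩ := T.existsL (k := k + 1) (by simp [h1, inData])
      obtain ⟨-, j, hj, htj⟩ := T.L_BCB (k1 := k + 2) (k2 := k + 3) hi (by omega) (by omega) h1 h2 h3
      have h5 := T.eq_D_of_BC (k1 := k + 4) (k2 := k + 5) (by omega) (by omega) h3 h4 hj htj
      exact ⟨k + 4, by omega, le_rfl, h4, by rwa [show k + 4 + 1 = k + 5 by ring]⟩
    · exact ⟨k + 2, by omega, by omega, h2, by rwa [show k + 2 + 1 = k + 3 by ring]⟩
  · exact ⟨k, le_rfl, by omega, h, h1⟩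

theorem exists_CD (k : ℤ) : ∃ m, m ≤ k ∧ tN m = .C ∧ tN (m + 1) = .D := by
  -- From position `k - 8` a block `C` is reached within four steps (the longest way is D A D B C),
  -- and from there a pair C D starts within four more, hence not beyond `k`.
  have key : ∃ l, l ≤ k - 4 ∧ tN l = .C := by
    have hA : ∀ l, l + 3 ≤ k - 4 → tN l = .A → ∃ l, l ≤ k - 4 ∧ tN l = .C := by
      intro l hl h
      rcases T.eq_C_or_D_of_A (k1 := l + 1) rfl h with h1 | h1
      · exact ⟨_, by omega, h1⟩
      · rcases T.of_D (k1 := l + 2) (by omega) h1 with h2 | h2 | h2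
        · exact (T.not_ADA rfl rfl h h1 h2).elim
        · exact ⟨l + 3, by omega, T.eq_C_of_B (by omega) h2⟩
        · exact ⟨_, by omega, h2⟩
    have hB : ∀ l, l + 1 ≤ k - 4 → tN l = .B → ∃ l, l ≤ k - 4 ∧ tN l = .C :=
      fun l hl h => ⟨l + 1, hl, T.eq_C_of_B rfl h⟩
    cases h : tN (k - 8) with
    | A => exact hA _ (by omega) h
    | B => exact hB _ (by omega) h
    | C => exact ⟨_, by omega, h⟩
    | D =>
      rcases T.of_D (k1 := k - 7) (by omega) h with h1 | h1 | h1
      · exact hA _ (by omega) h1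
      · exact hB _ (by omega) h1
      · exact ⟨_, by omega, h1⟩
    | E => exact (T.not_E h).elim
  obtain ⟨l, hl, h⟩ := key
  obtain ⟨m, h1, h2, h3⟩ := T.exists_CD_of_C h
  exact ⟨m, by omega, h3⟩

/-- The places where the three strips are cut into blocks of a higher level. -/
structure Cut (k i u : ℤ) : Prop where
  hC : tN k = .C
  hD : tN (k + 1) = .D
  hi : T.MatchL (k + 1) i
  hu : T.MatchU k u

/-- The middle strip is cut inside each pair C D. By the excluded words there are only five ways
from one cut to the next, the words `seqN`, and each of them determines the corresponding pieces
`seqL` and `seqU` of the neighbours. -/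
theorem Cut.step {k i u : ℤ} (h : T.Cut k i u) :
    ∃ Q, T.Cut (k + (seqN Q).length) (i + (seqL Q).length) (u + (seqU Q).length) ∧
      Reads tN (k + 1) (seqN Q) ∧ Reads tL i (seqL Q) ∧ Reads tU (u + 1) (seqU Q) := by
  obtain ⟨hC, hD, hi, hu⟩ := h
  have hti : tL i = .C := by simpa [hD] using T.typeL hi
  have typeD : ∀ {k u : ℤ}, T.MatchU k u → tN k = .C → tU u = .D := by
    intro k u h h0
    simpa [h0] using T.typeU h
  rcases T.of_D (k1 := k + 2) (by omega) hD with h2 | h2 | h2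
  · have u1 := T.U_CDA hu rfl rfl hC hD h2
    rcases T.eq_C_or_D_of_A (k1 := k + 3) (by omega) h2 with h3 | h3
    · have u2 := T.U_AC (k1 := k + 3) u1.1 (by omega) h2 h3
      have t2 := typeD u2.1 h3
      rcases T.eq_B_or_D_of_C (k1 := k + 4) (by omega) h3 with h4 | h4
      · have i1 := T.L_DACB (k1 := k + 2) (k2 := k + 3) (k3 := k + 4) hi (by omega) (by omega)
          (by omega) hD h2 h3 h4
        have h5 := T.eq_C_of_B (k1 := k + 5) (by omega) h4
        have h6 := T.eq_D_of_BC (k1 := k + 5) (k2 := k + 6) (by omega) (by omega) h4 h5 i1.1 i1.2.2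
        have i2 := T.L_BCD (k1 := k + 5) (k2 := k + 6) i1.1 (by omega) (by omega) h4 h5 h6
        have u3 := T.U_CBC (k1 := k + 4) (k2 := k + 5) u2.1 (by omega) (by omega) h3 h4 h5
        have t3 := typeD u3 h5
        refine ⟨.D, ⟨h5, ?_, ?_, ?_⟩, ?_, ?_, ?_⟩ <;>
          simp only [seqN, seqL, seqU, Reads, List.length_cons, List.length_nil] <;>
          push_cast <;> ring_nf at * <;> simp_all
      · have i1 := T.L_DACD (k1 := k + 2) (k2 := k + 3) (k3 := k + 4) hi (by omega) (by omega)
          (by omega) hD h2 h3 h4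
        refine ⟨.B, ⟨h3, ?_, ?_, ?_⟩, ?_, ?_, ?_⟩ <;>
          simp only [seqN, seqL, seqU, Reads, List.length_cons, List.length_nil] <;>
          push_cast <;> ring_nf at * <;> simp_all
    · have i1 := T.L_DAD (k1 := k + 2) (k2 := k + 3) hi (by omega) (by omega) hD h2 h3
      have ti1 : tL (i + 1) = .C := by simpa [h3] using T.typeL i1
      rcases T.of_D (k1 := k + 4) (by omega) h3 with h4 | h4 | h4
      · exact (T.not_ADA (by omega) (by omega) h2 h3 h4).elim
      · have i2 := T.L_DB (k1 := k + 4) i1 (by omega) h3 h4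
        have h5 := T.eq_C_of_B (k1 := k + 5) (by omega) h4
        have h6 := T.eq_D_of_BC (k1 := k + 5) (k2 := k + 6) (by omega) (by omega) h4 h5 i2.1 i2.2
        have i3 := T.L_BCD (k1 := k + 5) (k2 := k + 6) i2.1 (by omega) (by omega) h4 h5 h6
        have u2 := T.U_ADBC (k1 := k + 3) (k2 := k + 4) (k3 := k + 5) u1.1 (by omega) (by omega)
          (by omega) h2 h3 h4 h5
        have t2 := typeD u2.1 h5
        refine ⟨.C, ⟨h5, ?_, ?_, ?_⟩, ?_, ?_, ?_⟩ <;>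
          simp only [seqN, seqL, seqU, Reads, List.length_cons, List.length_nil] <;>
          push_cast <;> ring_nf at * <;> simp_all
      · have u2 := T.U_ADC (k1 := k + 3) (k2 := k + 4) u1.1 (by omega) (by omega) h2 h3 h4
        have t2 := typeD u2.1 h4
        have h5 : tN (k + 5) = .B := (T.eq_B_or_D_of_C (k1 := k + 5) (by omega) h4).resolve_right
          fun h5 => T.not_L_DCD (by omega) (by omega) h3 h4 h5
        have i2 := T.L_DCB (k1 := k + 4) (k2 := k + 5) i1 (by omega) (by omega) h3 h4 h5
        have h6 := T.eq_C_of_B (k1 := k + 6) (by omega) h5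
        have h7 := T.eq_D_of_BC (k1 := k + 6) (k2 := k + 7) (by omega) (by omega) h5 h6 i2.1 i2.2.2
        have i3 := T.L_BCD (k1 := k + 6) (k2 := k + 7) i2.1 (by omega) (by omega) h5 h6 h7
        have u3 := T.U_CBC (k1 := k + 5) (k2 := k + 6) u2.1 (by omega) (by omega) h4 h5 h6
        have t3 := typeD u3 h6
        refine ⟨.E, ⟨h6, ?_, ?_, ?_⟩, ?_, ?_, ?_⟩ <;>
          simp only [seqN, seqL, seqU, Reads, List.length_cons, List.length_nil] <;>
          push_cast <;> ring_nf at * <;> simp_all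
  · have i1 := T.L_DB (k1 := k + 2) hi (by omega) hD h2
    have h3 := T.eq_C_of_B (k1 := k + 3) (by omega) h2
    have h4 := T.eq_D_of_BC (k1 := k + 3) (k2 := k + 4) (by omega) (by omega) h2 h3 i1.1 i1.2
    have i2 := T.L_BCD (k1 := k + 3) (k2 := k + 4) i1.1 (by omega) (by omega) h2 h3 h4
    have u1 := T.U_CDBC (k1 := k + 1) (k2 := k + 2) (k3 := k + 3) hu rfl rfl rfl hC hD h2 h3
    have t1 := typeD u1.1 h3
    refine ⟨.A, ⟨h3, ?_, ?_, ?_⟩, ?_, ?_, ?_⟩ <;>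
      simp only [seqN, seqL, seqU, Reads, List.length_cons, List.length_nil] <;>
      push_cast <;> ring_nf at * <;> simp_all
  · exact (T.not_U_CDC rfl rfl hC hD h2).elim

end Triple

/-! ### Substitutions of block sequences, and the marks of their images. -/

theorem reads_iff {t : ℤ → Blk} {k : ℤ} {l : List Blk} :
    Reads t k l ↔ ∀ n (h : n < l.length), t (k + n) = l[n] := by
  induction l generalizing k with
  | nil => simp [Reads]
  | cons x l ih =>
    rw [Reads, ih]
    constructor
    · rintro ⟨h0, h⟩ n hn
      cases n with
      | zero => rw [Nat.cast_zero, add_zero]; exact h0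
      | succ n =>
        rw [show k + ((n + 1 : ℕ) : ℤ) = k + 1 + n by push_cast; ring]
        exact h n (by simpa using hn)
    · intro h
      have h0 := h 0 (by simp)
      rw [Nat.cast_zero, add_zero] at h0
      refine ⟨h0, fun n hn => ?_⟩
      have := h (n + 1) (by simpa using hn)
      rwa [show k + ((n + 1 : ℕ) : ℤ) = k + 1 + n by push_cast; ring] at this

/-- The sequence `t` is obtained from `Q` by the substitution `seq`; the image of the term `k` of
`Q` starts at the index `K k`. -/
def Refines (t Q : ℤ → Blk) (seq : Blk → List Blk) (K : ℤ → ℤ) : Prop :=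
  ∀ k, K (k + 1) = K k + (seq (Q k)).length ∧ Reads t (K k) (seq (Q k))

namespace MarkData

/-- The total length of a list of blocks. -/
def lnSum (M : MarkData) : List Blk → ℤ
  | [] => 0
  | x :: l => M.ln x + lnSum M l

/-- The offset `i` lies in a mark of a block of the list. -/
def InSeq (M : MarkData) : List Blk → ℤ → Prop
  | [], _ => False
  | x :: l, i => M.InMark x i ∨ InSeq M l (i - M.ln x)

variable {M : MarkData} {p : ℤ → ℤ} {t Q : ℤ → Blk} {seq : Blk → List Blk} {K : ℤ → ℤ}

theorem Layout.of_reads (h : M.Layout p t) {k : ℤ} {l : List Blk} (hl : Reads t k l) :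
    p (k + l.length) = p k + M.lnSum l := by
  induction l generalizing k with
  | nil => simp [lnSum]
  | cons x l ih =>
    have h1 := ih hl.2
    have h2 := h k
    rw [hl.1] at h2
    rw [lnSum, List.length_cons, ← add_assoc, ← h2, ← h1]
    push_cast
    ring_nf

theorem inSeq_iff (h : M.Layout p t) {k i : ℤ} {l : List Blk} (hl : Reads t k l) :
    M.InSeq l (i - p k) ↔ ∃ j, k ≤ j ∧ j < k + l.length ∧ M.InMark (t j) (i - p j) := by
  induction l generalizing k with
  | nil =>
    simp only [InSeq, List.length_nil, false_iff]
    rintro ⟨j, h1, h2, -⟩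
    simp at h2
    omega
  | cons x l ih =>
    have h1 := ih hl.2
    have h2 := h k
    rw [hl.1] at h2
    rw [InSeq, show i - p k - M.ln x = i - p (k + 1) by omega, h1]
    constructor
    · rintro (h3 | ⟨j, h3, h4, h5⟩)
      · exact ⟨k, le_rfl, by simp, by rwa [hl.1]⟩
      · exact ⟨j, by omega, by simp; omega, h5⟩
    · rintro ⟨j, h3, h4, h5⟩
      rcases eq_or_lt_of_le h3 with rfl | h3
      · left; rwa [hl.1] at h5
      · exact Or.inr ⟨j, by omega, by simp at h4; omega, h5⟩

theorem mem_zone_refines (h : M.Layout p t) (hr : Refines t Q seq K)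
    (hs : ∀ x, 0 < (seq x).length) {i : ℤ} :
    i ∈ M.zone p t ↔ ∃ k, M.InSeq (seq (Q k)) (i - p (K k)) := by
  have hK : StrictMono K := strictMono_int_of_lt_succ fun k => by
    have := (hr k).1; have := hs (Q k); omega
  constructor
  · rintro ⟨j, hj⟩
    obtain ⟨k, h1, h2⟩ := exists_mem_interval hK j
    exact ⟨k, (inSeq_iff h (hr k).2).2 ⟨j, h1, by have := (hr k).1; omega, hj⟩⟩
  · rintro ⟨k, hk⟩
    obtain ⟨j, -, -, hj⟩ := (inSeq_iff h (hr k).2).1 hk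
    exact ⟨j, hj⟩

theorem lnSum_take_succ (M : MarkData) (l : List Blk) (n : ℕ) (hn : n < l.length) :
    M.lnSum (l.take (n + 1)) = M.lnSum (l.take n) + M.ln l[n] := by
  induction l generalizing n with
  | nil => simp at hn
  | cons x l ih =>
    cases n with
    | zero => simp [lnSum]
    | succ n =>
      have := ih n (by simpa using hn)
      simp only [List.take_succ_cons, lnSum, List.getElem_cons_succ, this]
      ring

/-- Substitution in a layout. -/
theorem exists_refines (M M' : MarkData) {P : ℤ → ℤ} (c : ℤ) (hs : ∀ x, 0 < (seq x).length)
    (hl : ∀ x, M.lnSum (seq x) = M'.ln x) (hP : M'.Layout P Q) :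
    ∃ p t K, M.Layout p t ∧ Refines t Q seq K ∧ ∀ k, p (K k) = P k + c := by
  obtain ⟨K, -, hK⟩ := exists_int_partialSum fun k => ((seq (Q k)).length : ℤ)
  have hKm : StrictMono K := strictMono_int_of_lt_succ fun k => by
    have := hK k; have := hs (Q k); omega
  -- `o j` is the index of the term of `Q` whose image covers position `j`; the new blocks and their
  -- places are read off from it.
  choose o ho1 ho2 using exists_mem_interval hKm
  have hlt : ∀ j, (j - K (o j)).toNat < (seq (Q (o j))).length := by
    intro j
    have := ho1 j; have := ho2 j; have := hK (o j)
    omega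
  have hoK : ∀ k (n : ℕ), n < (seq (Q k)).length → o (K k + n) = k := by
    intro k n hn
    have := hK k
    exact interval_unique hKm (ho1 _) (ho2 _) (by omega) (by omega)
  let t : ℤ → Blk := fun j => (seq (Q (o j)))[(j - K (o j)).toNat]'(hlt j)
  let p : ℤ → ℤ := fun j => P (o j) + c + M.lnSum ((seq (Q (o j))).take (j - K (o j)).toNat)
  have hpK : ∀ k, p (K k) = P k + c := by
    intro k
    have := hoK k 0 (hs _)
    simp only [Nat.cast_zero, add_zero] at this
    simp [p, this, lnSum]
  refine ⟨p, t, K, ?_, ?_, hpK⟩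
  · intro j
    have h1 : p j + M.ln (t j) =
        P (o j) + c + M.lnSum ((seq (Q (o j))).take ((j - K (o j)).toNat + 1)) := by
      rw [lnSum_take_succ _ _ _ (hlt j)]
      simp only [p, t]
      ring
    rw [h1]
    have h3 := hlt j
    have h4 := ho1 j
    rcases (show (j - K (o j)).toNat + 1 < (seq (Q (o j))).length ∨
      (j - K (o j)).toNat + 1 = (seq (Q (o j))).length by omega) with h2 | h2
    · have h5 := hoK _ _ h2
      rw [show K (o j) + (((j - K (o j)).toNat + 1 : ℕ) : ℤ) = j + 1 by omega] at h5
      simp only [p, h5]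
      congr 3
      omega
    · have h5 := hK (o j)
      rw [show j + 1 = K (o j + 1) by omega, hpK, h2, List.take_length, hl, hP]
      ring
  · intro k
    refine ⟨hK k, reads_iff.2 fun n hn => ?_⟩
    have h1 := hoK k n hn
    have h2 : (K k + n - K (o (K k + n))).toNat = n := by rw [h1]; omega
    simp only [t]
    congr 1 <;> simp [h1]

theorem match_unique {M' : MarkData} (hM' : M'.Wf) {p' : ℤ → ℤ} {t' : ℤ → Blk}
    (h' : M'.Layout p' t') {k i j : ℤ} (hi : Match M M' p t p' t' k i)
    (hj : Match M M' p t p' t' k j) : i = j := by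
  have h1 := hi.1; have h2 := hj.1; have h3 := hi.2; have h4 := hj.2
  have h5 := hM' (t' i); have h6 := hM' (t' j)
  rcases lt_trichotomy i j with h | h | h
  · have := h'.sep hM' h hi.symm.2.2 hj.symm.2.2; omega
  · exact h
  · have := h'.sep hM' h hj.symm.2.2 hi.symm.2.2; omega

end MarkData

open MarkData

section Local
variable {a b s : ℤ}

/-- These four lemmas compare marks block by block. Relative to a block three levels higher, the
lower word starts at offset 0, the middle one at `a + b + 1 - 2 * s` and the upper one at `a + 2 *
b`. With these offsets the outer marks are those of the large block and the inner marks cancel, so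
they serve both for combining and for splitting. -/
theorem inMark_seqL (h : LevelOk a b s) (x : Blk) (i : ℤ) :
    (inData (a + 2 * b) (2 * a + 3 * b) (1 - s)).InMark x i ↔
      (inData b (a + b) (1 - s)).InSeq (seqL x) i := by
  obtain ⟨g1, g2, g3, g4, g5⟩ := h
  cases x <;> simp [InMark, InSeq, seqL, inData, blkLen] <;> omega

theorem inMark_seqU (h : LevelOk a b s) (x : Blk) (i : ℤ) :
    (outData (a + 2 * b) (2 * a + 3 * b) (1 - s)).InMark x i ↔
      (outData b (a + b) (1 - s)).InSeq (seqU x) (i - (a + 2 * b)) := by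
  obtain ⟨g1, g2, g3, g4, g5⟩ := h
  cases x <;> simp [InMark, InSeq, seqU, outData, blkLen] <;> omega

theorem inSeq_seqL_seqN (h : LevelOk a b s) (x : Blk) (i : ℤ) :
    (outData b (a + b) (1 - s)).InSeq (seqL x) i ↔
      (inData a b s).InSeq (seqN x) (i - (a + b + 1 - 2 * s)) := by
  obtain ⟨g1, g2, g3, g4, g5⟩ := h
  cases x <;> simp [InMark, InSeq, seqL, seqN, inData, outData, blkLen] <;> omega

theorem inSeq_seqN_seqU (h : LevelOk a b s) (x : Blk) (i : ℤ) :
    (outData a b s).InSeq (seqN x) (i - (a + b + 1 - 2 * s)) ↔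
      (inData b (a + b) (1 - s)).InSeq (seqU x) (i - (a + 2 * b)) := by
  obtain ⟨g1, g2, g3, g4, g5⟩ := h
  cases x <;> simp [InMark, InSeq, seqU, seqN, inData, outData, blkLen] <;> omega

end Local

open MarkData

theorem seqL_length_pos (x : Blk) : 0 < (seqL x).length := by cases x <;> simp [seqL]
theorem seqN_length_pos (x : Blk) : 0 < (seqN x).length := by cases x <;> simp [seqN]
theorem seqU_length_pos (x : Blk) : 0 < (seqU x).length := by cases x <;> simp [seqU]

namespace Triple
variable {a b s : ℤ} {pL pN pU : ℤ → ℤ} {tL tN tU : ℤ → Blk}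

/-- Chaining the two matched marks at a cut gives the offset between upper and lower piece. It does
not depend on the cut, so both sides of a large block can be measured from the start of its lower
piece. -/
theorem Cut.start (T : Triple a b s pL tL pN tN pU tU) {k i u : ℤ} (h : T.Cut k i u) :
    pU (u + 1) = pL i + (a + 2 * b) := by
  obtain ⟨hC, hD, hi, hu⟩ := h
  have ti : tL i = .C := by simpa [hD] using T.typeL hi
  have tu : tU u = .D := by simpa [hC] using T.typeU hu
  have h1 := hi.1
  have h2 := hu.1
  have h3 := T.hN k
  have h4 := T.hU u
  simp [hC, hD, ti, tu, inData, outData, blkLen] at h1 h2 h3 h4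
  omega

/-- No word `seqN` contains C D, so `Cut.step` leads to the next cut and skips none;
`exists_consecutive` needs this. -/
theorem Cut.not_between {k w : ℤ} {x : Blk}
    (h : Reads tN (k + 1) (seqN x)) (h1 : k < w) (h2 : w < k + (seqN x).length) :
    ¬ (tN w = .C ∧ tN (w + 1) = .D) := by
  have key : ∀ (x : Blk) (n : ℕ) (hn : n + 1 < (seqN x).length),
      (seqN x)[n] = .C → (seqN x)[n + 1] ≠ .D := by
    intro x n hn
    have hn' : n < 8 := by cases x <;> simp [seqN] at hn <;> omega
    cases x <;> interval_cases n <;> first | (simp [seqN]; done) | simp [seqN] at hn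
  rw [reads_iff] at h
  obtain ⟨n, rfl⟩ : ∃ n : ℕ, w = k + 1 + n := ⟨(w - k - 1).toNat, by omega⟩
  rintro ⟨h3, h4⟩
  have hn : n + 1 < (seqN x).length := by omega
  rw [h n (by omega)] at h3
  rw [show k + 1 + n + 1 = k + 1 + ((n + 1 : ℕ) : ℤ) by push_cast; ring, h (n + 1) hn] at h4
  exact key x n hn h3 h4

/-- Three consecutive strips, one of a level between two of the next level, form one strip of the
level three above. -/
theorem combine (T : Triple a b s pL tL pN tN pU tU) :
    ∃ P Q KL KU, (∀ k, P (k + 1) = P k + blkLen (a + 2 * b) (2 * a + 3 * b) (Q k)) ∧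
      (inData (a + 2 * b) (2 * a + 3 * b) (1 - s)).zone P Q =
        (inData b (a + b) (1 - s)).zone pL tL ∧
      (outData (a + 2 * b) (2 * a + 3 * b) (1 - s)).zone P Q =
        (outData b (a + b) (1 - s)).zone pU tU ∧
      Refines tL Q seqL KL ∧ Refines tU Q seqU KU := by
  have hcut : ∀ k, tN k = .C → tN (k + 1) = .D → ∃ i u, T.Cut k i u := by
    intro k h1 h2
    obtain ⟨i, hi⟩ := T.existsL (k := k + 1) (by simp [h2, inData])
    obtain ⟨u, hu⟩ := T.existsU (k := k) (by simp [h1, outData])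
    exact ⟨i, u, h1, h2, hi, hu⟩
  obtain ⟨κ, hκ⟩ := exists_consecutive (V := {k | tN k = .C ∧ tN (k + 1) = .D})
    (Good := fun k k' => ∃ x i u, k' = k + (seqN x).length ∧ T.Cut k i u ∧
      T.Cut k' (i + (seqL x).length) (u + (seqU x).length) ∧ Reads tL i (seqL x) ∧
      Reads tU (u + 1) (seqU x))
    (fun n => by
      obtain ⟨m, h1, h2⟩ := T.exists_CD n
      exact ⟨m, h2, h1⟩)
    (fun k hk => by
      obtain ⟨i, u, hc⟩ := hcut k hk.1 hk.2
      obtain ⟨x, h1, h2, h3, h4⟩ := Cut.step T hc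
      have := seqN_length_pos x
      exact ⟨_, ⟨h1.hC, h1.hD⟩, by omega, fun w hw hw' => Cut.not_between h2 hw hw',
        x, i, u, rfl, hc, h1, h3, h4⟩)
  choose hV hlt Q ι υ hlen hc hc' hrL hrU using hκ
  -- The indices chosen separately at cut `k + 1` agree with those reached from cut `k`, because a
  -- mark has only one partner.
  have hι : ∀ k, ι (k + 1) = ι k + (seqL (Q k)).length := fun k =>
    match_unique (outData_wf T.ok.next) T.hL (hc (k + 1)).hi (hc' k).hi
  have hυ : ∀ k, υ (k + 1) = υ k + (seqU (Q k)).length := fun k =>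
    match_unique (inData_wf T.ok.next) T.hU (hc (k + 1)).hu (hc' k).hu
  have rL : Refines tL Q seqL ι := fun k => ⟨hι k, hrL k⟩
  have rU : Refines tU Q seqU (fun k => υ k + 1) := fun k => ⟨by
    change υ (k + 1) + 1 = υ k + 1 + _
    rw [hυ]; ring, hrU k⟩
  refine ⟨fun k => pL (ι k), Q, ι, fun k => υ k + 1, fun k => ?_, ?_, ?_, rL, rU⟩
  · have h1 := Layout.of_reads (M := inData b (a + b) (1 - s)) T.hL (hrL k)
    rw [← hι] at h1
    simp only [h1]
    congr 1
    cases Q k <;> simp [seqL, lnSum, inData, blkLen] <;> ring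
  · ext i
    rw [mem_zone_refines (M := inData b (a + b) (1 - s)) T.hL rL seqL_length_pos]
    exact exists_congr fun k => inMark_seqL T.ok _ _
  · ext i
    rw [mem_zone_refines (M := outData b (a + b) (1 - s)) T.hU rU seqU_length_pos]
    refine exists_congr fun k => ?_
    rw [inMark_seqU T.ok, Cut.start T (hc k), sub_sub]

end Triple

/-! ### Lower and upper position exclude each other; splitting a strip. -/

/-- A sequence cannot be both in lower and in upper position. -/
theorem not_refines_both {t Q Q' : ℤ → Blk} {K K' : ℤ → ℤ} (hL : Refines t Q seqL K)
    (hU : Refines t Q' seqU K') : False := by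
  -- In images under `seqL` the block `D` occurs only inside C D A.
  have key : ∀ j, t j = .D → t (j + 1) = .A ∧ t (j - 1) = .C := by
    have hK : StrictMono K := strictMono_int_of_lt_succ fun k => by
      have := (hL k).1; have := seqL_length_pos (Q k); omega
    intro j hj
    obtain ⟨k, h1, h2⟩ := exists_mem_interval hK j
    obtain ⟨h3, h4⟩ := hL k
    obtain ⟨n, rfl⟩ : ∃ n : ℕ, j = K k + n := ⟨(j - K k).toNat, by omega⟩
    have hn : n < (seqL (Q k)).length := by omega
    cases hQ : Q k <;> rw [hQ] at h4 hn <;> simp [seqL, Reads] at h4 hn <;> interval_cases n <;>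
      ring_nf at h4 hj ⊢ <;> simp_all
  have h1 : ∀ k, t (K' (k + 1) - 1) = .D := by
    intro k
    obtain ⟨h3, h4⟩ := hU k
    rw [h3]
    cases hQ : Q' k <;> rw [hQ] at h4 <;> simp [seqU, Reads] at h4 ⊢ <;> ring_nf at * <;> simp_all
  -- Each word `seqU` ends in `D`, so the next one starts with `A`, and only `seqU .A` does. But
  -- then `D` is preceded by `A` instead of `C`.
  have h2 : ∀ k, Q' k = .A := by
    intro k
    have h3 := (key _ (h1 (k - 1))).1
    have h4 := (hU k).2
    simp only [sub_add_cancel] at h3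
    cases hQ : Q' k <;> rw [hQ] at h4 <;> simp [seqU, Reads, h3] at h4 ⊢
  obtain ⟨h3, h4⟩ := hU 0
  have h5 := (key _ (h1 0)).2
  rw [h3, h2] at h5
  rw [h2] at h4
  simp [seqU, Reads] at h4 h5
  ring_nf at h4 h5
  simp_all

/-- Every strip of a level three higher arises from three strips. -/
theorem exists_triple {a b s : ℤ} (h : LevelOk a b s) {P : ℤ → ℤ} {Q : ℤ → Blk}
    (hP : ∀ k, P (k + 1) = P k + blkLen (a + 2 * b) (2 * a + 3 * b) (Q k)) :
    ∃ pL tL pN tN pU tU, Triple a b s pL tL pN tN pU tU ∧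
      (inData (a + 2 * b) (2 * a + 3 * b) (1 - s)).zone P Q =
        (inData b (a + b) (1 - s)).zone pL tL ∧
      (outData (a + 2 * b) (2 * a + 3 * b) (1 - s)).zone P Q =
        (outData b (a + b) (1 - s)).zone pU tU := by
  obtain ⟨pL, tL, KL, hL, rL, cL⟩ := exists_refines (seq := seqL) (inData b (a + b) (1 - s))
    (inData (a + 2 * b) (2 * a + 3 * b) (1 - s)) 0 seqL_length_pos
    (fun x => by cases x <;> simp [seqL, lnSum, inData, blkLen] <;> ring) hP
  obtain ⟨pN, tN, KN, hN, rN, cN⟩ := exists_refines (seq := seqN) (inData a b s)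
    (inData (a + 2 * b) (2 * a + 3 * b) (1 - s)) (a + b + 1 - 2 * s) seqN_length_pos
    (fun x => by cases x <;> simp [seqN, lnSum, inData, blkLen] <;> ring) hP
  obtain ⟨pU, tU, KU, hU, rU, cU⟩ := exists_refines (seq := seqU) (inData b (a + b) (1 - s))
    (inData (a + 2 * b) (2 * a + 3 * b) (1 - s)) (a + 2 * b) seqU_length_pos
    (fun x => by cases x <;> simp [seqU, lnSum, inData, blkLen] <;> ring) hP
  refine ⟨pL, tL, pN, tN, pU, tU, ⟨h, hL, hN, hU, ?_, ?_⟩, ?_, ?_⟩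
  · ext i
    rw [mem_zone_refines (M := inData a b s) hN rN seqN_length_pos,
      mem_zone_refines (M := outData b (a + b) (1 - s)) hL rL seqL_length_pos]
    refine exists_congr fun k => ?_
    rw [inSeq_seqL_seqN h, cL, cN, add_zero, sub_sub]
  · ext i
    rw [mem_zone_refines (M := outData a b s) hN rN seqN_length_pos,
      mem_zone_refines (M := inData b (a + b) (1 - s)) hU rU seqU_length_pos]
    refine exists_congr fun k => ?_
    rw [cN, cU, ← sub_sub, ← sub_sub, inSeq_seqN_seqU h]
  · ext i
    rw [mem_zone_refines (M := inData b (a + b) (1 - s)) hL rL seqL_length_pos]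
    refine exists_congr fun k => ?_
    rw [inMark_seqL h, cL, add_zero]
  · ext i
    rw [mem_zone_refines (M := outData b (a + b) (1 - s)) hU rU seqU_length_pos]
    refine exists_congr fun k => ?_
    rw [inMark_seqU h, cU, sub_sub]

open MarkData

/-! ### Strips as relations between sets of positions. -/

/-- The set `X` or its complement, according to the parity `s`. -/
def orient (s : ℤ) (X : Set ℤ) : Set ℤ := if s = 0 then Xᶜ else X

theorem mem_orient {s : ℤ} {X : Set ℤ} {i : ℤ} : i ∈ orient s X ↔ (s = 0 ∧ i ∉ X ∨ s ≠ 0 ∧ i ∈ X) := by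
  unfold orient; split <;> simp_all

/-- `X` and `Y` are the positions of colour one below and above a strip with parameters
`a`, `b`, `s`. -/
def StripRel (a b s : ℤ) (X Y : Set ℤ) : Prop :=
  ∃ p t, (∀ k, p (k + 1) = p k + blkLen a b (t k)) ∧
    orient s X = (inData a b s).zone p t ∧ orient (1 - s) Y = (outData a b s).zone p t

theorem StripRel.combine {a b s : ℤ} (h : LevelOk a b s) {X Y Z W : Set ℤ}
    (h1 : StripRel b (a + b) (1 - s) X Y) (h2 : StripRel a b s Y Z)
    (h3 : StripRel b (a + b) (1 - s) Z W) :
    StripRel (a + 2 * b) (2 * a + 3 * b) (1 - s) X W := by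
  obtain ⟨pL, tL, hL, iL, oL⟩ := h1
  obtain ⟨pN, tN, hN, iN, oN⟩ := h2
  obtain ⟨pU, tU, hU, iU, oU⟩ := h3
  rw [sub_sub_cancel] at oL
  obtain ⟨P, Q, -, -, hP, hi, ho, -⟩ := Triple.combine
    ⟨h, hL, hN, hU, iN.symm.trans oL, oN.symm.trans iU⟩
  exact ⟨P, Q, hP, iL.trans hi.symm, oU.trans ho.symm⟩

theorem StripRel.split {a b s : ℤ} (h : LevelOk a b s) {X W : Set ℤ}
    (hXW : StripRel (a + 2 * b) (2 * a + 3 * b) (1 - s) X W) :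
    ∃ Y Z, StripRel b (a + b) (1 - s) X Y ∧ StripRel a b s Y Z ∧
      StripRel b (a + b) (1 - s) Z W := by
  obtain ⟨P, Q, hP, hi, ho⟩ := hXW
  obtain ⟨pL, tL, pN, tN, pU, tU, hT, h1, h2⟩ := exists_triple h hP
  have key : ∀ s (Z : Set ℤ), orient s (orient s Z) = Z := by
    intro s Z; unfold orient; split <;> simp
  refine ⟨orient s ((inData a b s).zone pN tN), orient (1 - s) ((outData a b s).zone pN tN),
    ⟨pL, tL, hT.hL, hi.trans h1, ?_⟩, ⟨pN, tN, hT.hN, key _ _, key _ _⟩,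
    ⟨pU, tU, hT.hU, ?_, ho.trans h2⟩⟩
  · rw [sub_sub_cancel, key, hT.hLN]
  · rw [key, hT.hNU]

/-- The third of the five strips would be the upper strip of one triple and the lower strip of the
next, contrary to `not_refines_both`. -/
theorem StripRel.not_alternate {a b s : ℤ} (h : LevelOk a b s) {X₀ X₁ X₂ X₃ X₄ X₅ : Set ℤ}
    (h1 : StripRel b (a + b) (1 - s) X₀ X₁) (h2 : StripRel a b s X₁ X₂)
    (h3 : StripRel b (a + b) (1 - s) X₂ X₃) (h4 : StripRel a b s X₃ X₄)
    (h5 : StripRel b (a + b) (1 - s) X₄ X₅) : False := by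
  obtain ⟨pL, tL, hL, iL, oL⟩ := h1
  obtain ⟨pN, tN, hN, iN, oN⟩ := h2
  obtain ⟨pM, tM, hM, iM, oM⟩ := h3
  obtain ⟨pN', tN', hN', iN', oN'⟩ := h4
  obtain ⟨pU, tU, hU, iU, oU⟩ := h5
  rw [sub_sub_cancel] at oL oM
  obtain ⟨-, Q, -, K, -, -, -, -, r⟩ := Triple.combine
    ⟨h, hL, hN, hM, iN.symm.trans oL, oN.symm.trans iM⟩
  obtain ⟨-, Q', K', -, -, -, -, r', -⟩ := Triple.combine
    ⟨h, hM, hN', hU, iN'.symm.trans oM, oN'.symm.trans iU⟩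
  exact not_refines_both r' r

theorem not_mem_zone_of_le {M : MarkData} (hM : M.Wf) {p : ℤ → ℤ} {t : ℤ → Blk}
    (h : M.Layout p t) {k i : ℤ} (h1 : p k ≤ i) (h2 : i < p (k + 1))
    (hi : ¬ M.InMark (t k) (i - p k)) : i ∉ M.zone p t := by
  rintro ⟨l, hl⟩
  have h3 := hM (t l)
  have h4 := h l
  have h5 := hl
  unfold InMark at h5
  have : l = k := interval_unique (h.strictMono hM) (m := i) (by omega) (by omega) h1 h2
  exact hi (this ▸ hl)

theorem not_mem_zone_inData {a b s : ℤ} (h : LevelOk a b s) {p : ℤ → ℤ} {t : ℤ → Blk}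
    (hp : ∀ k, p (k + 1) = p k + blkLen a b (t k)) {k i : ℤ} (h1 : p k ≤ i)
    (h2 : i < p k + (a + b - 3 + s)) : i ∉ (inData a b s).zone p t := by
  have hk := hp k
  obtain ⟨g1, g2, g3, g4, g5⟩ := id h
  refine not_mem_zone_of_le (inData_wf h) hp h1 ?_ ?_
  · cases h3 : t k <;> rw [h3] at hk <;> simp [blkLen] at hk <;> omega
  · cases h3 : t k <;> simp [inData, InMark] <;> omega

theorem not_mem_zone_outData {a b s : ℤ} (h : LevelOk a b s) {p : ℤ → ℤ} {t : ℤ → Blk}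
    (hp : ∀ k, p (k + 1) = p k + blkLen a b (t k)) {k i : ℤ} (h1 : p k ≤ i)
    (h2 : i < p k + (b - 3 + s)) : i ∉ (outData a b s).zone p t := by
  have hk := hp k
  obtain ⟨g1, g2, g3, g4, g5⟩ := id h
  refine not_mem_zone_of_le (outData_wf h) hp h1 ?_ ?_
  · cases h3 : t k <;> rw [h3] at hk <;> simp [blkLen] at hk <;> omega
  · cases h3 : t k <;> simp [outData, InMark] <;> omega

/-- Upper marks are at most three wide, and at least two free places separate them, since every
block starts with two free ones. So `i` and `i + 2` share a mark, and so do `i + 2` and `i + 3`. -/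
theorem not_four_mem_zone_outData {a b s : ℤ} (h : LevelOk a b s) {p : ℤ → ℤ} {t : ℤ → Blk}
    (hp : ∀ k, p (k + 1) = p k + blkLen a b (t k)) {i : ℤ} (h0 : i ∈ (outData a b s).zone p t)
    (h1 : i + 2 ∈ (outData a b s).zone p t) :
    i + 3 ∉ (outData a b s).zone p t := by
  obtain ⟨k, hk⟩ := h0
  have hk1 := hp k
  have hk2 := hp (k + 1)
  obtain ⟨g1, g2, g3, g4, g5⟩ := id h
  rcases lt_or_ge (i + 3) (p (k + 1)) with hi | hi
  · refine not_mem_zone_of_le (outData_wf h) (k := k) hp ?_ hi ?_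
    · cases h3 : t k <;> rw [h3] at hk hk1 <;> simp [blkLen, outData, InMark] at * <;> omega
    · cases h3 : t k <;> rw [h3] at hk hk1 <;> simp [blkLen, outData, InMark] at * <;> omega
  · rcases lt_or_ge (i + 2) (p (k + 1)) with hi' | hi'
    · refine not_mem_zone_of_le (outData_wf h) (k := k + 1) hp hi ?_ ?_
      · cases h3 : t (k + 1) <;> rw [h3] at hk2 <;> simp [blkLen] at * <;> omega
      · cases h3 : t (k + 1) <;> simp [outData, InMark] <;> omega
    · refine absurd h1 (not_mem_zone_of_le (outData_wf h) (k := k + 1) hp hi' ?_ ?_)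
      · cases h3 : t (k + 1) <;> rw [h3] at hk2 <;> cases h4 : t k <;> rw [h4] at hk hk1 <;>
          simp [blkLen, outData, InMark] at * <;> omega
      · cases h3 : t (k + 1) <;> cases h4 : t k <;> rw [h4] at hk hk1 <;>
          simp [blkLen, outData, InMark] at * <;> omega

theorem mem_orient_one_sub {s : ℤ} (hs : s = 0 ∨ s = 1) {X : Set ℤ} {i : ℤ} :
    i ∈ orient (1 - s) X ↔ i ∉ orient s X := by
  rw [mem_orient, mem_orient]
  rcases hs with rfl | rfl <;> simp

/-- Strips of the same parity are not adjacent. -/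
theorem StripRel.not_adjacent {a b a' b' s : ℤ} (h : LevelOk a b s) (h' : LevelOk a' b' s)
    (hab : 7 ≤ a' + b' + s) {X Y Z : Set ℤ} (h1 : StripRel a b s X Y)
    (h2 : StripRel a' b' s Y Z) : False := by
  obtain ⟨p, t, hp, -, o⟩ := h1
  obtain ⟨p', t', hp', i, -⟩ := h2
  -- With equal parities, free places above the common line are marked places below it. A block of
  -- the upper strip starts with at least `a' + b' - 3 + s ≥ 4` free places, more than a mark of the
  -- lower strip can cover.
  have key : ∀ j, p' 0 ≤ j → j < p' 0 + 4 → j ∈ (outData a b s).zone p t := by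
    intro j h3 h4
    rw [← o, mem_orient_one_sub h.hs, i]
    exact not_mem_zone_inData h' hp' h3 (by omega)
  exact not_four_mem_zone_outData h hp (key (p' 0) (by omega) (by omega))
    (key (p' 0 + 2) (by omega) (by omega)) (key (p' 0 + 3) (by omega) (by omega))

/-- The sides of a strip do not have a common small period. -/
theorem StripRel.lt_period {a b s : ℤ} (h : LevelOk a b s) {X Y : Set ℤ} (hXY : StripRel a b s X Y)
    {u : ℤ} (hu : 0 < u) (hX : ∀ i, i ∈ X ↔ i + u ∈ X) (hY : ∀ i, i ∈ Y ↔ i + u ∈ Y) :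
    b - 3 < u := by
  by_contra! hlt
  obtain ⟨p, t, hp, hi, ho⟩ := hXY
  obtain ⟨g1, g2, g3, g4, g5⟩ := id h
  -- A periodic zone with a free window as long as its period is empty: translate any element into
  -- the window.
  have key : ∀ (X Z : Set ℤ) (s x : ℤ), orient s X = Z → (∀ i, i ∈ X ↔ i + u ∈ X) →
      (∀ i, x ≤ i → i < x + u → i ∉ Z) → ∀ i, i ∉ Z := by
    rintro X _ s x rfl hX hx i hi
    have hper : ∀ i, i ∈ orient s X ↔ i + u ∈ orient s X := fun i => by
      rw [mem_orient, mem_orient, hX i]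
    have hmul : ∀ (n : ℕ) i, i ∈ orient s X ↔ i + n * u ∈ orient s X := by
      intro n
      induction n with
      | zero => simp
      | succ n ih => intro i; rw [ih, hper]; push_cast; ring_nf
    have hmul' : ∀ (n : ℤ) i, i ∈ orient s X ↔ i + n * u ∈ orient s X := by
      intro n i
      obtain ⟨m, rfl | rfl⟩ := n.eq_nat_or_neg
      · exact hmul m i
      · rw [hmul m (i + -(m : ℤ) * u)]; ring_nf
    refine hx (x + (i - x) % u) ?_ ?_ ?_
    · have := Int.emod_nonneg (i - x) hu.ne'; omega
    · have := Int.emod_lt_of_pos (i - x) hu; omega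
    · rw [hmul' ((i - x) / u)]
      have := Int.emod_add_mul_ediv (i - x) u
      rwa [show x + (i - x) % u + (i - x) / u * u = i by linarith]
  have h1 := key _ _ _ (p 0) hi hX fun i h1 h2 => not_mem_zone_inData h hp h1 (by omega)
  have h2 := key _ _ _ (p 0) ho hY fun i h1 h2 => not_mem_zone_outData h hp h1 (by omega)
  -- Both zones would be empty, but every block has a mark on at least one side.
  by_cases h0 : (inData a b s).wd (t 0) = 0
  · refine h2 (p 0 + (outData a b s).hd (t 0)) ⟨0, ?_⟩
    cases h3 : t 0 <;> simp [h3, inData, outData, InMark] at *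
  · refine h1 (p 0 + (inData a b s).hd (t 0)) ⟨0, ?_⟩
    have := inData_wf h (t 0)
    simp only [InMark]; omega

/-! ### Parameters and heights of all levels. -/

/-- The parameters `a`, `b`, `s` of the strips of each level. -/
def levelPar : ℕ → ℤ × ℤ × ℤ
  | 0 => (2, 3, 1)
  | m + 1 => ((levelPar m).2.1, (levelPar m).1 + (levelPar m).2.1, 1 - (levelPar m).2.2)

/-- The heights of the strips of each level. -/
def levelHeight : ℕ → ℤ
  | 0 => 4
  | 1 => 10
  | 2 => 13
  | m + 3 => 2 * levelHeight (m + 1) + levelHeight m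

theorem levelPar_ok (m : ℕ) : LevelOk (levelPar m).1 (levelPar m).2.1 (levelPar m).2.2 := by
  induction m with
  | zero => constructor <;> simp [levelPar]
  | succ m ih => exact ih.next

theorem le_levelPar (m : ℕ) : m + 3 ≤ (levelPar m).2.1 := by
  induction m with
  | zero => simp [levelPar]
  | succ m ih => have := (levelPar_ok m).ha; simp [levelPar]; omega

theorem levelHeight_strictMono : StrictMono levelHeight := by
  have h : ∀ m, levelHeight m < levelHeight (m + 1) ∧ levelHeight (m + 1) < levelHeight (m + 2) ∧
      levelHeight (m + 2) < levelHeight (m + 3) := by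
    intro m
    induction m with
    | zero => simp [levelHeight]
    | succ m ih =>
      obtain ⟨h1, h2, h3⟩ := ih
      have h5 : levelHeight (m + 3) = 2 * levelHeight (m + 1) + levelHeight m := rfl
      have h6 : levelHeight (m + 4) = 2 * levelHeight (m + 2) + levelHeight (m + 1) := rfl
      exact ⟨h2, h3, by change levelHeight (m + 3) < levelHeight (m + 4); omega⟩
  exact strictMono_nat_of_lt_succ fun m => (h m).1

theorem levelHeight_lt (m : ℕ) : 0 < levelHeight m ∧ m ≤ levelHeight m ∧
    levelHeight m < levelHeight (m + 1) ∧ levelHeight (m + 1) < levelHeight (m + 2) := by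
  have h3 : m + 4 ≤ levelHeight m := by
    induction m with
    | zero => simp [levelHeight]
    | succ m ih => have := levelHeight_strictMono (show m < m + 1 by omega); push_cast; omega
  exact ⟨by omega, by omega, levelHeight_strictMono (by omega), levelHeight_strictMono (by omega)⟩

/-- The relation between the lower and upper sides of a strip of level `m`. -/
def LevelRel (m : ℕ) : Set ℤ → Set ℤ → Prop :=
  StripRel (levelPar m).1 (levelPar m).2.1 (levelPar m).2.2

theorem levelRel_add_three (m : ℕ) : LevelRel (m + 3) =
    StripRel ((levelPar m).1 + 2 * (levelPar m).2.1) (2 * (levelPar m).1 + 3 * (levelPar m).2.1)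
      (1 - (levelPar m).2.2) := by
  unfold LevelRel
  simp only [levelPar]
  congr 1 <;> ring

namespace LevelRel
variable {m : ℕ}

theorem combine {X Y Z W : Set ℤ} (h1 : LevelRel (m + 1) X Y) (h2 : LevelRel m Y Z)
    (h3 : LevelRel (m + 1) Z W) : LevelRel (m + 3) X W := by
  rw [levelRel_add_three]
  exact StripRel.combine (levelPar_ok m) h1 h2 h3

theorem split {X W : Set ℤ} (h : LevelRel (m + 3) X W) :
    ∃ Y Z, LevelRel (m + 1) X Y ∧ LevelRel m Y Z ∧ LevelRel (m + 1) Z W := by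
  rw [levelRel_add_three] at h
  exact StripRel.split (levelPar_ok m) h

theorem not_alternate {X₀ X₁ X₂ X₃ X₄ X₅ : Set ℤ} (h1 : LevelRel (m + 1) X₀ X₁)
    (h2 : LevelRel m X₁ X₂) (h3 : LevelRel (m + 1) X₂ X₃) (h4 : LevelRel m X₃ X₄)
    (h5 : LevelRel (m + 1) X₄ X₅) : False :=
  StripRel.not_alternate (levelPar_ok m) h1 h2 h3 h4 h5

/-- For the upper strip level 0 has to be left out: its parameters 2, 3, 1 guarantee only three free
places at the start of a block. -/
theorem not_adjacent {k l : ℕ} (hl : 1 ≤ l) (hkl : (levelPar k).2.2 = (levelPar l).2.2)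
    {X Y Z : Set ℤ} (h1 : LevelRel k X Y) (h2 : LevelRel l Y Z) : False := by
  have hk := levelPar_ok k
  rw [hkl] at hk
  unfold LevelRel at h1 h2
  rw [hkl] at h1
  refine StripRel.not_adjacent hk (levelPar_ok l) ?_ h1 h2
  obtain ⟨l, rfl⟩ : ∃ n, l = n + 1 := ⟨l - 1, by omega⟩
  obtain ⟨h1, h2, h3, h4, h5⟩ := levelPar_ok l
  simp only [levelPar]
  omega

theorem shift {X Y X' Y' : Set ℤ} {u : ℤ} (h : LevelRel m X Y) (hX : ∀ i, i + u ∈ X' ↔ i ∈ X)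
    (hY : ∀ i, i + u ∈ Y' ↔ i ∈ Y) : LevelRel m X' Y' := by
  obtain ⟨p, t, hp, hi, ho⟩ := h
  have key : ∀ (M : MarkData) (s : ℤ) (X X' : Set ℤ), (∀ i, i + u ∈ X' ↔ i ∈ X) →
      orient s X = M.zone p t → orient s X' = M.zone (fun k => p k + u) t := by
    intro M s X X' hX h
    ext i
    obtain ⟨i, rfl⟩ : ∃ j, i = j + u := ⟨i - u, by ring⟩
    rw [mem_orient, hX, ← mem_orient, h]
    exact exists_congr fun k => by rw [add_sub_add_right_eq_sub]
  exact ⟨fun k => p k + u, t, fun k => by simp only [hp]; ring, key _ _ _ _ hX hi,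
    key _ _ _ _ hY ho⟩

end LevelRel

/-! ### The hierarchy of decompositions, and the absence of periods. -/

/-- The heights `y` and `y + levelHeight i` are consecutive in `S` and bound a strip of
level `i`. -/
structure IsStrip (row : ℤ → Set ℤ) (S : Set ℤ) (i : ℕ) (y z : ℤ) : Prop where
  left : y ∈ S
  right : z ∈ S
  eq : z = y + levelHeight i
  gap : ∀ w, y < w → w < z → w ∉ S
  rel : LevelRel i (row y) (row z)

/-- The set `S` of heights cuts the plane into strips of levels `m`, `m + 1` and `m + 2`. -/
structure Decomposes (row : ℤ → Set ℤ) (m : ℕ) (S : Set ℤ) : Prop where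
  below : ∀ n, ∃ y ∈ S, y ≤ n
  next : ∀ y ∈ S, ∃ z, IsStrip row S m y z ∨ IsStrip row S (m + 1) y z ∨ IsStrip row S (m + 2) y z
  alternate : ∀ i j y z w, (i = m ∨ i = m + 2) → (j = m ∨ j = m + 2) → IsStrip row S i y z →
    ¬ IsStrip row S j z w

namespace Decomposes
variable {row : ℤ → Set ℤ} {m : ℕ} {S : Set ℤ}

theorem prev (h : Decomposes row m S) {y : ℤ} (hy : y ∈ S) :
    ∃ x, IsStrip row S m x y ∨ IsStrip row S (m + 1) x y ∨ IsStrip row S (m + 2) x y := by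
  obtain ⟨x, ⟨hx, hlt⟩, hmax⟩ := Int.exists_greatest_of_bdd (P := fun z => z ∈ S ∧ z < y)
    ⟨y, fun z hz => hz.2.le⟩ (by
      obtain ⟨v, hv, hle⟩ := h.below (y - 1)
      exact ⟨v, hv, by omega⟩)
  obtain ⟨z, hz⟩ := h.next x hx
  have key : ∀ i, IsStrip row S i x z → y = z := by
    intro i hi
    have h1 := hi.eq
    have h2 := (levelHeight_lt i).1
    rcases lt_trichotomy y z with h3 | h3 | h3
    · exact absurd hy (hi.gap y hlt h3)
    · exact h3
    · have := hmax z ⟨hi.right, h3⟩; omega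
  have : y = z := by rcases hz with hz | hz | hz <;> exact key _ hz
  exact ⟨x, this ▸ hz⟩

theorem not_same {y z w : ℤ} (h1 : IsStrip row S (m + 1) y z) :
    ¬ IsStrip row S (m + 1) z w := fun h2 =>
  LevelRel.not_adjacent (by omega) rfl h1.rel h2.rel

theorem unique {i j : ℕ} (hij : i < j) (hj : j ≤ i + 2) {y z w : ℤ}
    (h1 : IsStrip row S i y z) : ¬ IsStrip row S j y w := by
  intro h2
  have h3 := h1.eq
  have h4 := h2.eq
  obtain ⟨h5, -, h6, h7⟩ := levelHeight_lt i
  refine h2.gap z (by omega) ?_ h1.right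
  obtain rfl | rfl : j = i + 1 ∨ j = i + 2 := by omega
  all_goals omega

theorem unique' {i j : ℕ} (hij : i < j) (hj : j ≤ i + 2) {y z w : ℤ}
    (h1 : IsStrip row S i z y) : ¬ IsStrip row S j w y := by
  intro h2
  have h3 := h1.eq
  have h4 := h2.eq
  obtain ⟨h5, -, h6, h7⟩ := levelHeight_lt i
  refine h2.gap z ?_ (by omega) h1.left
  obtain rfl | rfl : j = i + 1 ∨ j = i + 2 := by omega
  all_goals omega

/-- The heights in `S` that do not bound a strip of level `m`. -/
def coarsen (row : ℤ → Set ℤ) (m : ℕ) (S : Set ℤ) : Set ℤ :=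
  {y | y ∈ S ∧ ∀ z, ¬ IsStrip row S m y z ∧ ¬ IsStrip row S m z y}

theorem not_mem_coarsen {y z : ℤ} (h : IsStrip row S m y z) :
    y ∉ coarsen row m S ∧ z ∉ coarsen row m S :=
  ⟨fun h' => (h'.2 z).1 h, fun h' => (h'.2 y).2 h⟩

/-- In these names odd strips have level `m + 1` and even ones level `m` or `m + 2`; the two kinds
alternate. -/
theorem next_of_odd (h : Decomposes row m S) {y z : ℤ} (h1 : IsStrip row S (m + 1) y z) :
    ∃ w, IsStrip row S m z w ∨ IsStrip row S (m + 2) z w := by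
  obtain ⟨w, hw | hw | hw⟩ := h.next z h1.right
  · exact ⟨w, Or.inl hw⟩
  · exact absurd hw (not_same h1)
  · exact ⟨w, Or.inr hw⟩

theorem next_of_even (h : Decomposes row m S) {i : ℕ} (hi : i = m ∨ i = m + 2) {y z : ℤ}
    (h1 : IsStrip row S i y z) : ∃ w, IsStrip row S (m + 1) z w := by
  obtain ⟨w, hw | hw | hw⟩ := h.next z h1.right
  · exact absurd hw (h.alternate i m y z w hi (Or.inl rfl) h1)
  · exact ⟨w, hw⟩
  · exact absurd hw (h.alternate i (m + 2) y z w hi (Or.inr rfl) h1)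

theorem prev_of_odd (h : Decomposes row m S) {y z : ℤ} (h1 : IsStrip row S (m + 1) y z) :
    ∃ w, IsStrip row S m w y ∨ IsStrip row S (m + 2) w y := by
  obtain ⟨w, hw | hw | hw⟩ := h.prev h1.left
  · exact ⟨w, Or.inl hw⟩
  · exact absurd h1 (not_same hw)
  · exact ⟨w, Or.inr hw⟩

theorem prev_of_even (h : Decomposes row m S) {i : ℕ} (hi : i = m ∨ i = m + 2) {y z : ℤ}
    (h1 : IsStrip row S i y z) : ∃ w, IsStrip row S (m + 1) w y := by
  obtain ⟨w, hw | hw | hw⟩ := h.prev h1.left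
  · exact absurd h1 (h.alternate m i w y z (Or.inl rfl) hi hw)
  · exact ⟨w, hw⟩
  · exact absurd h1 (h.alternate (m + 2) i w y z (Or.inr rfl) hi hw)

theorem mem_coarsen_of_between {i j : ℕ} (hi : i = m + 1 ∨ i = m + 2)
    (hj : j = m + 1 ∨ j = m + 2) {x y z : ℤ} (h1 : IsStrip row S i x y)
    (h2 : IsStrip row S j y z) : y ∈ coarsen row m S :=
  ⟨h2.left, fun w => ⟨fun h3 => unique (by omega) (by omega) h3 h2,
    fun h3 => unique' (by omega) (by omega) h3 h1⟩⟩

theorem odd_even_odd (h : Decomposes row m S) {y₀ y₁ y₂ y₃ y₄ : ℤ}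
    (h1 : IsStrip row S (m + 1) y₀ y₁) (h2 : IsStrip row S m y₁ y₂)
    (h3 : IsStrip row S (m + 1) y₂ y₃) : ¬ IsStrip row S m y₃ y₄ := by
  intro h4
  obtain ⟨_, h5⟩ := h.next_of_even (Or.inl rfl) h4
  exact LevelRel.not_alternate h1.rel h2.rel h3.rel h4.rel h5.rel

/-- The neighbours of a strip of level `m` are odd, and by `odd_even_odd` their other neighbours
have level `m + 2`. Hence the groups `m + 1`, `m`, `m + 1` do not overlap, and each becomes one
strip of level `m + 3`. -/
theorem coarsen_decomposes (h : Decomposes row m S) :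
    Decomposes row (m + 1) (coarsen row m S) where
  below n := by
    obtain ⟨y, hy, hyn⟩ := h.below n
    by_cases hc : y ∈ coarsen row m S
    · exact ⟨y, hc, hyn⟩
    -- Going down from a strip of level `m` and past the odd strip below it, one meets a strip of
    -- level `m + 2`; the height between these two is kept.
    have key : ∀ x z, IsStrip row S m x z → x ≤ n → ∃ y ∈ coarsen row m S, y ≤ n := by
      intro x z hx hxn
      obtain ⟨w, hw⟩ := h.prev_of_even (Or.inl rfl) hx
      obtain ⟨v, hv | hv⟩ := h.prev_of_odd hw
      · obtain ⟨_, hu⟩ := h.prev_of_even (Or.inl rfl) hv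
        exact absurd hx (h.odd_even_odd hu hv hw)
      · have := hw.eq
        have := (levelHeight_lt (m + 1)).1
        exact ⟨w, mem_coarsen_of_between (Or.inr rfl) (Or.inl rfl) hv hw, by omega⟩
    simp only [coarsen, Set.mem_ofPred_eq, not_and, not_forall] at hc
    obtain ⟨z, hz⟩ := hc hy
    by_cases hyz : IsStrip row S m y z
    · exact key y z hyz hyn
    · have hzy : IsStrip row S m z y := by tauto
      have := hzy.eq
      have := (levelHeight_lt m).1
      exact key z y hzy (by omega)
  next y hy := by
    have hsub : ∀ w, w ∈ coarsen row m S → w ∈ S := fun w hw => hw.1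
    have mk : ∀ i z, IsStrip row S i y z → z ∈ coarsen row m S →
        IsStrip row (coarsen row m S) i y z := fun i z h1 h2 =>
      ⟨hy, h2, h1.eq, fun w h3 h4 h5 => h1.gap w h3 h4 h5.1, h1.rel⟩
    obtain ⟨z, hz | hz | hz⟩ := h.next y hy.1
    · exact absurd hz (hy.2 z).1
    · obtain ⟨w, hw | hw⟩ := h.next_of_odd hz
      · obtain ⟨v, hv⟩ := h.next_of_even (Or.inl rfl) hw
        obtain ⟨u, hu | hu⟩ := h.next_of_odd hv
        · exact absurd hu (h.odd_even_odd hz hw hv)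
        refine ⟨v, Or.inr (Or.inr ⟨hy, mem_coarsen_of_between (Or.inl rfl) (Or.inr rfl) hv hu,
          ?_, ?_, LevelRel.combine hz.rel hw.rel hv.rel⟩)⟩
        · have := hz.eq
          have := hw.eq
          have := hv.eq
          have : levelHeight (m + 1 + 2) = 2 * levelHeight (m + 1) + levelHeight m := rfl
          omega
        · intro x h1 h2 hx
          have h3 := not_mem_coarsen hw
          rcases lt_trichotomy x z with h4 | rfl | h4
          · exact hz.gap x h1 h4 hx.1
          · exact h3.1 hx
          rcases lt_trichotomy x w with h5 | rfl | h5
          · exact hw.gap x h4 h5 hx.1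
          · exact h3.2 hx
          · exact hv.gap x h5 h2 hx.1
      · exact ⟨z, Or.inl (mk _ _ hz (mem_coarsen_of_between (Or.inl rfl) (Or.inr rfl) hz hw))⟩
    · obtain ⟨w, hw⟩ := h.next_of_even (Or.inr rfl) hz
      exact ⟨z, Or.inr (Or.inl
        (mk _ _ hz (mem_coarsen_of_between (Or.inr rfl) (Or.inl rfl) hz hw)))⟩
  alternate i j y z w hi hj h1 h2 := by
    refine LevelRel.not_adjacent (k := i) (l := j) (by omega) ?_ h1.rel h2.rel
    -- Levels `m + 1` and `m + 3` have the same parity, so such strips never touch.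
    have : (levelPar (m + 1 + 2)).2.2 = (levelPar (m + 1)).2.2 := by simp [levelPar]
    rcases hi with rfl | rfl <;> rcases hj with rfl | rfl <;> simp only [this]

theorem isStrip_of_shift {row' : ℤ → Set ℤ} {S' : Set ℤ} {u v : ℤ}
    (hr : ∀ y i, i + u ∈ row' (y + v) ↔ i ∈ row y) (hS : ∀ y, y + v ∈ S' ↔ y ∈ S) {i : ℕ}
    {y z : ℤ} (h : IsStrip row S i y z) : IsStrip row' S' i (y + v) (z + v) := by
  obtain ⟨h1, h2, h3, h4, h5⟩ := h
  exact ⟨(hS y).2 h1, (hS z).2 h2, by omega, fun w h6 h7 h8 =>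
    h4 (w - v) (by omega) (by omega) ((hS (w - v)).1 (by rwa [sub_add_cancel])),
    h5.shift (hr y) (hr z)⟩

theorem isStrip_add {u v : ℤ} (hr : ∀ y i, i + u ∈ row (y + v) ↔ i ∈ row y)
    (hS : ∀ y, y + v ∈ S ↔ y ∈ S) (i : ℕ) (y z : ℤ) :
    IsStrip row S i (y + v) (z + v) ↔ IsStrip row S i y z := by
  refine ⟨fun h => ?_, isStrip_of_shift hr hS⟩
  have := isStrip_of_shift (row' := row) (S' := S) (u := -u) (v := -v)
    (fun y i => by rw [← hr]; simp) (fun y => by rw [← hS]; simp) h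
  simpa using this

theorem coarsen_add {u v : ℤ} (hr : ∀ y i, i + u ∈ row (y + v) ↔ i ∈ row y)
    (hS : ∀ y, y + v ∈ S ↔ y ∈ S) (y : ℤ) : y + v ∈ coarsen row m S ↔ y ∈ coarsen row m S := by
  unfold coarsen
  simp only [Set.mem_ofPred_eq, hS]
  refine and_congr_right fun _ => ?_
  rw [← (Equiv.addRight v).forall_congr_right]
  simp only [Equiv.coe_addRight, isStrip_add hr hS]

/-- `coarsen` is defined from `row` and `S` alone, so common symmetries of these pass to every
level. -/
theorem exists_level (h : Decomposes row 0 S) (m : ℕ) : ∃ S', Decomposes row m S' ∧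
    ∀ u v, (∀ y i, i + u ∈ row (y + v) ↔ i ∈ row y) → (∀ y, y + v ∈ S ↔ y ∈ S) →
      ∀ y, y + v ∈ S' ↔ y ∈ S' := by
  induction m with
  | zero => exact ⟨S, h, fun u v _ h => h⟩
  | succ m ih =>
    obtain ⟨S', h1, h2⟩ := ih
    exact ⟨_, h1.coarsen_decomposes, fun u v h3 h4 => coarsen_add h3 (h2 u v h3 h4)⟩

theorem exists_isStrip (h : Decomposes row m S) : ∃ i y z, m ≤ i ∧ IsStrip row S i y z := by
  obtain ⟨y, hy, -⟩ := h.below 0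
  obtain ⟨z, hz | hz | hz⟩ := h.next y hy
  exacts [⟨_, _, _, le_rfl, hz⟩, ⟨_, _, _, by omega, hz⟩, ⟨_, _, _, by omega, hz⟩]

theorem not_period_of_pos (h : Decomposes row 0 S) {u v : ℤ} (hv : 0 < v)
    (hr : ∀ y i, i + u ∈ row (y + v) ↔ i ∈ row y) (hS : ∀ y, y + v ∈ S ↔ y ∈ S) : False := by
  -- At this level all strips are higher than `v`, so translating the bottom of one by `v` lands
  -- strictly inside it.
  obtain ⟨S', h1, h2⟩ := h.exists_level (v.toNat + 1)
  obtain ⟨i, y, z, hi, hyz⟩ := h1.exists_isStrip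
  have h3 := (levelHeight_lt i).2.1
  have h4 := hyz.eq
  exact hyz.gap (y + v) (by omega) (by omega) ((h2 u v hr hS y).2 hyz.left)

theorem not_period_of_eq_zero (h : Decomposes row 0 S) {u : ℤ} (hu : 0 < u)
    (hr : ∀ y i, i + u ∈ row y ↔ i ∈ row y) : False := by
  -- At this level `b - 3` is at least `u`.
  obtain ⟨S', h1, -⟩ := h.exists_level u.toNat
  obtain ⟨i, y, z, hi, hyz⟩ := h1.exists_isStrip
  have h3 := le_levelPar i
  have h4 := StripRel.lt_period (levelPar_ok i) hyz.rel hu (fun i => (hr y i).symm)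
    (fun i => (hr z i).symm)
  omega

theorem not_period (h : Decomposes row 0 S) {u v : ℤ} (huv : (u, v) ≠ (0, 0))
    (hr : ∀ y i, i + u ∈ row (y + v) ↔ i ∈ row y) (hS : ∀ y, y + v ∈ S ↔ y ∈ S) : False := by
  have hr' : ∀ y i, i + -u ∈ row (y + -v) ↔ i ∈ row y := fun y i => by rw [← hr]; simp
  rcases lt_trichotomy v 0 with hv | rfl | hv
  · exact h.not_period_of_pos (by omega) hr' fun y => by rw [← hS]; simp
  · simp only [add_zero, neg_zero] at hr hr'
    rcases lt_trichotomy u 0 with hu | rfl | hu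
    · exact h.not_period_of_eq_zero (by omega) hr'
    · exact huv rfl
    · exact h.not_period_of_eq_zero hu hr
  · exact h.not_period_of_pos hv hr hS

end Decomposes

/-! ### Finite transducers and their bi-infinite paths. -/

/-- A transducer, as a list of edges: source, target, lower and upper letter. -/
abbrev Aut := List (ℕ × ℕ × ℕ × ℕ)

namespace Aut

/-- `s` is a bi-infinite path that reads `X` below and `Y` above. -/
def IsPath (E : Aut) (s X Y : ℤ → ℕ) : Prop :=
  ∀ i, (s i, s (i + 1), X i, Y i) ∈ E

/-- Product of two transducers over a common middle letter; `f` selects the letters that are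
kept. -/
def comp (K : ℕ) (f : ℕ → ℕ → ℕ → ℕ × ℕ) (E F : Aut) : Aut :=
  E.flatMap fun e => (F.filter fun g => g.2.2.1 == e.2.2.2).map fun g =>
    (e.1 * K + g.1, e.2.1 * K + g.2.1, f e.2.2.1 e.2.2.2 g.2.2.2)

/-- The number with the given binary digits set. -/
def bits (l : List ℕ) : ℕ := l.foldr (fun i m => m ||| (1 <<< i)) 0

/-- Removes the edges from sources and the edges into sinks. -/
def pruneOnce (E : Aut) : Aut :=
  E.filter fun e => (bits (E.map fun e => e.1)).testBit e.2.1 &&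
    (bits (E.map fun e => e.2.1)).testBit e.1

/-- Repeated pruning. -/
def prune : ℕ → Aut → Aut
  | 0, E => E
  | n + 1, E => prune n (pruneOnce E)

/-- Relabels the states by the entries of a table of hexadecimal digits. -/
def relabel (M T n : ℕ) : ℕ := (T >>> (4 * (n % M))) % 16

/-- `φ` maps the edges of `E` to edges of `F`. -/
def homCheck (φ : ℕ → ℕ) (E F : Aut) : Bool :=
  E.all fun e => F.contains (φ e.1, φ e.2.1, e.2.2)

/-- All walks from `w` first hit `V` within `n` steps, and then the word read satisfies `P`. -/
def returnCheck (E : Aut) (V : ℕ → Bool) (P : List (ℕ × ℕ) → Bool) : ℕ → ℕ → List (ℕ × ℕ) → Bool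
  | 0, _, _ => false
  | n + 1, w, acc => E.all fun e => !(e.1 == w) ||
      bif V e.2.1 then P (acc ++ [e.2.2]) else returnCheck E V P n e.2.1 (acc ++ [e.2.2])

theorem testBit_bits {l : List ℕ} {i : ℕ} : (bits l).testBit i = true ↔ i ∈ l := by
  induction l with
  | nil => simp [bits]
  | cons a l ih =>
    change (bits l ||| (1 <<< a)).testBit i = true ↔ _
    rw [Nat.testBit_or, Bool.or_eq_true, ih, Nat.one_shiftLeft, Nat.testBit_two_pow, List.mem_cons]
    simp only [decide_eq_true_eq]
    tauto

variable {E F G : Aut} {s t X Y Z : ℤ → ℕ}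

theorem IsPath.comp (h : E.IsPath s X Y) (h' : F.IsPath t Y Z) (K : ℕ) :
    (E.comp K (fun x _ z => (x, z)) F).IsPath (fun i => s i * K + t i) X Z := fun i => by
  simp only [Aut.comp, List.mem_flatMap, List.mem_map, List.mem_filter, beq_iff_eq]
  exact ⟨_, h i, _, ⟨h' i, rfl⟩, rfl⟩

theorem IsPath.comp_left (h : E.IsPath s X Y) (h' : F.IsPath t Y Z) (K : ℕ) :
    (E.comp K (fun x y _ => (x, y)) F).IsPath (fun i => s i * K + t i) X Y := fun i => by
  simp only [Aut.comp, List.mem_flatMap, List.mem_map, List.mem_filter, beq_iff_eq]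
  exact ⟨_, h i, _, ⟨h' i, rfl⟩, rfl⟩

theorem IsPath.comp_right (h : E.IsPath s X Y) (h' : F.IsPath t Y Z) (K : ℕ) :
    (E.comp K (fun _ y z => (y, z)) F).IsPath (fun i => s i * K + t i) Y Z := fun i => by
  simp only [Aut.comp, List.mem_flatMap, List.mem_map, List.mem_filter, beq_iff_eq]
  exact ⟨_, h i, _, ⟨h' i, rfl⟩, rfl⟩

/-- A bi-infinite path enters and leaves every state it visits, so no edge it uses is removed. The
number of rounds does not matter for this. -/
theorem IsPath.prune (h : E.IsPath s X Y) (n : ℕ) : (E.prune n).IsPath s X Y := by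
  induction n generalizing E with
  | zero => exact h
  | succ n ih =>
    refine ih fun i => ?_
    simp only [pruneOnce, List.mem_filter, Bool.and_eq_true, testBit_bits, List.mem_map]
    refine ⟨h i, ⟨_, h (i + 1), rfl⟩, _, h (i - 1), ?_⟩
    simp

theorem IsPath.filter (h : E.IsPath s X Y) (P : ℕ → Bool) (hP : ∀ i, P (Y i)) :
    IsPath (E.filter fun e => P e.2.2.2) s X Y := fun i =>
  List.mem_filter.2 ⟨h i, hP i⟩

/-- A homomorphism is enough: the target may have more paths, so no minimisation or equivalence of
transducers has to be proved. -/
theorem IsPath.map (h : E.IsPath s X Y) {φ : ℕ → ℕ} (hφ : homCheck φ E F = true) :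
    F.IsPath (fun i => φ (s i)) X Y := fun i => by
  have := List.all_eq_true.1 hφ _ (h i)
  exact List.contains_iff_mem.1 this

theorem not_isPath_nil : ¬ IsPath [] s X Y := fun h => by simpa using h 0

theorem IsPath.exists_return (h : E.IsPath s X Y) {V : ℕ → Bool} {P : List (ℕ × ℕ) → Bool}
    {n : ℕ} {i : ℤ} {acc : List (ℕ × ℕ)} (hc : returnCheck E V P n (s i) acc = true) :
    ∃ m : ℕ, 0 < m ∧ m ≤ n ∧ V (s (i + m)) = true ∧ (∀ j, i < j → j < i + m → ¬ V (s j) = true) ∧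
      P (acc ++ (List.range m).map fun j : ℕ => (X (i + j), Y (i + j))) = true := by
  induction n generalizing i acc with
  | zero => simp [returnCheck] at hc
  | succ n ih =>
    have h1 := List.all_eq_true.1 hc _ (h i)
    simp only [beq_self_eq_true, Bool.not_true, Bool.false_or] at h1
    cases hV : V (s (i + 1)) with
    | true =>
      rw [hV] at h1
      exact ⟨1, by omega, by omega, by simpa using hV, fun j h2 h3 => by
        push_cast at h3; omega, by simpa using h1⟩
    | false =>
      rw [hV] at h1
      obtain ⟨m, h2, h3, h4, h5, h6⟩ := ih h1
      refine ⟨m + 1, by omega, by omega, ?_, fun j h7 h8 => ?_, ?_⟩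
      · rw [← h4]; congr 2; push_cast; ring
      · rcases (show j = i + 1 ∨ i + 1 < j by omega) with rfl | h9
        · simp [hV]
        · exact h5 j h9 (by push_cast at h8; omega)
      · rw [← h6, List.range_succ_eq_map]
        simp [Function.comp_def, add_comm, add_left_comm]

end Aut

/-! ### Reading block sequences off a transducer. -/

/-- The letters below and above the block `t`. -/
def blkWord (a b s : ℤ) (t : Blk) : List (ℕ × ℕ) :=
  (List.range (blkLen a b t).toNat).map fun j : ℕ =>
    (if ((inData a b s).hd t ≤ j ∧ j < (inData a b s).hd t + (inData a b s).wd t ↔ s ≠ 0)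
      then 1 else 0,
    if ((outData a b s).hd t ≤ j ∧ j < (outData a b s).hd t + (outData a b s).wd t ↔ s = 0)
      then 1 else 0)

/-- The word is read along one block. -/
def isBlkWord (a b s : ℤ) (w : List (ℕ × ℕ)) : Bool :=
  [Blk.A, .B, .C, .D, .E].any fun t => w == blkWord a b s t

/-- The transducer reads block words from each visit of `V` to the next. -/
def Aut.blkCheck (a b s : ℤ) (n : ℕ) (V : ℕ → Bool) (E : Aut) : Bool :=
  E.all fun e => Aut.returnCheck E V (fun _ => true) n e.1 [] &&
    (!(V e.1) || Aut.returnCheck E V (isBlkWord a b s) n e.1 [])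

/-- The visits to `V` are the starts of the blocks: between two consecutive visits the path reads a
block word. -/
theorem Aut.IsPath.stripRel {E : Aut} {s X Y : ℤ → ℕ} (h : E.IsPath s X Y) {a b σ : ℤ}
    (hok : LevelOk a b σ) {n : ℕ} {V : ℕ → Bool} (hc : E.blkCheck a b σ n V = true) :
    StripRel a b σ {i | X i = 1} {i | Y i = 1} := by
  have hc' : ∀ i, returnCheck E V (fun _ => true) n (s i) [] = true ∧
      (V (s i) = true → returnCheck E V (isBlkWord a b σ) n (s i) [] = true) := fun i => by
    have := List.all_eq_true.1 hc _ (h i)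
    simp only [Bool.and_eq_true, Bool.or_eq_true, Bool.not_eq_true'] at this
    exact ⟨this.1, fun hV => by simpa [hV] using this.2⟩
  obtain ⟨κ, hκ⟩ := exists_consecutive (V := {i | V (s i) = true})
    (Good := fun i j => ∃ t, j = i + blkLen a b t ∧ ∀ k : ℕ, k < blkLen a b t →
      (X (i + k), Y (i + k)) = (
        if ((inData a b σ).hd t ≤ k ∧ k < (inData a b σ).hd t + (inData a b σ).wd t ↔ σ ≠ 0)
          then 1 else 0,
        if ((outData a b σ).hd t ≤ k ∧ k < (outData a b σ).hd t + (outData a b σ).wd t ↔ σ = 0)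
          then 1 else 0))
    (fun i => by
      -- Every walk meets `V` within `n` steps, so starting at `i - n` gives a visit not beyond `i`.
      obtain ⟨m, h1, h2, h3, -⟩ := h.exists_return (hc' (i - n)).1
      exact ⟨_, h3, by omega⟩)
    (fun i hi => by
      obtain ⟨m, h1, h2, h3, h4, h5⟩ := h.exists_return ((hc' i).2 hi)
      refine ⟨_, h3, by omega, h4, ?_⟩
      obtain ⟨t, -, ht⟩ := List.any_eq_true.1 h5
      simp only [List.nil_append, beq_iff_eq] at ht
      have hl := congrArg List.length ht
      simp only [blkWord, List.length_map, List.length_range] at hl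
      have hpos := (inData_wf hok t).1
      have hm : (m : ℤ) = blkLen a b t := by
        have : (inData a b σ).ln t = blkLen a b t := rfl
        omega
      refine ⟨t, by omega, fun k hk => ?_⟩
      have h6 := congrArg (fun l => l[k]?) ht
      simp only [blkWord] at h6
      rw [← hl] at h6
      simpa [show k < m by omega] using h6)
  choose hV hlt t ht hw using hκ
  have hmem : ∀ i, ∃ k, ∃ j : ℕ, i - κ k = j ∧ j < blkLen a b (t k) := fun i => by
    obtain ⟨k, h1, h2⟩ := exists_mem_interval (κ := κ)
      (strictMono_int_of_lt_succ fun k => hlt k) i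
    have := ht k
    exact ⟨k, (i - κ k).toNat, by omega, by omega⟩
  have key : ∀ (M : MarkData), M.Wf → M.ln = blkLen a b → ∀ i, ∃ k, ∃ j : ℕ, i - κ k = j ∧
      j < blkLen a b (t k) ∧ (i ∈ M.zone κ t ↔ M.InMark (t k) j) := by
    intro M hM hl i
    obtain ⟨k, j, h1, h2⟩ := hmem i
    refine ⟨k, j, h1, h2, fun h3 => ?_, fun h3 => ⟨k, by rwa [h1]⟩⟩
    by_contra h4
    rw [← h1] at h4
    have := ht k
    exact not_mem_zone_of_le hM (fun k => by rw [hl]; exact ht k) (k := k) (by omega)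
      (by omega) h4 h3
  refine ⟨κ, t, ht, ?_, ?_⟩
  · ext i
    obtain ⟨k, j, h1, h2, h3⟩ := key _ (inData_wf hok) rfl i
    rw [h3, mem_orient]
    have h4 := congrArg Prod.fst (hw k j h2)
    rw [show κ k + j = i by omega] at h4
    simp only at h4
    simp only [Set.mem_ofPred_eq, h4, MarkData.InMark]
    rcases hok.hs with rfl | rfl <;> simp
  · ext i
    obtain ⟨k, j, h1, h2, h3⟩ := key _ (outData_wf hok) rfl i
    rw [h3, mem_orient]
    have h4 := congrArg Prod.snd (hw k j h2)
    rw [show κ k + j = i by omega] at h4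
    simp only at h4
    simp only [Set.mem_ofPred_eq, h4, MarkData.InMark]
    rcases hok.hs with rfl | rfl <;> simp

/-! ### The transducers of the tile set, and the finite computations. -/

namespace Aut

/-- The rows made of the tiles of state two. -/
def autOne : Aut := [(0, 0, 1, 0), (0, 0, 0, 2)]

/-- The rows made of the other tiles. -/
def autZero : Aut :=
  [(0, 0, 1, 0), (0, 3, 2, 1), (1, 0, 2, 2), (1, 1, 0, 2), (1, 3, 2, 3), (3, 0, 1, 1),
    (3, 1, 1, 1), (3, 1, 2, 2), (3, 3, 3, 1)]

/-- Adds one row of the second kind above. -/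
def addZero (E : Aut) : Aut := (E.comp 4 (fun x _ z => (x, z)) autZero).prune 30

/-- Keeps the edges with upper letter zero or one. -/
def restrict (E : Aut) : Aut := prune 30 (E.filter fun e => Nat.ble e.2.2.2 1)

/-- Strips of five rows between rows with letters zero and one. -/
def autA : Aut :=
  [(0, 1, 1, 0), (0, 2, 1, 1), (1, 3, 1, 0), (1, 4, 0, 0), (2, 5, 1, 1), (3, 6, 0, 0),
    (3, 7, 1, 1), (4, 9, 0, 0), (5, 0, 1, 0), (6, 1, 0, 0), (6, 2, 0, 1), (7, 8, 1, 1),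
    (8, 0, 1, 1), (9, 5, 0, 0)]

/-- Strips of four rows between rows with letters zero and one. -/
def autB : Aut :=
  [(0, 1, 0, 0), (1, 2, 0, 1), (1, 3, 0, 0), (2, 0, 0, 1), (2, 3, 1, 1), (3, 5, 1, 1),
    (3, 6, 0, 0), (4, 1, 0, 1), (5, 4, 0, 1), (5, 7, 1, 1), (6, 5, 0, 1), (7, 6, 0, 1)]

/-- Strips of four rows between strips of five rows. -/
def autQ : Aut :=
  [(0, 1, 0, 1), (1, 2, 0, 0), (1, 3, 0, 1), (2, 4, 0, 0), (3, 6, 1, 1), (3, 7, 0, 1),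
    (4, 5, 0, 1), (5, 0, 0, 1), (6, 5, 1, 1), (6, 8, 1, 1), (7, 9, 0, 0), (8, 11, 1, 1),
    (9, 10, 0, 0), (10, 4, 0, 0), (10, 8, 1, 1), (11, 4, 0, 1)]

/-- Composition of strips. -/
def stack (E F : Aut) : Aut := (E.comp 16 (fun x _ z => (x, z)) F).prune 30

/-- The middle one of three strips. -/
def middle (E F G : Aut) : Aut :=
  (((E.comp 16 (fun _ y z => (y, z)) F).prune 30).comp 16 (fun x y _ => (x, y)) G).prune 30

theorem not_oneZeroOne : (autOne.addZero.comp 4 (fun x _ z => (x, z)) autOne).prune 30 = [] := by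
  decide +kernel

theorem not_oneZeroZeroOne :
    (autOne.addZero.addZero.comp 4 (fun x _ z => (x, z)) autOne).prune 30 = [] := by
  decide +kernel

/-- The composite states are reduced modulo a number and then looked up in a table of hexadecimal
digits; the check certifies the table. -/
theorem homA : homCheck (relabel 34 0x401030070002000800506090600)
    autOne.addZero.addZero.addZero.addZero.restrict autA = true := by
  decide +kernel

theorem homB : homCheck (relabel 14 0x15001267043) autOne.addZero.addZero.addZero.restrict autB =
    true := by
  decide +kernel

theorem stack_B_B : autB.stack autB = [] := by decide +kernel

theorem stack_A_A_A : (autA.stack autA).stack autA = [] := by decide +kernel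

/-- Composite states are written in base 16: 25 is the pair (1, 9), and 1331 below is the triple (5,
3, 3). Blocks start at these states. -/
theorem blkCheck_A_A : (autA.stack autA).blkCheck 3 5 0 20 (fun n => n == 25) = true := by
  decide +kernel

theorem blkCheck_Q : autQ.blkCheck 2 3 1 20 (fun n => n == 5) = true := by
  decide +kernel

theorem blkCheck_Q_A_Q : ((autQ.stack autA).stack autQ).blkCheck 5 8 1 30 (fun n => n == 1331) =
    true := by
  decide +kernel

theorem stack_Q_A_Q_A_Q : (((autQ.stack autA).stack autQ).stack autA).stack autQ = [] := by
  decide +kernel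

theorem homQ : homCheck (relabel 857 0x5505055550000000000000000000000a0020000000000000330303333000000010919111000040004000000700005050050000000000000000000000a002000aa00000000030303003000000010019100000040044000000700000050050000000000000000000000a00200000000000000000000030000000100191000000000008080707000000000000000000000066060666600000000000000000b000000b000000000040044000000005505055550000000000000000000000a0020000000000000000000003000000011919111100000000000000708808088880000000000000000000000000000000000000000000000000000044040444400000000000050050000000000000000000000a0020000000000000000000003000000011019111100040004000070705505055550000000000000000000000a0020000000000000000000033000000010019100000000000000000700000000000000000000000000000000066060666600000bb0b0bbbb000000040040004000000000005050050000000000000000000000a002000aa0000000033030333300000001001910000004004400000070)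
    (middle autA autB autA) autQ = true := by
  decide +kernel

/-- In five rows of the second kind, the row that stays in state zero. -/
def zeroRow (n : ℕ) : ℕ :=
  if n / 16 % 4 = 0 ∧ n / 4 % 4 = 1 then 2 else if n / 64 % 4 = 0 ∧ n / 16 % 4 = 1 then 3
  else if n / 256 % 4 = 0 ∧ n / 64 % 4 = 1 then 4 else 1

/-- The states of the five rows are the base-4 digits of the composite state, the top row being the
last digit. After pruning, the row selected by `zeroRow` is the same at both ends of an edge and its
state is zero. -/
theorem zeroRow_check : (autZero.addZero.addZero.addZero.addZero.all fun e =>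
    zeroRow e.1 == zeroRow e.2.1 && e.1 / 4 ^ zeroRow e.1 % 4 == 0) = true := by
  decide +kernel

end Aut

open Aut

/-! ### Rows of a tiling, and strips of four and five rows. -/

/-- The row with lower letters `S y` and upper letters `S (y + 1)` reads like a row of tiles of
state two, and is not constantly zero below. -/
def TypeOne (S : ℤ → ℤ → ℕ) (y : ℤ) : Prop :=
  (∀ x, S y x = 1 ∧ S (y + 1) x = 0 ∨ S y x = 0 ∧ S (y + 1) x = 2) ∧ ∃ x, S y x = 1

/-- The rows of letters of a tiling. -/
structure IsTilingRows (S : ℤ → ℤ → ℕ) : Prop where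
  zero : ∀ y, ¬ TypeOne S y → ∃ s, autZero.IsPath s (S y) (S (y + 1))

namespace IsTilingRows
variable {S : ℤ → ℤ → ℕ} {y : ℤ}

theorem path_one (h : TypeOne S y) : autOne.IsPath (fun _ => 0) (S y) (S (y + 1)) := fun i => by
  rcases h.1 i with ⟨h1, h2⟩ | ⟨h1, h2⟩ <;> simp [autOne, h1, h2]

theorem le_one (h : TypeOne S y) (x : ℤ) : Nat.ble (S y x) 1 = true := by
  rcases h.1 x with ⟨h1, -⟩ | ⟨h1, -⟩ <;> rw [h1] <;> rfl

theorem not_one_one (h : TypeOne S y) : ¬ TypeOne S (y + 1) := by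
  rintro ⟨-, x, hx⟩
  rcases h.1 x with ⟨-, h1⟩ | ⟨-, h1⟩ <;> omega

variable (hS : IsTilingRows S)
include hS

theorem path_addZero {E : Aut} {s X : ℤ → ℕ} {y : ℤ} (h : E.IsPath s X (S y))
    (hy : ¬ TypeOne S y) :
    ∃ t, (E.addZero).IsPath (fun i => s i * 4 + t i) X (S (y + 1)) ∧
      autZero.IsPath t (S y) (S (y + 1)) := by
  obtain ⟨t, ht⟩ := hS.zero y hy
  exact ⟨t, (h.comp ht 4).prune 30, ht⟩

theorem not_one_zero_one (h : TypeOne S y) : ¬ TypeOne S (y + 2) := by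
  intro h2
  obtain ⟨t, ht, -⟩ := hS.path_addZero (path_one h) (not_one_one h)
  rw [add_assoc] at ht
  have := ((ht.comp (path_one h2) 4).prune 30)
  rw [not_oneZeroOne] at this
  exact not_isPath_nil this

theorem not_one_zero_zero_one (h : TypeOne S y) : ¬ TypeOne S (y + 3) := by
  intro h2
  obtain ⟨t, ht, -⟩ := hS.path_addZero (path_one h) (not_one_one h)
  rw [add_assoc] at ht
  obtain ⟨t, ht, -⟩ := hS.path_addZero ht (hS.not_one_zero_one h)
  rw [add_assoc] at ht
  have := ((ht.comp (path_one h2) 4).prune 30)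
  rw [not_oneZeroZeroOne] at this
  exact not_isPath_nil this

/-- If none of five successive rows is of this type, `zeroRow_check` finds one that stays in state
zero. It reads 1 below and 0 above everywhere, hence is of this type after all. -/
theorem exists_one (y : ℤ) : TypeOne S y ∨ TypeOne S (y + 1) ∨ TypeOne S (y + 2) ∨
    TypeOne S (y + 3) ∨ TypeOne S (y + 4) := by
  by_contra! h
  obtain ⟨h0, h1, h2, h3, h4⟩ := h
  obtain ⟨t₀, p₀⟩ := hS.zero y h0
  obtain ⟨t₁, p, p₁⟩ := hS.path_addZero p₀ h1
  rw [add_assoc] at p p₁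
  obtain ⟨t₂, p, p₂⟩ := hS.path_addZero p h2
  rw [add_assoc] at p p₂
  obtain ⟨t₃, p, p₃⟩ := hS.path_addZero p h3
  rw [add_assoc] at p p₃
  obtain ⟨t₄, p, p₄⟩ := hS.path_addZero p h4
  rw [add_assoc] at p p₄
  have hlt : ∀ {t X Y}, autZero.IsPath t X Y → ∀ i, t i < 4 := by
    intro t X Y ht i
    have h : ∀ e ∈ autZero, e.1 < 4 := by decide
    exact h _ (ht i)
  have hzero : ∀ {t y}, autZero.IsPath t (S y) (S (y + 1)) → ¬ TypeOne S y →
      ¬ ∀ i, t i = 0 := by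
    intro t y ht hy h0
    refine hy ?_
    have h : ∀ e ∈ autZero, e.1 = 0 → e.2.1 = 0 → e.2.2.1 = 1 ∧ e.2.2.2 = 0 := by decide
    have h' : ∀ i, S y i = 1 ∧ S (y + 1) i = 0 := fun i => h _ (ht i) (h0 i) (h0 (i + 1))
    exact ⟨fun x => Or.inl (h' x), 0, (h' 0).1⟩
  have key : ∀ i, _ := fun i => List.all_eq_true.1 zeroRow_check _ (p i)
  simp only [Bool.and_eq_true, beq_iff_eq] at key
  set σ : ℤ → ℕ := fun i => (((t₀ i * 4 + t₁ i) * 4 + t₂ i) * 4 + t₃ i) * 4 + t₄ i with hσ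
  have hconst : ∀ i, zeroRow (σ i) = zeroRow (σ 0) := by
    intro i
    induction i using Int.induction_on with
    | zero => rfl
    | succ i ih => rw [← ih]; exact (key i).1.symm
    | pred i ih => rw [← ih, (key (-(i : ℤ) - 1)).1, sub_add_cancel]
  have hz : ∀ i, σ i / 4 ^ zeroRow (σ 0) % 4 = 0 := fun i => by
    have := (key i).2
    rwa [← hconst i]
  have hcase : zeroRow (σ 0) = 1 ∨ zeroRow (σ 0) = 2 ∨ zeroRow (σ 0) = 3 ∨
      zeroRow (σ 0) = 4 := by
    unfold zeroRow
    split_ifs <;> simp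
  have l₀ := hlt p₀
  have l₁ := hlt p₁
  have l₂ := hlt p₂
  have l₃ := hlt p₃
  have l₄ := hlt p₄
  rcases hcase with hc | hc | hc | hc <;> rw [hc] at hz <;> simp only [hσ] at hz
  · refine hzero (y := y + 3) p₃ h3 fun i => ?_
    have := hz i; have := l₃ i; have := l₄ i; omega
  · refine hzero (y := y + 2) (by rw [add_assoc]; exact p₂) h2 fun i => ?_
    have := hz i; have := l₃ i; have := l₄ i; have := l₂ i; omega
  · refine hzero (y := y + 1) (by rw [add_assoc]; exact p₁) h1 fun i => ?_
    have := hz i; have := l₃ i; have := l₄ i; have := l₂ i; have := l₁ i; omega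
  · refine hzero p₀ h0 fun i => ?_
    have := hz i; have := l₃ i; have := l₄ i; have := l₂ i; have := l₁ i; have := l₀ i; omega

theorem path_B (h : TypeOne S y) (h' : TypeOne S (y + 4)) :
    ∃ s, autB.IsPath s (S y) (S (y + 4)) := by
  have n3 : ¬ TypeOne S (y + 3) := fun h3 => not_one_one h3 (by rwa [add_assoc])
  obtain ⟨t, ht, -⟩ := hS.path_addZero (path_one h) (not_one_one h)
  rw [add_assoc] at ht
  obtain ⟨t, ht, -⟩ := hS.path_addZero ht (hS.not_one_zero_one h)
  rw [add_assoc] at ht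
  obtain ⟨t, ht, -⟩ := hS.path_addZero ht n3
  rw [add_assoc] at ht
  exact ⟨_, ((ht.filter (fun n => Nat.ble n 1) (le_one h')).prune 30).map homB⟩

theorem path_A (h : TypeOne S y) (h' : TypeOne S (y + 5)) :
    ∃ s, autA.IsPath s (S y) (S (y + 5)) := by
  have n4 : ¬ TypeOne S (y + 4) := fun h4 => not_one_one h4 (by rwa [add_assoc])
  have n3 : ¬ TypeOne S (y + 3) := fun h3 => hS.not_one_zero_one h3 (by rwa [add_assoc])
  obtain ⟨t, ht, -⟩ := hS.path_addZero (path_one h) (not_one_one h)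
  rw [add_assoc] at ht
  obtain ⟨t, ht, -⟩ := hS.path_addZero ht (hS.not_one_zero_one h)
  rw [add_assoc] at ht
  obtain ⟨t, ht, -⟩ := hS.path_addZero ht n3
  rw [add_assoc] at ht
  obtain ⟨t, ht, -⟩ := hS.path_addZero ht n4
  rw [add_assoc] at ht
  exact ⟨_, ((ht.filter (fun n => Nat.ble n 1) (le_one h')).prune 30).map homA⟩

/-- The strips of five rows on both sides restrict the four-row strip between them; `autQ` records
the letters compatible with both. -/
theorem path_Q {w x y z : ℤ} (hx : x = w + 5) (hy : y = x + 4) (hz : z = y + 5)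
    (h0 : TypeOne S w) (h1 : TypeOne S x) (h2 : TypeOne S y) (h3 : TypeOne S z) :
    ∃ s, autQ.IsPath s (S x) (S y) := by
  subst hx hy hz
  obtain ⟨s₁, p₁⟩ := hS.path_A h0 h1
  obtain ⟨s₂, p₂⟩ := hS.path_B h1 h2
  obtain ⟨s₃, p₃⟩ := hS.path_A h2 h3
  exact ⟨_, ((((p₁.comp_right p₂ 16).prune 30).comp_left p₃ 16).prune 30).map homQ⟩

theorem not_B_B (h0 : TypeOne S y) (h1 : TypeOne S (y + 4)) : ¬ TypeOne S (y + 8) := by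
  intro h2
  obtain ⟨s₁, p₁⟩ := hS.path_B h0 h1
  obtain ⟨s₂, p₂⟩ := hS.path_B h1 (by rwa [add_assoc])
  have := (p₁.comp p₂ 16).prune 30
  rw [← stack, stack_B_B] at this
  exact not_isPath_nil this

theorem not_A_A_A (h0 : TypeOne S y) (h1 : TypeOne S (y + 5)) (h2 : TypeOne S (y + 10)) :
    ¬ TypeOne S (y + 15) := by
  intro h3
  obtain ⟨s₁, p₁⟩ := hS.path_A h0 h1
  obtain ⟨s₂, p₂⟩ := hS.path_A h1 (by rwa [add_assoc])
  rw [add_assoc] at p₂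
  obtain ⟨s₃, p₃⟩ := hS.path_A h2 (by rwa [add_assoc])
  have := (((p₁.comp p₂ 16).prune 30).comp p₃ 16).prune 30
  rw [← stack, ← stack, stack_A_A_A] at this
  exact not_isPath_nil this

theorem levelRel_zero {w x y z : ℤ} (hx : x = w + 5) (hy : y = x + 4) (hz : z = y + 5)
    (h0 : TypeOne S w) (h1 : TypeOne S x) (h2 : TypeOne S y) (h3 : TypeOne S z) :
    LevelRel 0 {i | S x i = 1} {i | S y i = 1} := by
  obtain ⟨s, p⟩ := hS.path_Q hx hy hz h0 h1 h2 h3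
  exact p.stripRel (levelPar_ok 0) blkCheck_Q

theorem levelRel_one (h0 : TypeOne S y) (h1 : TypeOne S (y + 5)) (h2 : TypeOne S (y + 10)) :
    LevelRel 1 {i | S y i = 1} {i | S (y + 10) i = 1} := by
  obtain ⟨s₁, p₁⟩ := hS.path_A h0 h1
  obtain ⟨s₂, p₂⟩ := hS.path_A h1 (by rwa [add_assoc])
  rw [add_assoc] at p₂
  exact ((p₁.comp p₂ 16).prune 30).stripRel (levelPar_ok 1) blkCheck_A_A

theorem levelRel_two (h0 : TypeOne S (y - 5)) (h1 : TypeOne S y) (h2 : TypeOne S (y + 4))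
    (h3 : TypeOne S (y + 9)) (h4 : TypeOne S (y + 13)) (h5 : TypeOne S (y + 18)) :
    LevelRel 2 {i | S y i = 1} {i | S (y + 13) i = 1} := by
  obtain ⟨s₁, p₁⟩ := hS.path_Q (by ring) (by ring) (by ring) h0 h1 h2 h3
  obtain ⟨s₂, p₂⟩ := hS.path_A h2 (by rwa [add_assoc])
  rw [add_assoc] at p₂
  obtain ⟨s₃, p₃⟩ := hS.path_Q (by ring) (by ring) (by ring) h2 h3 h4 h5
  exact ((((p₁.comp p₂ 16).prune 30).comp p₃ 16).prune 30).stripRel (levelPar_ok 2) blkCheck_Q_A_Q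

theorem not_B_A_B_A_B (h0 : TypeOne S (y - 5)) (h1 : TypeOne S y) (h2 : TypeOne S (y + 4))
    (h3 : TypeOne S (y + 9)) (h4 : TypeOne S (y + 13)) (h5 : TypeOne S (y + 18))
    (h6 : TypeOne S (y + 22)) : ¬ TypeOne S (y + 27) := by
  intro h7
  obtain ⟨s₁, p₁⟩ := hS.path_Q (by ring) (by ring) (by ring) h0 h1 h2 h3
  obtain ⟨s₂, p₂⟩ := hS.path_A h2 (by rwa [add_assoc])
  rw [add_assoc] at p₂
  obtain ⟨s₃, p₃⟩ := hS.path_Q (by ring) (by ring) (by ring) h2 h3 h4 h5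
  obtain ⟨s₄, p₄⟩ := hS.path_A h4 (by rwa [add_assoc])
  rw [add_assoc] at p₄
  obtain ⟨s₅, p₅⟩ := hS.path_Q (by ring) (by ring) (by ring) h4 h5 h6 h7
  have := (((((((p₁.comp p₂ 16).prune 30).comp p₃ 16).prune 30).comp p₄ 16).prune 30).comp p₅
    16).prune 30
  rw [← stack, ← stack, ← stack, ← stack, stack_Q_A_Q_A_Q] at this
  exact not_isPath_nil this

end IsTilingRows

/-! ### The decomposition at level zero. -/

/-- The heights between a strip of four rows and two strips of five rows. -/
def cutSet (S : ℤ → ℤ → ℕ) : Set ℤ :=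
  {y | TypeOne S (y - 4) ∧ TypeOne S y ∧ TypeOne S (y + 5) ∧ TypeOne S (y + 10) ∨
    TypeOne S (y - 10) ∧ TypeOne S (y - 5) ∧ TypeOne S y ∧ TypeOne S (y + 4)}

theorem typeOne_of_mem_cutSet {S : ℤ → ℤ → ℕ} {y : ℤ} (h : y ∈ cutSet S) : TypeOne S y := by
  rcases h with h | h
  exacts [h.2.1, h.2.2.1]

namespace IsTilingRows
variable {S : ℤ → ℤ → ℕ} (hS : IsTilingRows S)
include hS

theorem four_le {u v : ℤ} (hu : TypeOne S u) (hv : TypeOne S v) (huv : u < v) : u + 4 ≤ v := by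
  by_contra! h
  rcases (show v = u + 1 ∨ v = u + 2 ∨ v = u + 3 by omega) with rfl | rfl | rfl
  · exact not_one_one hu hv
  · exact hS.not_one_zero_one hu hv
  · exact hS.not_one_zero_zero_one hu hv

theorem next {u v w : ℤ} (hv : v = u + 4) (hw : w = u + 5) (hu : TypeOne S u) :
    TypeOne S v ∨ TypeOne S w := by
  subst hv hw
  rcases hS.exists_one (u + 1) with h | h | h | h | h
  · exact absurd h (not_one_one hu)
  · have := hS.four_le hu h (by omega); omega
  · have := hS.four_le hu h (by omega); omega
  · exact Or.inl (by rwa [add_assoc] at h)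
  · exact Or.inr (by rwa [add_assoc] at h)

theorem prev {u v w : ℤ} (hv : v = u - 4) (hw : w = u - 5) (hu : TypeOne S u) :
    TypeOne S v ∨ TypeOne S w := by
  rcases hS.exists_one (u - 5) with h | h | h | h | h
  · exact Or.inr (by rwa [hw])
  · exact Or.inl (by rwa [hv, show u - 4 = u - 5 + 1 by ring])
  all_goals have := hS.four_le h hu (by omega); omega

theorem bb {u v w : ℤ} (hu : TypeOne S u) (hv : TypeOne S v) (hw : TypeOne S w)
    (h : v = u + 4) (h' : w = u + 8) : False := by
  subst h h'; exact hS.not_B_B hu hv hw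

theorem aaa {u v w x : ℤ} (hu : TypeOne S u) (hv : TypeOne S v) (hw : TypeOne S w)
    (hx : TypeOne S x) (h : v = u + 5) (h' : w = u + 10) (h'' : x = u + 15) : False := by
  subst h h' h''; exact hS.not_A_A_A hu hv hw hx

theorem next_five {t u v : ℤ} (h : u = t + 4) (hv : v = u + 5) (ht : TypeOne S t)
    (hu : TypeOne S u) : TypeOne S v :=
  (hS.next rfl hv hu).resolve_left fun h' => hS.bb ht hu h' h (by omega)

theorem prev_five {t u v : ℤ} (h : u = t - 4) (hv : v = u - 5) (ht : TypeOne S t)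
    (hu : TypeOne S u) : TypeOne S v :=
  (hS.prev rfl hv hu).resolve_left fun h' => hS.bb h' hu ht (by omega) (by omega)

theorem exists_cut_of_aa {u v w : ℤ} (hv : v = u - 5) (hw : w = u - 10) (h0 : TypeOne S u)
    (h1 : TypeOne S v) (h2 : TypeOne S w) : ∃ y ∈ cutSet S, y ≤ u := by
  subst hv hw
  refine ⟨u - 10, Or.inl ⟨?_, h2, ?_, ?_⟩, by omega⟩
  · refine (hS.prev rfl rfl h2).resolve_right fun h => ?_
    exact hS.aaa h h2 h1 h0 (by ring) (by ring) (by ring)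
  · rwa [show u - 10 + 5 = u - 5 by ring]
  · rwa [sub_add_cancel]

/-- Going down from a five-row strip, either two five-row strips are met in succession, or four- and
five-row strips alternate long enough to contradict `not_B_A_B_A_B`. -/
theorem exists_cut_of_a {u v : ℤ} (hv : v = u - 5) (h0 : TypeOne S u) (h1 : TypeOne S v) :
    ∃ y ∈ cutSet S, y ≤ u := by
  subst hv
  rcases hS.prev (v := u - 9) (w := u - 10) (by ring) (by ring) h1 with h2 | h2
  swap; · exact hS.exists_cut_of_aa rfl rfl h0 h1 h2
  have h3 := hS.prev_five (v := u - 14) (by ring) (by ring) h1 h2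
  rcases hS.prev (v := u - 18) (w := u - 19) (by ring) (by ring) h3 with h4 | h4
  swap
  · obtain ⟨y, hy, hyu⟩ := hS.exists_cut_of_aa (by ring) (by ring) h2 h3 h4
    exact ⟨y, hy, by omega⟩
  have h5 := hS.prev_five (v := u - 23) (by ring) (by ring) h3 h4
  rcases hS.prev (v := u - 27) (w := u - 28) (by ring) (by ring) h5 with h6 | h6
  swap
  · obtain ⟨y, hy, hyu⟩ := hS.exists_cut_of_aa (by ring) (by ring) h4 h5 h6
    exact ⟨y, hy, by omega⟩
  have h7 := hS.prev_five (v := u - 32) (by ring) (by ring) h5 h6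
  exfalso
  refine hS.not_B_A_B_A_B (y := u - 27) ?_ h6 ?_ ?_ ?_ ?_ ?_ ?_
  · rwa [show u - 27 - 5 = u - 32 by ring]
  · rwa [show u - 27 + 4 = u - 23 by ring]
  · rwa [show u - 27 + 9 = u - 18 by ring]
  · rwa [show u - 27 + 13 = u - 14 by ring]
  · rwa [show u - 27 + 18 = u - 9 by ring]
  · rwa [show u - 27 + 22 = u - 5 by ring]
  · rwa [sub_add_cancel]

theorem exists_cut (n : ℤ) : ∃ y ∈ cutSet S, y ≤ n := by
  obtain ⟨u, hu, hun⟩ : ∃ u, TypeOne S u ∧ u ≤ n := by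
    rcases hS.exists_one (n - 4) with h | h | h | h | h <;> exact ⟨_, h, by omega⟩
  rcases hS.prev rfl rfl hu with h1 | h1
  · obtain ⟨y, hy, hyu⟩ := hS.exists_cut_of_a rfl h1 (hS.prev_five rfl rfl hu h1)
    exact ⟨y, hy, by omega⟩
  · obtain ⟨y, hy, hyu⟩ := hS.exists_cut_of_a rfl hu h1
    exact ⟨y, hy, by omega⟩

/-- Above a cut there is either AA, which is level 1, or a four-row strip. In the latter case B is
followed by AA, or by a further A B and then AA, which gives level 0 or level 2. Both BB and AAA are
excluded, so these cases alternate as required. -/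
theorem decomposes : Decomposes (fun y => {x | S y x = 1}) 0 (cutSet S) where
  below := hS.exists_cut
  next y hy := by
    rcases id hy with ⟨h1, h2, h3, h4⟩ | ⟨h1, h2, h3, h4⟩
    · have h5 : TypeOne S (y + 14) := (hS.next (by ring) (by ring) h4).resolve_right fun h =>
        hS.aaa h2 h3 h4 h rfl rfl rfl
      refine ⟨y + 10, Or.inr (Or.inl ⟨hy, Or.inr ⟨?_, ?_, h4, ?_⟩, rfl, fun w hw hw' hc => ?_,
        hS.levelRel_one h2 h3 h4⟩)⟩
      · rwa [add_sub_cancel_right]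
      · rwa [show y + 10 - 5 = y + 5 by ring]
      · rwa [add_assoc]
      · have h6 := typeOne_of_mem_cutSet hc
        have h7 := hS.four_le h2 h6 hw
        have h8 := hS.four_le h6 h4 hw'
        have h9 : w = y + 5 := by
          rcases lt_trichotomy w (y + 5) with h | h | h
          · have := hS.four_le h6 h3 h; omega
          · exact h
          · have := hS.four_le h3 h6 h; omega
        subst h9
        rcases hc with ⟨h, -⟩ | ⟨-, -, -, h⟩
        · have := hS.four_le h2 h (by omega); omega
        · have := hS.four_le h h4 (by omega); omega
    · have h5 : TypeOne S (y + 9) := hS.next_five rfl (by ring) h3 h4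
      rcases hS.next (v := y + 13) (w := y + 14) (by ring) (by ring) h5 with h6 | h6
      · have h7 : TypeOne S (y + 18) := hS.next_five (by ring) (by ring) h5 h6
        have h8 : TypeOne S (y + 23) := by
          refine (hS.next (v := y + 22) (by ring) (by ring) h7).resolve_left fun h8 => ?_
          have h9 : TypeOne S (y + 27) := hS.next_five (by ring) (by ring) h7 h8
          exact hS.not_B_A_B_A_B h2 h3 h4 h5 h6 h7 h8 h9
        refine ⟨y + 13, Or.inr (Or.inr ⟨hy, Or.inl ⟨?_, h6, ?_, ?_⟩, rfl, fun w hw hw' hc => ?_,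
          hS.levelRel_two h2 h3 h4 h5 h6 h7⟩)⟩
        · rwa [show y + 13 - 4 = y + 9 by ring]
        · rwa [add_assoc]
        · rwa [add_assoc]
        · have h9 := typeOne_of_mem_cutSet hc
          have h10 := hS.four_le h3 h9 hw
          have h11 := hS.four_le h9 h6 hw'
          have h12 : w = y + 4 ∨ w = y + 9 := by
            rcases lt_trichotomy w (y + 4) with h | h | h
            · have := hS.four_le h9 h4 h; omega
            · exact Or.inl h
            have := hS.four_le h4 h9 h
            rcases lt_trichotomy w (y + 9) with h' | h' | h'
            · have := hS.four_le h9 h5 h'; omega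
            · exact Or.inr h'
            · have := hS.four_le h5 h9 h'; omega
          rcases h12 with rfl | rfl
          · rcases hc with ⟨-, -, -, h⟩ | ⟨-, h, -⟩
            · have := hS.four_le h6 h (by omega); omega
            · have := hS.four_le h h3 (by omega); omega
          · rcases hc with ⟨h, -⟩ | ⟨h, -⟩
            · have := hS.four_le h4 h (by omega); omega
            · have := hS.four_le h h3 (by omega); omega
      · refine ⟨y + 4, Or.inl ⟨hy, Or.inl ⟨?_, h4, ?_, ?_⟩, rfl, fun w hw hw' hc => ?_,
          hS.levelRel_zero (by ring) rfl (by ring) h2 h3 h4 h5⟩⟩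
        · rwa [add_sub_cancel_right]
        · rwa [add_assoc]
        · rwa [add_assoc]
        · have := hS.four_le h3 (typeOne_of_mem_cutSet hc) hw
          omega
  alternate i j y z w hi hj h1 h2 := by
    have hz := h1.eq
    have hw := h2.eq
    have oy := typeOne_of_mem_cutSet h1.left
    have ow := typeOne_of_mem_cutSet h2.right
    rcases id h2.left with ⟨g1, g2, g3, g4⟩ | ⟨g1, g2, g3, g4⟩
    · rcases hj with rfl | rfl <;> simp only [levelHeight] at hw
      · have := hS.four_le ow g3 (by omega); omega
      · have := hS.four_le g4 ow (by omega); omega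
    · rcases hi with rfl | rfl <;> simp only [levelHeight] at hz
      · have := hS.four_le g2 oy (by omega); omega
      · have := hS.four_le oy g1 (by omega); omega

end IsTilingRows

/-! ### From tilings to rows of letters. -/

/-- The lower letters of the rows of a map to tiles. -/
def letters (f : ℤ × ℤ → WangTile (Fin 4) (Fin 4)) (y x : ℤ) : ℕ := (f (x, y)).s.val

open WangSet

/-- After merging colours the tiles (0,0,1,0) and (2,2,1,0) have the same vertical colours, and so
do (1,1,0,2) and (2,2,0,2). Thus letters do not always reveal the horizontal state, and the type of
a row is defined by its letters. -/
theorem isTilingRows_letters {f : ℤ × ℤ → WangTile (Fin 4) (Fin 4)} (hf : wangT'.IsTiling f) :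
    IsTilingRows (letters f) where
  zero y hy := by
    obtain ⟨ht, he, hn⟩ := hf
    have hn' : ∀ x, letters f (y + 1) x = (f (x, y)).n.val := fun x =>
      congrArg Fin.val (hn x y).symm
    by_cases h2 : ∃ x, (f (x, y)).w = 2
    · have hew : ∀ t ∈ wangT'.tiles, (t.w = 2 ↔ t.e = 2) := by decide
      obtain ⟨x₀, hx₀⟩ := h2
      have hall : ∀ x, (f (x₀ + x, y)).w = 2 := by
        intro x
        induction x using Int.induction_on with
        | zero => simpa using hx₀
        | succ i ih =>
          rw [← add_assoc, ← he]
          exact (hew _ (ht _ _)).1 ih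
        | pred i ih =>
          rw [hew _ (ht _ _), he]
          rwa [show x₀ + (-(i : ℤ) - 1) + 1 = x₀ + -(i : ℤ) by ring]
      have hsn : ∀ t ∈ wangT'.tiles, t.w = 2 →
          t.s.val = 1 ∧ t.n.val = 0 ∨ t.s.val = 0 ∧ t.n.val = 2 := by decide
      have h3 : ∀ x, letters f y x = 1 ∧ letters f (y + 1) x = 0 ∨
          letters f y x = 0 ∧ letters f (y + 1) x = 2 := fun x => by
        rw [hn']
        exact hsn _ (ht _ _) (by simpa using hall (x - x₀))
      have h4 : ∀ x, letters f y x ≠ 1 := fun x hx => hy ⟨h3, x, hx⟩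
      -- A row in state two without letter 1 below reads 0 below and 2 above throughout; the loop of
      -- `autZero` at state one reads the same.
      refine ⟨fun _ => 1, fun i => ?_⟩
      rcases h3 i with h | h
      · exact absurd h.1 (h4 i)
      · rw [h.1, h.2]; simp [Aut.autZero]
    · push Not at h2
      have hmem : ∀ t ∈ wangT'.tiles, t.w ≠ 2 →
          (t.w.val, t.e.val, t.s.val, t.n.val) ∈ Aut.autZero := by decide
      refine ⟨fun x => (f (x, y)).w.val, fun x => ?_⟩
      simp only
      rw [hn', ← he]
      exact hmem _ (ht _ _) (h2 x)

theorem not_isPeriodicTiling {f : ℤ × ℤ → WangTile (Fin 4) (Fin 4)} (hf : wangT'.IsTiling f) :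
    ¬ IsPeriodicTiling f := by
  rintro ⟨u, v, huv, h⟩
  have hl : ∀ y x, letters f (y + v) (x + u) = letters f y x := fun y x => by
    unfold letters; rw [← h]
  have hT : ∀ y, TypeOne (letters f) (y + v) ↔ TypeOne (letters f) y := fun y => by
    unfold TypeOne
    rw [← (Equiv.addRight u).forall_congr_right, ← (Equiv.addRight u).exists_congr_right]
    simp only [Equiv.coe_addRight, hl, show y + v + 1 = y + 1 + v by ring]
  refine (isTilingRows_letters hf).decomposes.not_period huv (fun y i => ?_) fun y => ?_
  · simp only [Set.mem_ofPred_eq, hl]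
  · simp only [cutSet, Set.mem_ofPred_eq, show y + v - 4 = y - 4 + v by ring,
      show y + v + 5 = y + 5 + v by ring, show y + v + 10 = y + 10 + v by ring,
      show y + v - 10 = y - 10 + v by ring, show y + v - 5 = y - 5 + v by ring,
      show y + v + 4 = y + 4 + v by ring, hT]

open WangSet

/-! ### Existence of a tiling: explicit strips of levels 0, 1, 2. -/

/-- The tiles of `wangT'` in order. -/
def tileAt (n : ℕ) : WangTile (Fin 4) (Fin 4) :=
  [⟨0, 0, 1, 0⟩, ⟨0, 3, 2, 1⟩, ⟨1, 0, 2, 2⟩, ⟨1, 1, 0, 2⟩, ⟨1, 3, 2, 3⟩, ⟨3, 0, 1, 1⟩,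
    ⟨3, 1, 1, 1⟩, ⟨3, 1, 2, 2⟩, ⟨3, 3, 3, 1⟩, ⟨2, 2, 1, 0⟩, ⟨2, 2, 0, 2⟩].getD n ⟨0, 0, 1, 0⟩

theorem tileAt_mem (n : ℕ) : tileAt n ∈ wangT'.tiles := by
  have h : ∀ n < 11, tileAt n ∈ wangT'.tiles := by decide
  rcases lt_or_ge n 11 with hn | hn
  · exact h n hn
  · have : tileAt n = tileAt 0 := by
      unfold tileAt
      rw [List.getD_eq_default _ _ (by simpa using hn)]
      rfl
    rw [this]
    exact h 0 (by omega)

/-- The tile in row `r` and column `j` of a block; row `r` of block `t` is given by the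
hexadecimal digits of an entry of a table. -/
def patternTile (tab : Blk → List ℕ) (t : Blk) (r j : ℕ) : WangTile (Fin 4) (Fin 4) :=
  tileAt (((tab t).getD r 0 >>> (4 * j)) % 16)

/-- The table fills the blocks with the parameters `a`, `b`, `s` with `h` rows of tiles, such that
all blocks have the same colours on both sides. -/
def PatternOk (a b s : ℤ) (h : ℕ) (tab : Blk → List ℕ) : Prop :=
  ∀ t ∈ [Blk.A, .B, .C, .D, .E],
    (∀ r < h, (patternTile tab t r 0).w = (patternTile tab .A r 0).w ∧
      ∀ j < (blkLen a b t).toNat,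
        (j + 1 < (blkLen a b t).toNat →
          (patternTile tab t r j).e = (patternTile tab t r (j + 1)).w) ∧
        (j + 1 = (blkLen a b t).toNat →
          (patternTile tab t r j).e = (patternTile tab .A r 0).w) ∧
        (r + 1 < h → (patternTile tab t r j).n = (patternTile tab t (r + 1) j).s)) ∧
    (List.range (blkLen a b t).toNat).map (fun j =>
      ((patternTile tab t 0 j).s.val, (patternTile tab t (h - 1) j).n.val)) = blkWord a b s t

/-- Tiles for the strips of height 4. -/
def patternB : Blk → List ℕ
  | .A => [0xaaaaa, 0x74712, 0x78154, 0x10058]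
  | .B => [0x99aaa, 0x33712, 0x71264, 0x15158]
  | .C => [0xaaaaaaaa, 0x74712712, 0x78151264, 0x10005158]
  | .D => [0xaa999aaa, 0x74333712, 0x78471264, 0x15815158]
  | .E => [0xaa99aaaaaa, 0x7433712712, 0x7847151264, 0x1581005158]

theorem patternB_ok : PatternOk 2 3 1 4 patternB := by
  unfold PatternOk
  decide +kernel

/-- Tiles for the strips of height 10. -/
def patternAA : Blk → List ℕ
  | .A => [0x99999999, 0x33333333, 0x71271274, 0x15126478, 0x515810, 0xaa99999a, 0x12333337,
      0x64712712, 0x58151261, 0x5100]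
  | .B => [0xaa999999, 0x74333333, 0x78471274, 0x15815478, 0x5810, 0xaaaa999a, 0x12743337,
      0x64784712, 0x58158151, 0x0]
  | .C => [0x9999999999999, 0x3333333333333, 0x7127127471274, 0x1512647815478, 0x51581005810,
      0xaa99999aa999a, 0x1233333743337, 0x6471274784712, 0x5815478158151, 0x5810000000]
  | .D => [0x99999aaa99999, 0x3333371233333, 0x7127126471274, 0x1512615815478, 0x51000005810,
      0xaa99aaaaa999a, 0x1233712743337, 0x6471264784712, 0x5815158158151, 0x0]
  | .E => [0x999aa99999999999, 0x3337433333333333, 0x7127847127471274, 0x1512681547815478,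
      0x51000581005810, 0xaa99aaa999aa999a, 0x1233712333743337, 0x6471264712784712,
      0x5815158151268151, 0x5100000]

theorem patternAA_ok : PatternOk 3 5 0 10 patternAA := by
  unfold PatternOk
  decide +kernel

/-- Tiles for the strips of height 13. -/
def patternBAB : Blk → List ℕ
  | .A => [0xaaaaaaaaaaaaa, 0x7471274712712, 0x7815478151264, 0x1005810005158, 0x9aa999aaa9999,
      0x3743337123333, 0x4784712647127, 0x8158151581547, 0x581, 0xaaaaaaaaaa999, 0x7127471274333,
      0x2647815478471, 0x1581005815815]
  | .B => [0x99aaaaaaaaaaa, 0x3371274712712, 0x7126478151264, 0x1515810005158, 0x999999aaa9999,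
      0x3333337123333, 0x4712712647127, 0x8151261581547, 0x5100000581, 0xaaa99aaaaa999,
      0x7123371274333, 0x2647126478471, 0x1581515815815]
  | .C => [0xaaaaaaaaaaaaaaaaaaaaa, 0x747127471271274712712, 0x781547815126478151264,
      0x100581000515810005158, 0x9aa999aaa99999aaa9999, 0x374333712333337123333,
      0x478471264712712647127, 0x815815158151261581547, 0x5100000581, 0xaaaaaaaaaaa99aaaaa999,
      0x712747127123371274333, 0x264781512647126478471, 0x158100051581515815815]
  | .D => [0xaaaaaaa999aaaaaaaaaaa, 0x747127433371274712712, 0x781547847126478151264,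
      0x100581581515810005158, 0x9aa99999999999aaa9999, 0x374333333333337123333,
      0x478471274712712647127, 0x815815478151261581547, 0x5810005100000581,
      0xaaaaa999aaa99aaaaa999, 0x712743337123371274333, 0x264784712647126478471,
      0x158158151581515815815]
  | .E => [0xaaaaa99aaaaaaaaaaaaaaaaaaa, 0x74712337127471271274712712,
      0x78154712647815126478151264, 0x10058151581000515810005158, 0x9aa99999999aaa99999aaa9999,
      0x37433333333712333337123333, 0x47847127471264712712647127, 0x81581547815158151261581547,
      0x581000000005100000581, 0xaaaaa999aaaaaaaa99aaaaa999, 0x71274333712747123371274333,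
      0x26478471264781547126478471, 0x15815815158100581515815815]

theorem patternBAB_ok : PatternOk 5 8 1 13 patternBAB := by
  unfold PatternOk
  decide +kernel


/-! ### Existence of a tiling: stacking and compactness. -/

open MarkData WangSet

/-- There are `h` rows of tiles with `X` and `Y` the positions of the colour one below and above,
and zero elsewhere. -/
def TilesStrip (h : ℕ) (X Y : Set ℤ) : Prop :=
  ∃ f : ℕ → ℤ → WangTile (Fin 4) (Fin 4), (∀ y x, f y x ∈ wangT'.tiles) ∧
    (∀ y < h, ∀ x, (f y x).e = (f y (x + 1)).w) ∧
    (∀ y, y + 1 < h → ∀ x, (f y x).n = (f (y + 1) x).s) ∧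
    (∀ x, (x ∈ X → (f 0 x).s = 1) ∧ (x ∉ X → (f 0 x).s = 0)) ∧
    ∀ x, (x ∈ Y → (f (h - 1) x).n = 1) ∧ (x ∉ Y → (f (h - 1) x).n = 0)

theorem TilesStrip.stack {h k : ℕ} (h0 : 0 < h) (k0 : 0 < k) {X Y Z : Set ℤ}
    (hX : TilesStrip h X Y) (hY : TilesStrip k Y Z) : TilesStrip (h + k) X Z := by
  obtain ⟨f, f1, f2, f3, f4, f5⟩ := hX
  obtain ⟨g, g1, g2, g3, g4, g5⟩ := hY
  refine ⟨fun y => if y < h then f y else g (y - h), fun y x => ?_, fun y hy x => ?_,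
    fun y hy x => ?_, fun x => ?_, fun x => ?_⟩
  · simp only; split_ifs; exacts [f1 _ _, g1 _ _]
  · simp only; split_ifs with h1
    exacts [f2 y h1 x, g2 _ (by omega) x]
  · simp only
    rcases lt_trichotomy (y + 1) h with h1 | h1 | h1
    · rw [if_pos h1, if_pos (by omega)]; exact f3 y h1 x
    · rw [if_pos (by omega), if_neg (by omega), h1, Nat.sub_self]
      have h2 : y = h - 1 := by omega
      subst h2
      by_cases hx : x ∈ Y
      · rw [(f5 x).1 hx, (g4 x).1 hx]
      · rw [(f5 x).2 hx, (g4 x).2 hx]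
    · rw [if_neg (by omega), if_neg (by omega), show y + 1 - h = y - h + 1 by omega]
      exact g3 _ (by omega) x
  · simpa only [if_pos h0] using f4 x
  · simp only [if_neg (show ¬ h + k - 1 < h by omega), show h + k - 1 - h = k - 1 by omega]
    exact g5 x

theorem mem_zone_iff {M : MarkData} (hM : M.Wf) {p : ℤ → ℤ} {t : ℤ → Blk} (h : M.Layout p t)
    {k i : ℤ} (h1 : p k ≤ i) (h2 : i < p (k + 1)) : i ∈ M.zone p t ↔ M.InMark (t k) (i - p k) :=
  ⟨fun h3 => by_contra fun h4 => not_mem_zone_of_le hM h h1 h2 h4 h3, fun h3 => ⟨k, h3⟩⟩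

/-- In each row all block patterns have the same colour on their left and right sides, so they can
be juxtaposed in any order. -/
theorem StripRel.tilesStrip {a b s : ℤ} (hok : LevelOk a b s) {h : ℕ}
    {tab : Blk → List ℕ} (htab : PatternOk a b s h tab) {X Y : Set ℤ}
    (hXY : StripRel a b s X Y) : TilesStrip h X Y := by
  obtain ⟨p, t, hp, hi, ho⟩ := hXY
  have hmono : StrictMono p := Layout.strictMono (inData_wf hok) hp
  have hpat : ∀ t, _ := fun t => htab t (by cases t <;> simp)
  choose k hk1 hk2 using exists_mem_interval hmono
  have hj : ∀ x, ∃ j : ℕ, x - p (k x) = j ∧ j < (blkLen a b (t (k x))).toNat := fun x => by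
    have := hk1 x
    have := hk2 x
    have := hp (k x)
    exact ⟨(x - p (k x)).toNat, by omega, by omega⟩
  choose j hj1 hj2 using hj
  have hword : ∀ x, (((patternTile tab (t (k x)) 0 (j x)).s.val,
      (patternTile tab (t (k x)) (h - 1) (j x)).n.val) : ℕ × ℕ) = (
        if ((inData a b s).hd (t (k x)) ≤ j x ∧
          j x < (inData a b s).hd (t (k x)) + (inData a b s).wd (t (k x)) ↔ s ≠ 0) then 1 else 0,
        if ((outData a b s).hd (t (k x)) ≤ j x ∧
          j x < (outData a b s).hd (t (k x)) + (outData a b s).wd (t (k x)) ↔ s = 0)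
            then 1 else 0) := fun x => by
    have h1 := congrArg (fun l => l[j x]?) (hpat (t (k x))).2
    simp only [blkWord] at h1
    simpa [hj2 x] using h1
  have hX : ∀ x, ((inData a b s).InMark (t (k x)) (j x) ↔ s ≠ 0) ↔ x ∈ X := fun x => by
    rw [← hj1, ← mem_zone_iff (inData_wf hok) hp (hk1 x) (hk2 x), ← hi, mem_orient]
    rcases hok.hs with rfl | rfl <;> simp
  have hY : ∀ x, ((outData a b s).InMark (t (k x)) (j x) ↔ s = 0) ↔ x ∈ Y := fun x => by
    rw [← hj1, ← mem_zone_iff (outData_wf hok) hp (hk1 x) (hk2 x), ← ho, mem_orient]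
    rcases hok.hs with rfl | rfl <;> simp
  refine ⟨fun y x => patternTile tab (t (k x)) y (j x), fun y x => tileAt_mem _,
    fun y hy x => ?_, fun y hy x => ?_, fun x => ?_, fun x => ?_⟩
  · obtain ⟨-, h2⟩ := (hpat (t (k x))).1 y hy
    obtain ⟨h3, h4, -⟩ := h2 (j x) (hj2 x)
    have e1 := hj1 x
    have e2 := hj1 (x + 1)
    have e3 := hp (k x)
    have e4 := hk2 x
    have e5 := hj2 x
    have e6 := hp (k x + 1)
    have e7 := hmono (show k x + 1 < k x + 1 + 1 by omega)
    have e8 := hk1 x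
    simp only
    rcases lt_or_ge (x + 1) (p (k x + 1)) with h5 | h5
    · have h6 : k (x + 1) = k x :=
        interval_unique hmono (hk1 (x + 1)) (hk2 (x + 1)) (by omega) h5
      rw [h6] at e2 ⊢
      rw [show j (x + 1) = j x + 1 by omega]
      exact h3 (by omega)
    · have h6 : k (x + 1) = k x + 1 :=
        interval_unique hmono (hk1 (x + 1)) (hk2 (x + 1)) h5 (by omega)
      rw [h6] at e2
      rw [show j (x + 1) = 0 by omega, ((hpat (t (k (x + 1)))).1 y hy).1]
      exact h4 (by omega)
  · exact (((hpat (t (k x))).1 y (by omega)).2 (j x) (hj2 x)).2.2 hy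
  · have h1 := congrArg Prod.fst (hword x)
    exact ⟨fun hx => Fin.ext (h1.trans (if_pos ((hX x).2 hx))),
      fun hx => Fin.ext (h1.trans (if_neg (mt (hX x).1 hx)))⟩
  · have h1 := congrArg Prod.snd (hword x)
    exact ⟨fun hx => Fin.ext (h1.trans (if_pos ((hY x).2 hx))),
      fun hx => Fin.ext (h1.trans (if_neg (mt (hY x).1 hx)))⟩

/-- From level 3 on, a strip is split and its three parts are tiled by induction; levels 0, 1, 2 are
the explicit patterns. -/
theorem LevelRel.tilesStrip (m : ℕ) {X Y : Set ℤ} (h : LevelRel m X Y) :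
    ∃ k : ℕ, m < k ∧ TilesStrip k X Y := by
  induction m using Nat.strong_induction_on generalizing X Y with
  | _ m ih =>
    match m, ih, h with
    | 0, _, h => exact ⟨4, by omega, StripRel.tilesStrip (levelPar_ok 0) patternB_ok h⟩
    | 1, _, h => exact ⟨10, by omega, StripRel.tilesStrip (levelPar_ok 1) patternAA_ok h⟩
    | 2, _, h => exact ⟨13, by omega, StripRel.tilesStrip (levelPar_ok 2) patternBAB_ok h⟩
    | m + 3, ih, h =>
      obtain ⟨Z, W, h1, h2, h3⟩ := h.split
      obtain ⟨k₁, hk₁, s₁⟩ := ih (m + 1) (by omega) h1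
      obtain ⟨k₂, hk₂, s₂⟩ := ih m (by omega) h2
      obtain ⟨k₃, hk₃, s₃⟩ := ih (m + 1) (by omega) h3
      exact ⟨k₁ + k₂ + k₃, by omega,
        (s₁.stack (by omega) (by omega) s₂).stack (by omega) (by omega) s₃⟩

theorem exists_levelRel (m : ℕ) : ∃ X Y, LevelRel m X Y := by
  obtain ⟨p, -, hp⟩ := exists_int_partialSum
    (fun _ => blkLen (levelPar m).1 (levelPar m).2.1 .A)
  have key : ∀ s (Z : Set ℤ), orient s (orient s Z) = Z := by
    intro s Z; unfold orient; split <;> simp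
  exact ⟨_, _, p, fun _ => .A, hp, key _ _, key _ _⟩

theorem tilesPlane : wangT'.TilesPlane := by
  have hbox : ∀ n : ℕ, ∃ f : ℤ → ℤ → WangTile (Fin 4) (Fin 4), (∀ x y, f x y ∈ wangT'.tiles) ∧
      ∀ x y : ℤ, -(n : ℤ) ≤ y → y ≤ n → (f x y).e = (f (x + 1) y).w ∧ (f x y).n = (f x (y + 1)).s := by
    intro n
    -- A strip of more than `2 * n + 2` rows, shifted down by `n`, covers the heights from `-n` to
    -- `n + 1`.
    obtain ⟨X, Y, h⟩ := exists_levelRel (2 * n + 2)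
    obtain ⟨k, hk, f, h1, h2, h3, -⟩ := h.tilesStrip
    refine ⟨fun x y => f (y + n).toNat x, fun x y => h1 _ _, fun x y hy hy' => ?_⟩
    refine ⟨h2 _ (by omega) x, ?_⟩
    simp only
    rw [show (y + 1 + n).toNat = (y + n).toNat + 1 by omega]
    exact h3 _ (by omega) x
  choose f hf hm using hbox
  -- Only finitely many tiles compete for a cell, so along a free ultrafilter each cell has a limit
  -- tile. A matching condition involves two cells and therefore holds in the limit.
  have hlim : ∀ x y, ∃ t ∈ wangT'.tiles, ∀ᶠ n in (Filter.hyperfilter ℕ : Filter ℕ),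
      f n x y = t := fun x y =>
    (Ultrafilter.eventually_exists_mem_iff (f := Filter.hyperfilter ℕ)
      (P := fun t n => f n x y = t) wangT'.tiles.finite_toSet).1
      (Filter.Eventually.of_forall fun n => ⟨_, hf n x y, rfl⟩)
  choose g hg hgf using hlim
  have hge : ∀ m : ℕ, ∀ᶠ n in (Filter.hyperfilter ℕ : Filter ℕ), m ≤ n := fun m =>
    Nat.hyperfilter_le_atTop (Filter.eventually_ge_atTop m)
  refine ⟨fun c => g c.1 c.2, fun x y => hg x y, fun x y => ?_, fun x y => ?_⟩
  · obtain ⟨n, h1, h2, h3⟩ := ((hgf x y).and ((hgf (x + 1) y).and (hge y.natAbs))).exists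
    have := (hm n x y (by omega) (by omega)).1
    rwa [h1, h2] at this
  · obtain ⟨n, h1, h2, h3⟩ := ((hgf x y).and ((hgf x (y + 1)).and (hge y.natAbs))).exists
    have := (hm n x y (by omega) (by omega)).2
    rwa [h1, h2] at this

theorem mainTheorem3 :
    wangT.tiles.card = 11 ∧ wangT'.tiles.card = 11 ∧
      wangT' = wangT.mapVertical mergeFourZero ∧ wangT'.IsAperiodic := by
  refine ⟨by decide, by decide, ?_, tilesPlane, fun f hf => not_isPeriodicTiling hf⟩
  unfold WangSet.mapVertical
  exact congrArg WangSet.mk (by decide)
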